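/- Let $(\Sigma,g)$ be a smooth Riemannian $3$-manifold with Levi-Civita connection $\nabla$ and Schouten tensor $P=\mathrm{Ric}-\tfrac14 R\,g$ (with $P(u)$ defined by $g(P(u),v)=P(u,v)$), let $a<b$, and let $x(t)$, $a\le t\le b$, be a regular curve in $\Sigma$, that is, a smooth curve with nowhere vanishing velocity. Call $x$ a conformal geodesic if on $[a,b]$ $$\dot x\wedge\Bigl(\nabla_{\dot x}\nabla_{\dot x}\dot x-\frac{3g(\dot x,\nabla_{\dot x}\dot x)}{|\dot x|^2}\nabla_{\dot x}\dot x-|\dot x|^2P(\dot x)\Bigr)=0 .$$ Fix an orientation of $x^*T\Sigma$ (for instance one induced by an orientation of $\Sigma$), and oriented orthonormal bases $A=(e_1,e_2,\dot x(a)/|\dot x(a)|)$ of $T_{x(a)}\Sigma$ and $B=(e_1',e_2',\dot x(b)/|\dot x(b)|)$ of $T_{x(b)}\Sigma$. By a variation of $x$ we mean a smooth family $x_\epsilon(t)$, $|\epsilon|<\delta$, $a\le t\le b$, of regular curves with $x_0=x$ such that $x_\epsilon(a),\ x_\epsilon(b)$ and the unit tangents $\dot x_\epsilon/|\dot x_\epsilon|$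 at $t=a$ and $t=b$ do not depend on $\epsilon$. For a curve $y$ of a variation let $\mathscr T[y]\in\mathbb R/2\pi\mathbb Z\cong \mathrm{SO}(\dot y(a)^\perp)$ be its total torsion $h^{-1}\circ\mathcal P$, where $\mathcal P:\dot y(a)^\perp\to\dot y(b)^\perp$ is the parallel transport of the normal connection $\nabla^\perp$ along $y$, $h:\dot y(a)^\perp\to\dot y(b)^\perp$ is the linear map with $h(e_i)=e_i'$, and the angle is measured from $e_1$ towards $e_2$; the same $A$, $B$ are used for all $y$. (1) The curve $x$ is a conformal geodesic if and only if it is a critical curve of the total torsion, i.e. $\frac{d}{d\epsilon}\big|_{\epsilon=0}\mathscr T[x_\epsilon]=0$ for every variation $x_\epsilon$ of $x$. (2) Suppose that $\dot x\times\nabla_{\dot x}\dot x\ne0$ on $[a,b]$. Then $\mathscr T$ may be replaced by the integral of torsion $$\int_a^b\tau|\dot x|\,dt=\int_a^b\frac{\det(\dot x,\nabla_{\dot x}\dot x,\nabla_{\dot x}\nabla_{\dot x}\dot x)}{|\dot x\times\nabla_{\dot x}\dot x|^2}|\dot x|\,dt ,$$ provided that the end frames given by the principal normals are common to all curves: if $\nu_\epsilon$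 denotes the unit principal normal of $x_\epsilon$ (the normalized component of $\nabla_{\dot x_\epsilon}\dot x_\epsilon$ orthogonal to $\dot x_\epsilon$), then $x$ is a conformal geodesic if and only if $\frac{d}{d\epsilon}\big|_{\epsilon=0}\int_a^b\tau_\epsilon|\dot x_\epsilon|\,dt=0$ for every variation of $x$ for which the angle from $h(\nu_\epsilon(a))$ to $\nu_\epsilon(b)$ does not depend on $\epsilon$; and also if and only if this holds for every variation of $x$ for which $\nu_\epsilon(a)$ and $\nu_\epsilon(b)$ do not depend on $\epsilon$. -/

import Mathlib

open Set Filter Bundle MeasureTheory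
open scoped Manifold ContDiff Topology Matrix

noncomputable section

namespace ConfGeod

/-- The model space of a 3-manifold. -/
abbrev E3 : Type := EuclideanSpace ℝ (Fin 3)

variable {M : Type*} [TopologicalSpace M] [ChartedSpace E3 M]

/-! ### Coordinates -/

/-- Components of tangent vectors at `p` in the preferred chart around `c`
(meaningful for `p` in the domain of that chart). -/
def toCoord (c p : M) : TangentSpace (𝓡 3) p →L[ℝ] E3 :=
  mfderiv (𝓡 3) 𝓘(ℝ, E3) (extChartAt (𝓡 3) c) p

/-- The tangent vector at `p` with prescribed components in the preferred chart around `c`. -/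
def fromCoord (c p : M) : E3 →L[ℝ] TangentSpace (𝓡 3) p :=
  (toCoord c p).inverse

/-- The coordinate vector `∂ᵢ` at `p` in the chart around `c`. -/
def coordVec (c p : M) (i : Fin 3) : TangentSpace (𝓡 3) p :=
  fromCoord c p (EuclideanSpace.single i 1)

/-- Partial derivative `∂ₖ f` of a function of the coordinates. -/
def pd (k : Fin 3) (f : E3 → ℝ) (y : E3) : ℝ :=
  fderiv ℝ f y (EuclideanSpace.single k 1)

variable [IsManifold (𝓡 3) ∞ M]

variable (M) in
/-- Smooth Riemannian metrics on `M`. -/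
abbrev Metric3 : Type _ :=
  ContMDiffRiemannianMetric (𝓡 3) ∞ E3 (fun p : M ↦ TangentSpace (𝓡 3) p)

variable (g : Metric3 M)

/-! ### Levi-Civita connection and curvature, in the chart around `c` -/

/-- `g_{ij}` as a function of the coordinates. -/
def metricCoeff (c : M) (i j : Fin 3) (y : E3) : ℝ :=
  g.inner ((extChartAt (𝓡 3) c).symm y)
    (coordVec c ((extChartAt (𝓡 3) c).symm y) i) (coordVec c ((extChartAt (𝓡 3) c).symm y) j)

/-- `g^{ij}`. -/
def invCoeff (c : M) (i j : Fin 3) (y : E3) : ℝ :=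
  (Matrix.of fun k l ↦ metricCoeff g c k l y)⁻¹ i j

/-- Christoffel symbols `Γ^k_{ij}`. -/
def christoffel (c : M) (k i j : Fin 3) (y : E3) : ℝ :=
  (1 / 2) * ∑ l, invCoeff g c k l y *
    (pd i (metricCoeff g c j l) y + pd j (metricCoeff g c i l) y - pd l (metricCoeff g c i j) y)

/-- Curvature tensor `R_{ij}{}^k{}_l`, defined by
`(∇_i ∇_j - ∇_j ∇_i) X^k = R_{ij}{}^k{}_l X^l`. -/
def riemann (c : M) (i j k l : Fin 3) (y : E3) : ℝ :=
  pd i (christoffel g c k j l) y - pd j (christoffel g c k i l) y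
    + ∑ m, (christoffel g c k i m y * christoffel g c m j l y
        - christoffel g c k j m y * christoffel g c m i l y)

/-- Ricci tensor `R_{ij} = R_{ki}{}^k{}_j`. -/
def ricci (c : M) (i j : Fin 3) (y : E3) : ℝ := ∑ k, riemann g c k i k j y

/-- Scalar curvature. -/
def scalarCurv (c : M) (y : E3) : ℝ := ∑ i, ∑ j, invCoeff g c i j y * ricci g c i j y

/-- Schouten tensor `P_{ij} = R_{ij} - R g_{ij} / 4` in dimension three. -/
def schouten (c : M) (i j : Fin 3) (y : E3) : ℝ :=
  ricci g c i j y - (1 / 4) * scalarCurv g c y * metricCoeff g c i j y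

/-- The endomorphism `P(u)^i = P^i{}_j u^j` of `T_p M`, computed in the chart around `p`. -/
def schoutenOp (p : M) (u : TangentSpace (𝓡 3) p) : TangentSpace (𝓡 3) p :=
  ∑ i, (∑ k, ∑ j, invCoeff g p i k (extChartAt (𝓡 3) p p) *
    schouten g p k j (extChartAt (𝓡 3) p p) * toCoord p p u j) • coordVec p p i

/-! ### Linear algebra in a tangent space -/

/-- The length `|u|`. -/
def len {p : M} (u : TangentSpace (𝓡 3) p) : ℝ := √(g.inner p u u)

/-- `f` is an orthonormal basis of `T_p M`. -/
def IsOrthonormal {p : M} (f : Fin 3 → TangentSpace (𝓡 3) p) : Prop :=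
  ∀ i j, g.inner p (f i) (f j) = if i = j then 1 else 0

/-- Determinant of three vectors with respect to the orientation of an orthonormal basis `f`. -/
def det3 {p : M} (f : Fin 3 → TangentSpace (𝓡 3) p) (u v w : TangentSpace (𝓡 3) p) : ℝ :=
  Matrix.det (Matrix.of fun i j ↦ g.inner p (f i) (![u, v, w] j))

/-- Cross product with respect to the orientation of an orthonormal basis `f`. -/
def cross {p : M} (f : Fin 3 → TangentSpace (𝓡 3) p) (u v : TangentSpace (𝓡 3) p) :
    TangentSpace (𝓡 3) p :=
  ∑ k, (((fun i ↦ g.inner p (f i) u) ⨯₃ (fun i ↦ g.inner p (f i) v)) k) • f k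

/-- `u` and `v` are bases of the same tangent space, related by a matrix of positive
determinant. -/
def SameOrientation {p q : M} (u : Fin 3 → TangentSpace (𝓡 3) p)
    (v : Fin 3 → TangentSpace (𝓡 3) q) : Prop :=
  ∃ R : Matrix (Fin 3) (Fin 3) ℝ, 0 < R.det ∧
    ∀ i, (⟨p, u i⟩ : TangentBundle (𝓡 3) M) = ⟨q, ∑ j, R i j • v j⟩

/-- The bivector `u ∧ w` vanishes (evaluated on all pairs of covectors). -/
def WedgeEqZero {p : M} (u w : TangentSpace (𝓡 3) p) : Prop :=
  ∀ α β : TangentSpace (𝓡 3) p →L[ℝ] ℝ, α u * β w - α w * β u = 0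

/-! ### Curves `γ(t)`, `a ≤ t ≤ b`

Curves are functions on `ℝ` of which only the restriction to `[a, b]` matters; all derivatives
are taken within `[a, b]`. -/

variable (a b : ℝ) (γ : ℝ → M)

/-- The velocity `γ̇(t)`. -/
def velocity (t : ℝ) : TangentSpace (𝓡 3) (γ t) :=
  mfderivWithin 𝓘(ℝ, ℝ) (𝓡 3) γ (Icc a b) t (1 : ℝ)

/-- The unit tangent `T = γ̇ / |γ̇|`. -/
def unitTangent (t : ℝ) : TangentSpace (𝓡 3) (γ t) :=
  (len g (velocity a b γ t))⁻¹ • velocity a b γ t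

/-- Smooth on `[a, b]` with nowhere vanishing velocity. -/
structure IsRegularCurve : Prop where
  smooth : ContMDiffOn 𝓘(ℝ, ℝ) (𝓡 3) ∞ γ (Icc a b)
  velocity_ne : ∀ t ∈ Icc a b, velocity a b γ t ≠ 0

/-- The Levi-Civita covariant derivative `∇_γ̇ V` of a vector field along `γ`:
`(∇_γ̇ V)^k = dV^k/dt + Γ^k_{ij} γ̇^i V^j` in the chart around `γ t`. -/
def covDeriv (V : ∀ t, TangentSpace (𝓡 3) (γ t)) (t : ℝ) : TangentSpace (𝓡 3) (γ t) :=
  ∑ k, (derivWithin (fun s ↦ toCoord (γ t) (γ s) (V s) k) (Icc a b) t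
    + ∑ i, ∑ j, christoffel g (γ t) k i j (extChartAt (𝓡 3) (γ t) (γ t))
      * toCoord (γ t) (γ t) (velocity a b γ t) i * toCoord (γ t) (γ t) (V t) j)
    • coordVec (γ t) (γ t) k

/-- `∇_γ̇ γ̇`. -/
def accel (t : ℝ) : TangentSpace (𝓡 3) (γ t) := covDeriv g a b γ (velocity a b γ) t

/-- `∇_γ̇ ∇_γ̇ γ̇`. -/
def jerk (t : ℝ) : TangentSpace (𝓡 3) (γ t) := covDeriv g a b γ (accel g a b γ) t

/-- A regular curve is a conformal geodesic if
`γ̇ ∧ (∇_γ̇ ∇_γ̇ γ̇ - 3 g(γ̇, ∇_γ̇ γ̇) / |γ̇|² ∇_γ̇ γ̇ - |γ̇|² P(γ̇)) = 0`. -/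
def IsConformalGeodesic : Prop :=
  IsRegularCurve a b γ ∧ ∀ t ∈ Icc a b,
    WedgeEqZero (velocity a b γ t)
      (jerk g a b γ t
        - (3 * g.inner (γ t) (velocity a b γ t) (accel g a b γ t)
            / (len g (velocity a b γ t)) ^ 2) • accel g a b γ t
        - (len g (velocity a b γ t)) ^ 2 • schoutenOp g (γ t) (velocity a b γ t))

/-- Orthogonal projection of `w` to `γ̇(t)^⊥`. -/
def normalPart (t : ℝ) (w : TangentSpace (𝓡 3) (γ t)) : TangentSpace (𝓡 3) (γ t) :=
  w - g.inner (γ t) w (unitTangent g a b γ t) • unitTangent g a b γ t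

/-- `N` is a smooth normal vector field along `γ` which is parallel for the normal connection
`∇^⊥`. -/
structure IsNormalParallel (N : ∀ t, TangentSpace (𝓡 3) (γ t)) : Prop where
  smooth : ContMDiffOn 𝓘(ℝ, ℝ) (𝓡 3).tangent ∞
    (fun t ↦ (⟨γ t, N t⟩ : TangentBundle (𝓡 3) M)) (Icc a b)
  normal : ∀ t ∈ Icc a b, g.inner (γ t) (N t) (velocity a b γ t) = 0
  parallel : ∀ t ∈ Icc a b, normalPart g a b γ t (covDeriv g a b γ N t) = 0

/-- `θ ∈ ℝ / 2πℤ` is the total torsion of `γ` with respect to the frames `A` at `γ a` and `B` at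
`γ b`: the normal parallel transport takes `A 0`, `A 1` to the image of `B 0`, `B 1` under the
rotation by `θ`; that is, `h⁻¹ ∘ P` is the rotation by `θ` of the oriented plane with basis
`A 0`, `A 1`, where `P` is the normal parallel transport and `h (A i) = B i`. -/
def IsTotalTorsion {p q : M} (A : Fin 3 → TangentSpace (𝓡 3) p) (B : Fin 3 → TangentSpace (𝓡 3) q)
    (θ : Real.Angle) : Prop :=
  ∃ N₀ N₁ : ∀ t, TangentSpace (𝓡 3) (γ t),
    IsNormalParallel g a b γ N₀ ∧ IsNormalParallel g a b γ N₁ ∧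
    (⟨γ a, N₀ a⟩ : TangentBundle (𝓡 3) M) = ⟨p, A 0⟩ ∧
    (⟨γ a, N₁ a⟩ : TangentBundle (𝓡 3) M) = ⟨p, A 1⟩ ∧
    (⟨γ b, N₀ b⟩ : TangentBundle (𝓡 3) M) = ⟨q, θ.cos • B 0 + θ.sin • B 1⟩ ∧
    (⟨γ b, N₁ b⟩ : TangentBundle (𝓡 3) M) = ⟨q, -θ.sin • B 0 + θ.cos • B 1⟩

/-- A continuous orthonormal frame field along `γ`. Such a frame represents an orientation of the
pulled-back tangent bundle `γ^* TM`; every orientation of it arises in this way, in particular the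
one induced by an orientation of `M`. -/
structure IsFrameAlong (F : ∀ t, Fin 3 → TangentSpace (𝓡 3) (γ t)) : Prop where
  continuous : ∀ i, ContinuousOn (fun t ↦ (⟨γ t, F t i⟩ : TangentBundle (𝓡 3) M)) (Icc a b)
  orthonormal : ∀ t ∈ Icc a b, IsOrthonormal g (F t)

/-- The torsion `τ = det(γ̇, ∇_γ̇ γ̇, ∇_γ̇ ∇_γ̇ γ̇) / |γ̇ × ∇_γ̇ γ̇|²`, for the orientation along `γ`
given by the frame `F`. -/
def torsion (F : ∀ t, Fin 3 → TangentSpace (𝓡 3) (γ t)) (t : ℝ) : ℝ :=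
  det3 g (F t) (velocity a b γ t) (accel g a b γ t) (jerk g a b γ t)
    / (len g (cross g (F t) (velocity a b γ t) (accel g a b γ t))) ^ 2

/-- The integral of torsion `∫ τ |γ̇| dt`. -/
def torsionIntegral (F : ∀ t, Fin 3 → TangentSpace (𝓡 3) (γ t)) : ℝ :=
  ∫ t in a..b, torsion g a b γ F t * len g (velocity a b γ t)

/-- The unit principal normal: the normalized normal part of the acceleration. -/
def principalNormal (t : ℝ) : TangentSpace (𝓡 3) (γ t) :=
  (len g (normalPart g a b γ t (accel g a b γ t)))⁻¹ • normalPart g a b γ t (accel g a b γ t)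

/-! ### Variations and critical curves -/

/-- `X ε t`, `|ε| < δ`, `a ≤ t ≤ b`, is a smooth variation of `γ` through regular curves which
fixes the endpoints and the unit tangents at the endpoints. -/
structure IsVariation (δ : ℝ) (X : ℝ → ℝ → M) : Prop where
  pos : 0 < δ
  zero : X 0 = γ
  smooth : ContMDiffOn 𝓘(ℝ, ℝ × ℝ) (𝓡 3) ∞ (fun z : ℝ × ℝ ↦ X z.1 z.2) (Ioo (-δ) δ ×ˢ Icc a b)
  regular : ∀ ε ∈ Ioo (-δ) δ, IsRegularCurve a b (X ε)
  left : ∀ ε ∈ Ioo (-δ) δ, (⟨X ε a, unitTangent g a b (X ε) a⟩ : TangentBundle (𝓡 3) M)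
    = ⟨γ a, unitTangent g a b γ a⟩
  right : ∀ ε ∈ Ioo (-δ) δ, (⟨X ε b, unitTangent g a b (X ε) b⟩ : TangentBundle (𝓡 3) M)
    = ⟨γ b, unitTangent g a b γ b⟩

/-- `γ` is a critical curve of the total torsion, computed with common `A`, `B`: along every
variation, the `ℝ / 2πℤ`-valued function `ε ↦ 𝒯[X ε]` has derivative `0` at `ε = 0` (it has, near
`0`, a real lift with derivative `0`). -/
def IsCriticalForTotalTorsion {p q : M} (A : Fin 3 → TangentSpace (𝓡 3) p)
    (B : Fin 3 → TangentSpace (𝓡 3) q) : Prop :=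
  ∀ (δ : ℝ) (X : ℝ → ℝ → M), IsVariation g a b γ δ X →
    ∃ f : ℝ → ℝ, (∀ᶠ ε in 𝓝 0, IsTotalTorsion g a b (X ε) A B (f ε : Real.Angle)) ∧
      HasDerivAt f 0 0

/-- `γ` is a critical curve of the integral of torsion under those variations that belong to the
class `K`. Each curve `X ε` carries the orientation for which `A` is positive at its starting
point, represented by a frame `F ε`. -/
def IsCriticalForTorsionIntegral {p : M} (A : Fin 3 → TangentSpace (𝓡 3) p)
    (K : ℝ → (ℝ → ℝ → M) → Prop) : Prop :=
  ∀ (δ : ℝ) (X : ℝ → ℝ → M), IsVariation g a b γ δ X → K δ X →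
    ∀ F : ∀ ε t, Fin 3 → TangentSpace (𝓡 3) (X ε t),
      (∀ ε ∈ Ioo (-δ) δ, IsFrameAlong g a b (X ε) (F ε) ∧ SameOrientation (F ε a) A) →
      HasDerivAt (fun ε ↦ torsionIntegral g a b (X ε) (F ε)) 0 0

/-- All curves of the variation have the same principal normals at the endpoints, that is, the
adapted frames `(ν, T × ν, T)` at the endpoints are common to all of them. -/
def FixesPrincipalNormals (δ : ℝ) (X : ℝ → ℝ → M) : Prop :=
  ∀ ε ∈ Ioo (-δ) δ,
    (⟨X ε a, principalNormal g a b (X ε) a⟩ : TangentBundle (𝓡 3) M)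
      = ⟨γ a, principalNormal g a b γ a⟩ ∧
    (⟨X ε b, principalNormal g a b (X ε) b⟩ : TangentBundle (𝓡 3) M)
      = ⟨γ b, principalNormal g a b γ b⟩

/-- The angle `c` from `h (ν(a))` to `ν(b)` is the same for all curves of the variation, where
`ν` is the principal normal and `h (A i) = B i`. -/
def FixesNormalAngle {p q : M} (A : Fin 3 → TangentSpace (𝓡 3) p)
    (B : Fin 3 → TangentSpace (𝓡 3) q) (δ : ℝ) (X : ℝ → ℝ → M) : Prop :=
  ∃ c : Real.Angle, ∀ ε ∈ Ioo (-δ) δ, ∃ α : Real.Angle,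
    (⟨X ε a, principalNormal g a b (X ε) a⟩ : TangentBundle (𝓡 3) M)
      = ⟨p, α.cos • A 0 + α.sin • A 1⟩ ∧
    (⟨X ε b, principalNormal g a b (X ε) b⟩ : TangentBundle (𝓡 3) M)
      = ⟨q, (α + c).cos • B 0 + (α + c).sin • B 1⟩

end ConfGeod

end

open Set Filter Bundle MeasureTheory
open scoped Manifold ContDiff Topology Matrix

noncomputable section

namespace ConfGeod

set_option maxSynthPendingDepth 3

/-! Along a curve take an orthonormal frame (E₀, E₁, E₂) whose last vector is the unit tangent, and
write ωᵢⱼ = g(∇Eᵢ, Eⱼ). A unit normal field at angle ψ from E₀ is parallel for ∇^⊥ exactly when ψ' =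
-ω₀₁(∂_t). Hence the total torsion is α - β - ∫ ω₀₁(∂_t) dt modulo 2π, where α and β are the angles
from the frame to A and B at the ends (`isTotalTorsion_of_frame`). If the frame is defined over the
whole rectangle of a variation and is constant at the ends, then α and β do not depend on ε, and
only the derivative of ∫ ω₀₁(∂_t) dt is needed.

Let W be the variation field, with components Wᵢ, and let v be the speed. Cartan's structure
equation expresses ∂_ε ω₀₁(∂_t) as ∂_t ω₀₁(∂_ε), plus the curvature g(R(W, ẋ)E₀, E₁), plus products
of ωᵢ₂(∂_t) with ωⱼ₂(∂_ε). In dimension three the curvature term consists of off-diagonal Ricci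
components, which are Schouten components (`inner_schoutenOp_of_ne`). The identity ∇_ε ẋ = ∇_t W
trades ωⱼ₂(∂_ε) for t-derivatives of W₀ and W₁, and a product rule moves these derivatives onto
ωᵢ₂(∂_t)/v. The coefficient 3 in the conformal geodesic equation is the one for which the normal
component Jᵢ of `geodesicDefect` contains -v² (ωᵢ₂/v)'. The outcome (`first_variation`) is ∂_ε
ω₀₁(∂_t) = ∂_t B + v⁻² (W₀ J₁ - W₁ J₀), with B = 0 at both ends because the end data are fixed.

So the derivative of the total torsion is -∫ v⁻² (W₀ J₁ - W₁ J₀) dt. It vanishes for all variations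
if J is tangent to the curve, which is the conformal geodesic equation. Otherwise J has a normal
component at some interior time, and a bump variation directed there along J₁ E₀ - J₀ E₁ makes the
integral of v⁻² (W₀ J₁ - W₁ J₀) positive (`exists_noncritical_variation`).

For the integral of torsion, τ|ẋ| equals ω₀₁(∂_t) plus the angular velocity of the principal normal
in the frame (E₀, E₁) (`torsion_mul_len`). The total turning of the principal normal is determined
modulo 2π by its end angles, so it has derivative zero whenever the angle between the end normals is
fixed (`hasDerivAt_torsionIntegral`). Bump variations do not move the curve near its ends, so they
belong even to the smaller class with fixed principal normals, and all the criticality conditions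
are equivalent.

Two constructions support this. The covariant derivative of the statement uses the chart around the
moving point; its independence of the chart is proved for isometries between open subsets of a
vector space. The adapted frame (`exists_adaptedFrame`) comes from smoothing the given continuous
frame and completing the tangent by cross products with a generic constant vector. -/

/-! ### Levi-Civita connections on open subsets of a vector space -/

section VectorSpace

variable {E : Type*} [NormedAddCommGroup E] [NormedSpace ℝ E]

/-- The bilinear map `Γ` is the Christoffel map of the metric `G` on the open set `U`. -/
structure IsLeviCivita (U : Set E) (G : E → E →L[ℝ] E →L[ℝ] ℝ) (Γ : E → E →L[ℝ] E →L[ℝ] E) :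
    Prop where
  isOpen : IsOpen U
  contDiff_metric : ContDiffOn ℝ ∞ G U
  contDiff_christoffel : ContDiffOn ℝ ∞ Γ U
  symm : ∀ y ∈ U, ∀ u v, G y u v = G y v u
  pos : ∀ y ∈ U, ∀ v, v ≠ 0 → 0 < G y v v
  koszul : ∀ y ∈ U, ∀ u v w, 2 * G y (Γ y u v) w =
    fderiv ℝ G y u v w + fderiv ℝ G y v u w - fderiv ℝ G y w u v

/-- The curvature `R(u, v) w` of the connection with Christoffel map `Γ`. -/
def curvature (Γ : E → E →L[ℝ] E →L[ℝ] E) (y u v w : E) : E :=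
  fderiv ℝ Γ y u v w - fderiv ℝ Γ y v u w + Γ y u (Γ y v w) - Γ y v (Γ y u w)

section Smooth

variable {F : Type*} [NormedAddCommGroup F] [NormedSpace ℝ F]

lemma contDiffAt_fderiv {f : E → F} {x : E} (h : ContDiffAt ℝ ∞ f x) :
    ContDiffAt ℝ ∞ (fderiv ℝ f) x :=
  h.fderiv_right (m := ∞) (by simp)

lemma _root_.ContDiffAt.hasFDerivAt_infty {f : E → F} {x : E} (h : ContDiffAt ℝ ∞ f x) :
    HasFDerivAt f (fderiv ℝ f x) x :=
  (h.differentiableAt (by simp)).hasFDerivAt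

lemma _root_.ContDiffWithinAt.hasFDerivWithinAt_infty {f : E → F} {s : Set E} {x : E}
    (h : ContDiffWithinAt ℝ ∞ f s x) : HasFDerivWithinAt f (fderivWithin ℝ f s x) s x :=
  (h.differentiableWithinAt (by simp)).hasFDerivWithinAt

lemma fderiv_fderiv_comm {f : E → F} {x : E} (h : ContDiffAt ℝ ∞ f x) (u v : E) :
    fderiv ℝ (fderiv ℝ f) x u v = fderiv ℝ (fderiv ℝ f) x v u :=
  (h.isSymmSndFDerivAt (by simpa using ENat.LEInfty.out)).eq u v

end Smooth

namespace IsLeviCivita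

variable {U : Set E} {G : E → E →L[ℝ] E →L[ℝ] ℝ} {Γ : E → E →L[ℝ] E →L[ℝ] E}

section
variable (h : IsLeviCivita U G Γ)
include h

lemma contDiffAt_metric {y : E} (hy : y ∈ U) : ContDiffAt ℝ ∞ G y :=
  h.contDiff_metric.contDiffAt (h.isOpen.mem_nhds hy)

lemma contDiffAt_christoffel {y : E} (hy : y ∈ U) : ContDiffAt ℝ ∞ Γ y :=
  h.contDiff_christoffel.contDiffAt (h.isOpen.mem_nhds hy)

lemma eq_of_inner {y : E} (hy : y ∈ U) {u v : E} (huv : ∀ w, G y u w = G y v w) : u = v := by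
  by_contra hne
  have := h.pos y hy (u - v) (sub_ne_zero.2 hne)
  have e : G y (u - v) (u - v) = G y u (u - v) - G y v (u - v) := by simp
  rw [e, huv (u - v), sub_self] at this
  exact lt_irrefl _ this

lemma fderiv_metric_symm {y : E} (hy : y ∈ U) (u v w : E) :
    fderiv ℝ G y u v w = fderiv ℝ G y u w v := by
  have hG := (h.contDiffAt_metric hy).hasFDerivAt_infty
  have h1 : HasFDerivAt (fun z ↦ G z v w) _ y :=
    (hG.clm_apply (hasFDerivAt_const v y)).clm_apply (hasFDerivAt_const w y)
  have h2 : HasFDerivAt (fun z ↦ G z w v) _ y :=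
    (hG.clm_apply (hasFDerivAt_const w y)).clm_apply (hasFDerivAt_const v y)
  have h3 : (fun z ↦ G z v w) =ᶠ[𝓝 y] fun z ↦ G z w v := by
    filter_upwards [h.isOpen.mem_nhds hy] with z hz using h.symm z hz v w
  have := h1.unique (h2.congr_of_eventuallyEq h3)
  simpa using DFunLike.congr_fun this u

/-- The Koszul formulas for (u, v, w) and (u, w, v) add up to twice the derivative of the metric
along u; the other terms cancel by symmetry. -/
lemma metric_compat {y : E} (hy : y ∈ U) (u v w : E) :
    fderiv ℝ G y u v w = G y (Γ y u v) w + G y v (Γ y u w) := by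
  have h1 := h.koszul y hy u v w
  have h2 := h.koszul y hy u w v
  rw [h.symm y hy v]
  linarith [h.fderiv_metric_symm hy u v w, h.fderiv_metric_symm hy v u w,
    h.fderiv_metric_symm hy w u v]

lemma christoffel_symm {y : E} (hy : y ∈ U) (u v : E) : Γ y u v = Γ y v u := by
  refine h.eq_of_inner hy fun w ↦ ?_
  have h1 := h.koszul y hy u v w
  have h2 := h.koszul y hy v u w
  linarith [h.fderiv_metric_symm hy w u v]

omit h in
lemma curvature_swap (y u v w : E) : curvature Γ y u v w = -curvature Γ y v u w := by
  simp only [curvature]; abel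

lemma fderiv_christoffel_symm {y : E} (hy : y ∈ U) (u v w : E) :
    fderiv ℝ Γ y u v w = fderiv ℝ Γ y u w v := by
  have hG := (h.contDiffAt_christoffel hy).hasFDerivAt_infty
  have h1 : HasFDerivAt (fun z ↦ Γ z v w) _ y :=
    (hG.clm_apply (hasFDerivAt_const v y)).clm_apply (hasFDerivAt_const w y)
  have h2 : HasFDerivAt (fun z ↦ Γ z w v) _ y :=
    (hG.clm_apply (hasFDerivAt_const w y)).clm_apply (hasFDerivAt_const v y)
  have h3 : (fun z ↦ Γ z v w) =ᶠ[𝓝 y] fun z ↦ Γ z w v := by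
    filter_upwards [h.isOpen.mem_nhds hy] with z hz using h.christoffel_symm hz v w
  have := h1.unique (h2.congr_of_eventuallyEq h3)
  simpa using DFunLike.congr_fun this u

lemma bianchi {y : E} (hy : y ∈ U) (u v w : E) :
    curvature Γ y u v w + curvature Γ y v w u + curvature Γ y w u v = 0 := by
  simp only [curvature]
  rw [h.fderiv_christoffel_symm hy u v w, h.fderiv_christoffel_symm hy v w u,
    h.fderiv_christoffel_symm hy w u v, h.christoffel_symm hy v w, h.christoffel_symm hy u w,
    h.christoffel_symm hy v u]
  abel

/-- Differentiating metric compatibility once more expresses the second derivative of the metric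
through Γ and its derivative. That second derivative is symmetric in the two directions, and its
antisymmetrization is exactly the sum of the two curvature terms. -/
lemma curvature_antisymm {y : E} (hy : y ∈ U) (u v w z : E) :
    G y (curvature Γ y u v w) z = -G y w (curvature Γ y u v z) := by
  have key : ∀ u v : E, fderiv ℝ (fderiv ℝ G) y v u w z =
      fderiv ℝ G y v (Γ y u w) z + G y (fderiv ℝ Γ y v u w) z
        + fderiv ℝ G y v w (Γ y u z) + G y w (fderiv ℝ Γ y v u z) := by
    intro u v
    have hG := (h.contDiffAt_metric hy).hasFDerivAt_infty
    have hΓ := (h.contDiffAt_christoffel hy).hasFDerivAt_infty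
    have hDG := (contDiffAt_fderiv (h.contDiffAt_metric hy)).hasFDerivAt_infty
    have h1 : HasFDerivAt (fun x ↦ fderiv ℝ G x u w z) _ y :=
      ((hDG.clm_apply (hasFDerivAt_const u y)).clm_apply (hasFDerivAt_const w y)).clm_apply
        (hasFDerivAt_const z y)
    have hΓw : HasFDerivAt (fun x ↦ Γ x u w) _ y :=
      (hΓ.clm_apply (hasFDerivAt_const u y)).clm_apply (hasFDerivAt_const w y)
    have hΓz : HasFDerivAt (fun x ↦ Γ x u z) _ y :=
      (hΓ.clm_apply (hasFDerivAt_const u y)).clm_apply (hasFDerivAt_const z y)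
    have h2 : HasFDerivAt (fun x ↦ G x (Γ x u w) z + G x w (Γ x u z)) _ y :=
      ((hG.clm_apply hΓw).clm_apply (hasFDerivAt_const z y)).add
        ((hG.clm_apply (hasFDerivAt_const w y)).clm_apply hΓz)
    have h3 : (fun x ↦ fderiv ℝ G x u w z) =ᶠ[𝓝 y]
        fun x ↦ G x (Γ x u w) z + G x w (Γ x u z) := by
      filter_upwards [h.isOpen.mem_nhds hy] with x hx using h.metric_compat hx u w z
    have := DFunLike.congr_fun (h1.unique (h2.congr_of_eventuallyEq h3)) v
    simp at this
    rw [this]; ring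
  have h1 := key u v
  have h2 := key v u
  rw [fderiv_fderiv_comm (h.contDiffAt_metric hy)] at h1
  rw [h1] at h2
  simp only [h.metric_compat hy] at h2
  simp only [curvature, map_sub, map_add, sub_apply,
    add_apply]
  linarith

end

section Transform

variable {U' : Set E} {G' : E → E →L[ℝ] E →L[ℝ] ℝ} {Γ' : E → E →L[ℝ] E →L[ℝ] E}
  (h : IsLeviCivita U G Γ) (h' : IsLeviCivita U' G' Γ') {V : Set E} {ψ : E → E} (hV : IsOpen V)
  (hVU : V ⊆ U) (hψ : ContDiffOn ℝ ∞ ψ V) (hψU : MapsTo ψ V U')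
  (hsurj : ∀ y ∈ V, Function.Surjective (fderiv ℝ ψ y))
  (hG : ∀ y ∈ V, ∀ u v, G y u v = G' (ψ y) (fderiv ℝ ψ y u) (fderiv ℝ ψ y v))
include h h' hV hVU hψ hψU hsurj hG

/-- Differentiating the isometry relation brings in second derivatives of ψ. In the Koszul
combination they cancel in pairs except for D²ψ(u, v). Surjectivity of Dψ allows testing against
every vector of the target. -/
lemma christoffel_transform {y : E} (hy : y ∈ V) (u v : E) :
    fderiv ℝ ψ y (Γ y u v) =
      fderiv ℝ (fderiv ℝ ψ) y u v + Γ' (ψ y) (fderiv ℝ ψ y u) (fderiv ℝ ψ y v) := by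
  have hψy : ContDiffAt ℝ ∞ ψ y := hψ.contDiffAt (hV.mem_nhds hy)
  have key : ∀ u v w : E, fderiv ℝ G y u v w =
      fderiv ℝ G' (ψ y) (fderiv ℝ ψ y u) (fderiv ℝ ψ y v) (fderiv ℝ ψ y w)
        + G' (ψ y) (fderiv ℝ (fderiv ℝ ψ) y u v) (fderiv ℝ ψ y w)
        + G' (ψ y) (fderiv ℝ ψ y v) (fderiv ℝ (fderiv ℝ ψ) y u w) := by
    intro u v w
    have hGy := (h.contDiffAt_metric (hVU hy)).hasFDerivAt_infty
    have hG'y : HasFDerivAt (fun x ↦ G' (ψ x)) _ y :=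
      (h'.contDiffAt_metric (hψU hy)).hasFDerivAt_infty.comp y hψy.hasFDerivAt_infty
    have hD := (contDiffAt_fderiv hψy).hasFDerivAt_infty
    have h1 : HasFDerivAt (fun x ↦ G x v w) _ y :=
      (hGy.clm_apply (hasFDerivAt_const v y)).clm_apply (hasFDerivAt_const w y)
    have h2 : HasFDerivAt (fun x ↦ G' (ψ x) (fderiv ℝ ψ x v) (fderiv ℝ ψ x w)) _ y :=
      (hG'y.clm_apply (hD.clm_apply (hasFDerivAt_const v y))).clm_apply
        (hD.clm_apply (hasFDerivAt_const w y))
    have h3 : (fun x ↦ G x v w) =ᶠ[𝓝 y]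
        fun x ↦ G' (ψ x) (fderiv ℝ ψ x v) (fderiv ℝ ψ x w) := by
      filter_upwards [hV.mem_nhds hy] with x hx using hG x hx v w
    have := DFunLike.congr_fun (h1.unique (h2.congr_of_eventuallyEq h3)) u
    simp at this
    rw [this]; ring
  refine h'.eq_of_inner (hψU hy) fun w' ↦ ?_
  obtain ⟨w, rfl⟩ := hsurj y hy w'
  have e1 := h.koszul y (hVU hy) u v w
  have e2 := h'.koszul _ (hψU hy) (fderiv ℝ ψ y u) (fderiv ℝ ψ y v) (fderiv ℝ ψ y w)
  rw [hG y hy, key, key, key] at e1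
  rw [map_add, add_apply]
  rw [fderiv_fderiv_comm hψy v u, fderiv_fderiv_comm hψy w u, fderiv_fderiv_comm hψy w v,
    h'.symm _ (hψU hy) (fderiv ℝ (fderiv ℝ ψ) y u w)] at e1
  linarith

/-- Differentiate the transformation law of Γ and antisymmetrize: the third derivatives of ψ cancel,
and the second derivatives applied to Γ are absorbed by the same law used for the nested Christoffel
terms. -/
lemma curvature_transform {y : E} (hy : y ∈ V) (u v w : E) :
    fderiv ℝ ψ y (curvature Γ y u v w) =
      curvature Γ' (ψ y) (fderiv ℝ ψ y u) (fderiv ℝ ψ y v) (fderiv ℝ ψ y w) := by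
  have hψy : ContDiffAt ℝ ∞ ψ y := hψ.contDiffAt (hV.mem_nhds hy)
  have htr := fun u v ↦ christoffel_transform h h' hV hVU hψ hψU hsurj hG hy u v
  have key : ∀ u v : E, fderiv ℝ (fderiv ℝ ψ) y u (Γ y v w) + fderiv ℝ ψ y (fderiv ℝ Γ y u v w) =
      fderiv ℝ (fderiv ℝ (fderiv ℝ ψ)) y u v w
        + fderiv ℝ Γ' (ψ y) (fderiv ℝ ψ y u) (fderiv ℝ ψ y v) (fderiv ℝ ψ y w)
        + Γ' (ψ y) (fderiv ℝ (fderiv ℝ ψ) y u v) (fderiv ℝ ψ y w)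
        + Γ' (ψ y) (fderiv ℝ ψ y v) (fderiv ℝ (fderiv ℝ ψ) y u w) := by
    intro u v
    have hΓ := (h.contDiffAt_christoffel (hVU hy)).hasFDerivAt_infty
    have hΓ' : HasFDerivAt (fun x ↦ Γ' (ψ x)) _ y :=
      (h'.contDiffAt_christoffel (hψU hy)).hasFDerivAt_infty.comp y hψy.hasFDerivAt_infty
    have hD := (contDiffAt_fderiv hψy).hasFDerivAt_infty
    have hDD := (contDiffAt_fderiv (contDiffAt_fderiv hψy)).hasFDerivAt_infty
    have h1 : HasFDerivAt (fun x ↦ fderiv ℝ ψ x (Γ x v w)) _ y :=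
      hD.clm_apply ((hΓ.clm_apply (hasFDerivAt_const v y)).clm_apply (hasFDerivAt_const w y))
    have h2 : HasFDerivAt (fun x ↦ fderiv ℝ (fderiv ℝ ψ) x v w
        + Γ' (ψ x) (fderiv ℝ ψ x v) (fderiv ℝ ψ x w)) _ y :=
      ((hDD.clm_apply (hasFDerivAt_const v y)).clm_apply (hasFDerivAt_const w y)).add
        ((hΓ'.clm_apply (hD.clm_apply (hasFDerivAt_const v y))).clm_apply
          (hD.clm_apply (hasFDerivAt_const w y)))
    have h3 : (fun x ↦ fderiv ℝ ψ x (Γ x v w)) =ᶠ[𝓝 y] fun x ↦ fderiv ℝ (fderiv ℝ ψ) x v w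
        + Γ' (ψ x) (fderiv ℝ ψ x v) (fderiv ℝ ψ x w) := by
      filter_upwards [hV.mem_nhds hy] with x hx using
        christoffel_transform h h' hV hVU hψ hψU hsurj hG hx v w
    have := DFunLike.congr_fun (h1.unique (h2.congr_of_eventuallyEq h3)) u
    simp at this
    rw [add_comm, this]; abel
  have k1 := key u v
  have k2 := key v u
  have s1 : fderiv ℝ (fderiv ℝ (fderiv ℝ ψ)) y u v w = fderiv ℝ (fderiv ℝ (fderiv ℝ ψ)) y v u w :=
    DFunLike.congr_fun (fderiv_fderiv_comm (contDiffAt_fderiv hψy) u v) w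
  have s2 := fderiv_fderiv_comm hψy u v
  have t1 := htr u (Γ y v w)
  have t2 := htr v (Γ y u w)
  rw [htr v w, map_add] at t1
  rw [htr u w, map_add] at t2
  simp only [curvature, map_sub, map_add]
  rw [t1, t2, eq_sub_of_add_eq' k1, eq_sub_of_add_eq' k2, s1, s2]
  abel

end Transform

end IsLeviCivita

/-! ### Vector fields along a map into an open subset of a vector space -/

section Along

variable {P : Type*} [NormedAddCommGroup P] [NormedSpace ℝ P]

/-- Covariant derivative in the direction `d` of a vector field `V` along a map `y`. -/
def covAlong (Γ : E → E →L[ℝ] E →L[ℝ] E) (y V : P → E) (S : Set P) (d z : P) : E :=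
  fderivWithin ℝ V S z d + Γ (y z) (fderivWithin ℝ y S z d) (V z)

lemma covAlong_congr {Γ : E → E →L[ℝ] E →L[ℝ] E} {y V y' V' : P → E} {S : Set P} {z : P}
    (hy : y' =ᶠ[𝓝[S] z] y) (hV : V' =ᶠ[𝓝[S] z] V) (hz : z ∈ S) (d : P) :
    covAlong Γ y' V' S d z = covAlong Γ y V S d z := by
  have h1 : y' z = y z := hy.self_of_nhdsWithin hz
  have h2 : V' z = V z := hV.self_of_nhdsWithin hz
  rw [covAlong, covAlong, hy.fderivWithin_eq h1, hV.fderivWithin_eq h2, h1, h2]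

variable {U : Set E} {G : E → E →L[ℝ] E →L[ℝ] ℝ} {Γ : E → E →L[ℝ] E →L[ℝ] E}

lemma IsLeviCivita.contDiffWithinAt_covAlong (h : IsLeviCivita U G Γ) {y V : P → E} {S : Set P}
    {z : P} (hS : UniqueDiffOn ℝ S) (hz : z ∈ S) (hy : ContDiffWithinAt ℝ ∞ y S z)
    (hV : ContDiffWithinAt ℝ ∞ V S z) (hU : y z ∈ U) (d : P) :
    ContDiffWithinAt ℝ ∞ (covAlong Γ y V S d) S z := by
  have h1 : ContDiffWithinAt ℝ ∞ (fderivWithin ℝ V S) S z :=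
    hV.fderivWithin_right hS (by simp) hz
  have h2 : ContDiffWithinAt ℝ ∞ (fderivWithin ℝ y S) S z :=
    hy.fderivWithin_right hS (by simp) hz
  have h3 : ContDiffWithinAt ℝ ∞ (fun x ↦ Γ (y x)) S z :=
    (h.contDiffAt_christoffel hU).comp_contDiffWithinAt z hy
  exact (h1.clm_apply contDiffWithinAt_const).add
    ((h3.clm_apply (h2.clm_apply contDiffWithinAt_const)).clm_apply hV)

lemma IsLeviCivita.fderivWithin_inner (h : IsLeviCivita U G Γ) {y V W : P → E} {S : Set P}
    {z : P} (hS : UniqueDiffWithinAt ℝ S z) (hy : ContDiffWithinAt ℝ ∞ y S z)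
    (hV : ContDiffWithinAt ℝ ∞ V S z) (hW : ContDiffWithinAt ℝ ∞ W S z) (hU : y z ∈ U) (d : P) :
    fderivWithin ℝ (fun x ↦ G (y x) (V x) (W x)) S z d =
      G (y z) (covAlong Γ y V S d z) (W z) + G (y z) (V z) (covAlong Γ y W S d z) := by
  have hG : HasFDerivWithinAt (fun x ↦ G (y x)) _ S z :=
    (h.contDiffAt_metric hU).hasFDerivAt_infty.comp_hasFDerivWithinAt z hy.hasFDerivWithinAt_infty
  have h1 : HasFDerivWithinAt (fun x ↦ G (y x) (V x) (W x)) _ S z :=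
    (hG.clm_apply hV.hasFDerivWithinAt_infty).clm_apply hW.hasFDerivWithinAt_infty
  rw [h1.fderivWithin hS]
  simp [covAlong, h.metric_compat hU]
  ring

/-- Differentiating Dψ(y)X produces a D²ψ term, which is the inhomogeneous term in the
transformation law of Γ. -/
lemma IsLeviCivita.covAlong_transform {U' V : Set E} {G' : E → E →L[ℝ] E →L[ℝ] ℝ}
    {Γ' : E → E →L[ℝ] E →L[ℝ] E} (h : IsLeviCivita U G Γ) (h' : IsLeviCivita U' G' Γ')
    {ψ : E → E} (hV : IsOpen V)
    (hVU : V ⊆ U) (hψ : ContDiffOn ℝ ∞ ψ V) (hψU : MapsTo ψ V U')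
    (hsurj : ∀ y ∈ V, Function.Surjective (fderiv ℝ ψ y))
    (hG : ∀ y ∈ V, ∀ u v, G y u v = G' (ψ y) (fderiv ℝ ψ y u) (fderiv ℝ ψ y v))
    {y X y' X' : P → E} {S : Set P}
    {z : P} (hS : UniqueDiffWithinAt ℝ S z) (hz : z ∈ S) (hy : ContDiffWithinAt ℝ ∞ y S z)
    (hX : ContDiffWithinAt ℝ ∞ X S z) (hyV : y z ∈ V)
    (hy' : y' =ᶠ[𝓝[S] z] fun x ↦ ψ (y x))
    (hX' : X' =ᶠ[𝓝[S] z] fun x ↦ fderiv ℝ ψ (y x) (X x)) (d : P) :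
    covAlong Γ' y' X' S d z = fderiv ℝ ψ (y z) (covAlong Γ y X S d z) := by
  rw [covAlong_congr hy' hX' hz]
  have hψy : ContDiffAt ℝ ∞ ψ (y z) := hψ.contDiffAt (hV.mem_nhds hyV)
  have h1 : HasFDerivWithinAt (fun x ↦ ψ (y x)) _ S z :=
    hψy.hasFDerivAt_infty.comp_hasFDerivWithinAt z hy.hasFDerivWithinAt_infty
  have h2 : HasFDerivWithinAt (fun x ↦ fderiv ℝ ψ (y x)) _ S z :=
    (contDiffAt_fderiv hψy).hasFDerivAt_infty.comp_hasFDerivWithinAt z hy.hasFDerivWithinAt_infty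
  have h3 := h2.clm_apply hX.hasFDerivWithinAt_infty
  simp only [covAlong, h1.fderivWithin hS, h3.fderivWithin hS, map_add,
    christoffel_transform h h' hV hVU hψ hψU hsurj hG hyV]
  simp
  abel

lemma IsLeviCivita.covAlong_torsion_free (h : IsLeviCivita U G Γ) {y : P → E} {S : Set P}
    {z : P} (hz : S ∈ 𝓝 z) (hy : ContDiffAt ℝ ∞ y z) (hU : y z ∈ U) (d d' : P) :
    covAlong Γ y (fun x ↦ fderivWithin ℝ y S x d') S d z =
      covAlong Γ y (fun x ↦ fderivWithin ℝ y S x d) S d' z := by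
  have key : ∀ d d' : P, fderivWithin ℝ (fun x ↦ fderivWithin ℝ y S x d') S z d =
      fderiv ℝ (fderiv ℝ y) z d d' := by
    intro d d'
    rw [fderivWithin_of_mem_nhds hz]
    have h1 : (fun x ↦ fderivWithin ℝ y S x d') =ᶠ[𝓝 z] fun x ↦ fderiv ℝ y x d' := by
      filter_upwards [eventually_mem_nhds_iff.2 hz] with x hx
      rw [fderivWithin_of_mem_nhds hx]
    have h2 : HasFDerivAt (fun x ↦ fderiv ℝ y x d') _ z :=
      (contDiffAt_fderiv hy).hasFDerivAt_infty.clm_apply (hasFDerivAt_const d' z)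
    rw [h1.fderiv_eq, h2.fderiv]
    simp
  simp only [covAlong]
  rw [key, key, fderiv_fderiv_comm hy, h.christoffel_symm hU]

/-- Symmetry of second derivatives of y and V removes all terms except those of the curvature. This
symmetry is the reason for working at an interior point of S. -/
lemma IsLeviCivita.covAlong_commutator (h : IsLeviCivita U G Γ) {y V : P → E} {S : Set P}
    {z : P} (hz : S ∈ 𝓝 z) (hy : ContDiffAt ℝ ∞ y z) (hV : ContDiffAt ℝ ∞ V z) (hU : y z ∈ U)
    (d d' : P) :
    covAlong Γ y (covAlong Γ y V S d') S d z - covAlong Γ y (covAlong Γ y V S d) S d' z =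
      curvature Γ (y z) (fderivWithin ℝ y S z d) (fderivWithin ℝ y S z d') (V z) := by
  have key : ∀ d d' : P, fderivWithin ℝ (covAlong Γ y V S d') S z d =
      fderiv ℝ (fderiv ℝ V) z d d' + (fderiv ℝ Γ (y z) (fderiv ℝ y z d) (fderiv ℝ y z d') (V z)
        + Γ (y z) (fderiv ℝ (fderiv ℝ y) z d d') (V z)
        + Γ (y z) (fderiv ℝ y z d') (fderiv ℝ V z d)) := by
    intro d d'
    rw [fderivWithin_of_mem_nhds hz]
    have h1 : covAlong Γ y V S d' =ᶠ[𝓝 z]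
        fun x ↦ fderiv ℝ V x d' + Γ (y x) (fderiv ℝ y x d') (V x) := by
      filter_upwards [eventually_mem_nhds_iff.2 hz] with x hx
      rw [covAlong, fderivWithin_of_mem_nhds hx, fderivWithin_of_mem_nhds hx]
    have hΓ : HasFDerivAt (fun x ↦ Γ (y x)) _ z :=
      (h.contDiffAt_christoffel hU).hasFDerivAt_infty.comp z hy.hasFDerivAt_infty
    have h2 : HasFDerivAt (fun x ↦ fderiv ℝ V x d' + Γ (y x) (fderiv ℝ y x d') (V x)) _ z :=
      ((contDiffAt_fderiv hV).hasFDerivAt_infty.clm_apply (hasFDerivAt_const d' z)).add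
        ((hΓ.clm_apply ((contDiffAt_fderiv hy).hasFDerivAt_infty.clm_apply
          (hasFDerivAt_const d' z))).clm_apply hV.hasFDerivAt_infty)
    rw [h1.fderiv_eq, h2.fderiv]
    simp
    abel
  have e : ∀ W : P → E, ∀ d, covAlong Γ y W S d z = fderivWithin ℝ W S z d
      + Γ (y z) (fderivWithin ℝ y S z d) (W z) := fun W d ↦ rfl
  rw [e (covAlong Γ y V S d'), e (covAlong Γ y V S d), key, key, e V, e V]
  simp only [fderivWithin_of_mem_nhds hz, curvature, map_add]
  rw [fderiv_fderiv_comm hV d d', fderiv_fderiv_comm hy d d']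
  abel

end Along

end VectorSpace

set_option linter.unusedSectionVars false

variable {M : Type*} [TopologicalSpace M] [ChartedSpace E3 M] [IsManifold (𝓡 3) ∞ M]

/-! ### Coordinates -/

section Coordinates

omit [IsManifold (𝓡 3) ∞ M] in
lemma mem_source_self (c : M) : c ∈ (extChartAt (𝓡 3) c).source := mem_extChartAt_source c

lemma toCoord_isInvertible {c p : M} (hp : p ∈ (extChartAt (𝓡 3) c).source) :
    (toCoord c p).IsInvertible :=
  isInvertible_mfderiv_extChartAt hp

lemma toCoord_fromCoord {c p : M} (hp : p ∈ (extChartAt (𝓡 3) c).source) (v : E3) :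
    toCoord c p (fromCoord c p v) = v := by
  obtain ⟨e, he⟩ := toCoord_isInvertible hp
  rw [fromCoord, ← he, ContinuousLinearMap.inverse_equiv]
  exact e.apply_symm_apply v

lemma fromCoord_toCoord {c p : M} (hp : p ∈ (extChartAt (𝓡 3) c).source)
    (v : TangentSpace (𝓡 3) p) : fromCoord c p (toCoord c p v) = v := by
  obtain ⟨e, he⟩ := toCoord_isInvertible hp
  rw [fromCoord, ← he, ContinuousLinearMap.inverse_equiv]
  exact e.symm_apply_apply v

lemma toCoord_injective {c p : M} (hp : p ∈ (extChartAt (𝓡 3) c).source) :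
    Function.Injective (toCoord c p) :=
  Function.LeftInverse.injective (fromCoord_toCoord hp)

lemma toCoord_eq_trivializationAt {c p : M} (hp : p ∈ (extChartAt (𝓡 3) c).source)
    (v : TangentSpace (𝓡 3) p) :
    (trivializationAt E3 (TangentSpace (𝓡 3)) c (⟨p, v⟩ : TangentBundle (𝓡 3) M)).2
      = toCoord c p v := by
  have hp' : p ∈ (chartAt E3 c).source := by rwa [extChartAt_source] at hp
  have h := TangentBundle.continuousLinearMapAt_trivializationAt (I := 𝓡 3) hp'
  rw [toCoord, ← h, Trivialization.continuousLinearMapAt_apply, Trivialization.linearMapAt_apply,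
    if_pos]
  · simpa using hp'

end Coordinates

/-! ### Smooth vector fields along a map, read in charts -/

section AlongMap

variable {P : Type*} [NormedAddCommGroup P] [NormedSpace ℝ P] {X : P → M} {S : Set P} {z : P}

/-- Smoothness within `S` at `z` of a vector field along `X`. -/
abbrev SmoothFieldAt (X : P → M) (V : ∀ z, TangentSpace (𝓡 3) (X z)) (S : Set P) (z : P) : Prop :=
  ContMDiffWithinAt 𝓘(ℝ, P) (𝓡 3).tangent ∞
    (fun w ↦ (⟨X w, V w⟩ : TangentBundle (𝓡 3) M)) S z

lemma eventually_mem_source {c : M} (hX : ContinuousWithinAt X S z)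
    (hc : X z ∈ (extChartAt (𝓡 3) c).source) :
    ∀ᶠ w in 𝓝[S] z, X w ∈ (extChartAt (𝓡 3) c).source :=
  hX.eventually_mem ((isOpen_extChartAt_source c).mem_nhds hc)

lemma contDiffWithinAt_extChartAt {c : M} (hX : ContMDiffWithinAt 𝓘(ℝ, P) (𝓡 3) ∞ X S z)
    (hc : X z ∈ (extChartAt (𝓡 3) c).source) :
    ContDiffWithinAt ℝ ∞ (fun w ↦ extChartAt (𝓡 3) c (X w)) S z := by
  rw [← contMDiffWithinAt_iff_contDiffWithinAt]
  exact (contMDiffAt_extChartAt' (by rwa [extChartAt_source] at hc)).comp_contMDiffWithinAt z hX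

/-- Over the chart around c, the fibre coordinate of the tangent bundle trivialization is `toCoord
c`. Smoothness can therefore be tested in any chart containing the point, which frees later
arguments from the chart at the moving point. -/
lemma smoothFieldAt_iff {V : ∀ z, TangentSpace (𝓡 3) (X z)} {c : M}
    (hX : ContMDiffWithinAt 𝓘(ℝ, P) (𝓡 3) ∞ X S z) (hz : z ∈ S)
    (hc : X z ∈ (extChartAt (𝓡 3) c).source) :
    SmoothFieldAt X V S z ↔ ContDiffWithinAt ℝ ∞ (fun w ↦ toCoord c (X w) (V w)) S z := by
  have h0 : (⟨X z, V z⟩ : TangentBundle (𝓡 3) M) ∈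
      (trivializationAt E3 (TangentSpace (𝓡 3)) c).source := by
    rw [Trivialization.mem_source]
    simpa using hc
  have h1 := Trivialization.contMDiffWithinAt_iff (n := ∞) (IM := 𝓘(ℝ, P)) (IB := 𝓡 3)
    (e := trivializationAt E3 (TangentSpace (𝓡 3)) c)
    (f := fun w ↦ (⟨X w, V w⟩ : TangentBundle (𝓡 3) M)) (s := S) h0
  have h2 : (fun w ↦ (trivializationAt E3 (TangentSpace (𝓡 3)) c
      (⟨X w, V w⟩ : TangentBundle (𝓡 3) M)).2) =ᶠ[𝓝[S] z] fun w ↦ toCoord c (X w) (V w) := by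
    filter_upwards [eventually_mem_source hX.continuousWithinAt hc] with w hw
    exact toCoord_eq_trivializationAt hw (V w)
  rw [SmoothFieldAt]
  refine h1.trans ⟨fun h ↦ ?_, fun h ↦ ⟨hX, ?_⟩⟩
  · exact (contMDiffWithinAt_iff_contDiffWithinAt.1 h.2).congr_of_eventuallyEq h2.symm
      (h2.self_of_nhdsWithin hz).symm
  · exact (contMDiffWithinAt_iff_contDiffWithinAt.2 (h.congr_of_eventuallyEq h2
      (h2.self_of_nhdsWithin hz)))

lemma SmoothFieldAt.contDiffWithinAt {V : ∀ z, TangentSpace (𝓡 3) (X z)} {c : M}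
    (h : SmoothFieldAt X V S z) (hz : z ∈ S) (hc : X z ∈ (extChartAt (𝓡 3) c).source) :
    ContDiffWithinAt ℝ ∞ (fun w ↦ toCoord c (X w) (V w)) S z := by
  refine (smoothFieldAt_iff ?_ hz hc).1 h
  exact (contMDiffWithinAt_totalSpace.1 h).1

lemma SmoothFieldAt.base {V : ∀ z, TangentSpace (𝓡 3) (X z)} (h : SmoothFieldAt X V S z) :
    ContMDiffWithinAt 𝓘(ℝ, P) (𝓡 3) ∞ X S z :=
  (contMDiffWithinAt_totalSpace.1 h).1

end AlongMap

/-! ### The metric, Christoffel symbols and curvature in a chart -/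

section ChartMetric

variable (g : Metric3 M)

lemma smoothFieldAt_inner {P : Type*} [NormedAddCommGroup P] [NormedSpace ℝ P] {X : P → M}
    {S : Set P} {z : P} {V W : ∀ z, TangentSpace (𝓡 3) (X z)}
    (hV : SmoothFieldAt X V S z) (hW : SmoothFieldAt X W S z) :
    ContDiffWithinAt ℝ ∞ (fun w ↦ g.inner (X w) (V w) (W w)) S z := by
  have : ContMDiffWithinAt 𝓘(ℝ, P) ((𝓡 3).prod 𝓘(ℝ)) ∞
      (fun m ↦ TotalSpace.mk' ℝ (E := Bundle.Trivial M ℝ) (X m) (g.inner (X m) (V m) (W m))) S z := by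
    apply ContMDiffWithinAt.clm_bundle_apply₂ (F₁ := E3) (F₂ := E3)
    · exact ContMDiffAt.comp_contMDiffWithinAt z g.contMDiff.contMDiffAt hV.base
    · exact hV
    · exact hW
  rw [contMDiffWithinAt_totalSpace] at this
  exact contMDiffWithinAt_iff_contDiffWithinAt.1 this.2

lemma contDiffOn_metricCoeff (c : M) (i j : Fin 3) :
    ContDiffOn ℝ ∞ (metricCoeff g c i j) (extChartAt (𝓡 3) c).target := by
  intro y hy
  have hX : ContMDiffWithinAt 𝓘(ℝ, E3) (𝓡 3) ∞ (extChartAt (𝓡 3) c).symm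
    (extChartAt (𝓡 3) c).target y := contMDiffOn_extChartAt_symm c y hy
  have key : ∀ i, SmoothFieldAt (P := E3) (extChartAt (𝓡 3) c).symm
      (fun y ↦ coordVec c ((extChartAt (𝓡 3) c).symm y) i) (extChartAt (𝓡 3) c).target y := by
    intro i
    rw [smoothFieldAt_iff hX hy ((extChartAt (𝓡 3) c).map_target hy)]
    refine (contDiffWithinAt_const (c := EuclideanSpace.single i (1 : ℝ))).congr (fun w hw ↦ ?_) ?_
    · exact toCoord_fromCoord ((extChartAt (𝓡 3) c).map_target hw) _
    · exact toCoord_fromCoord ((extChartAt (𝓡 3) c).map_target hy) _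
  exact smoothFieldAt_inner g (key i) (key j)

end ChartMetric

section ChartMetric

variable (g : Metric3 M)

/-- The metric in the chart around `c`, as a function of the coordinates. -/
def chartMetric (c : M) (y : E3) : E3 →L[ℝ] E3 →L[ℝ] ℝ :=
  ∑ i, ∑ j, metricCoeff g c i j y •
    (EuclideanSpace.proj i : E3 →L[ℝ] ℝ).smulRight (EuclideanSpace.proj j : E3 →L[ℝ] ℝ)

/-- The Christoffel symbols in the chart around `c`, as a bilinear map. -/
def chartChristoffel (c : M) (y : E3) : E3 →L[ℝ] E3 →L[ℝ] E3 :=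
  ∑ k, ∑ i, ∑ j, christoffel g c k i j y •
    (EuclideanSpace.proj i : E3 →L[ℝ] ℝ).smulRight
      ((EuclideanSpace.proj j : E3 →L[ℝ] ℝ).smulRight (EuclideanSpace.single k (1 : ℝ)))

lemma chartMetric_apply (c : M) (y u v : E3) :
    chartMetric g c y u v = ∑ i, ∑ j, metricCoeff g c i j y * u i * v j := by
  simp [chartMetric, mul_assoc]

lemma chartChristoffel_apply (c : M) (y u v : E3) :
    chartChristoffel g c y u v =
      ∑ k, (∑ i, ∑ j, christoffel g c k i j y * u i * v j) • EuclideanSpace.single k (1 : ℝ) := by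
  simp [chartChristoffel, Finset.sum_smul, smul_smul, mul_assoc]

lemma chartChristoffel_apply_coord (c : M) (y u v : E3) (k : Fin 3) :
    chartChristoffel g c y u v k = ∑ i, ∑ j, christoffel g c k i j y * u i * v j := by
  simp [chartChristoffel_apply, Pi.single_apply]

lemma E3_eq_sum (u : E3) : u = ∑ i, u i • EuclideanSpace.single i (1 : ℝ) := by
  ext j; simp [Pi.single_apply]

lemma fromCoord_eq_sum (c p : M) (u : E3) : fromCoord c p u = ∑ i, u i • coordVec c p i := by
  conv_lhs => rw [E3_eq_sum u]
  simp only [map_sum, map_smul, coordVec]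

lemma chartMetric_eq_inner (c : M) (y u v : E3) :
    chartMetric g c y u v = g.inner ((extChartAt (𝓡 3) c).symm y)
      (fromCoord c ((extChartAt (𝓡 3) c).symm y) u)
      (fromCoord c ((extChartAt (𝓡 3) c).symm y) v) := by
  simp only [chartMetric_apply, fromCoord_eq_sum, map_sum, map_smul,
    FunLike.coe_sum, Finset.sum_apply, smul_apply, smul_eq_mul, metricCoeff,
    Finset.mul_sum]
  rw [Finset.sum_comm]
  refine Finset.sum_congr rfl fun i _ ↦ Finset.sum_congr rfl fun j _ ↦ by ring

lemma inner_eq_chartMetric {c p : M} (hp : p ∈ (extChartAt (𝓡 3) c).source)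
    (u v : TangentSpace (𝓡 3) p) :
    g.inner p u v = chartMetric g c (extChartAt (𝓡 3) c p) (toCoord c p u) (toCoord c p v) := by
  rw [chartMetric_eq_inner, (extChartAt (𝓡 3) c).left_inv hp, fromCoord_toCoord hp,
    fromCoord_toCoord hp]

lemma chartMetric_pos {c : M} {y : E3} (hy : y ∈ (extChartAt (𝓡 3) c).target) {v : E3}
    (hv : v ≠ 0) : 0 < chartMetric g c y v v := by
  rw [chartMetric_eq_inner]
  refine g.pos _ _ fun h ↦ hv ?_
  have := toCoord_fromCoord ((extChartAt (𝓡 3) c).map_target hy) v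
  rw [h, map_zero] at this
  exact this.symm

lemma chartMetric_symm (c : M) (y u v : E3) : chartMetric g c y u v = chartMetric g c y v u := by
  rw [chartMetric_eq_inner, chartMetric_eq_inner, g.symm]

lemma metricCoeff_symm (c : M) (i j : Fin 3) (y : E3) :
    metricCoeff g c i j y = metricCoeff g c j i y := g.symm _ _ _

/-- A kernel vector of the Gram matrix would be a nonzero vector of length zero. -/
lemma metricMatrix_det_ne_zero {c : M} {y : E3} (hy : y ∈ (extChartAt (𝓡 3) c).target) :
    (Matrix.of fun k l ↦ metricCoeff g c k l y).det ≠ 0 := by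
  intro h
  obtain ⟨v, hv, hv0⟩ := Matrix.exists_mulVec_eq_zero_iff.2 h
  have h1 := chartMetric_pos g hy (v := WithLp.toLp 2 v) (by
    intro h; apply hv; ext i; simpa using congrArg (fun w : E3 ↦ w i) h)
  have h2 : chartMetric g c y (WithLp.toLp 2 v) (WithLp.toLp 2 v) =
      v ⬝ᵥ ((Matrix.of fun k l ↦ metricCoeff g c k l y) *ᵥ v) := by
    rw [chartMetric_apply]
    simp only [dotProduct, Matrix.mulVec, Matrix.of_apply, Finset.mul_sum]
    refine Finset.sum_congr rfl fun i _ ↦ Finset.sum_congr rfl fun j _ ↦ by ring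
  rw [h2, hv0] at h1
  simp at h1

lemma sum_metricCoeff_invCoeff {c : M} {y : E3} (hy : y ∈ (extChartAt (𝓡 3) c).target)
    (m l : Fin 3) :
    ∑ k, metricCoeff g c m k y * invCoeff g c k l y = if m = l then 1 else 0 := by
  have h := Matrix.mul_nonsing_inv (Matrix.of fun k l ↦ metricCoeff g c k l y)
    (isUnit_iff_ne_zero.2 (metricMatrix_det_ne_zero g hy))
  have := congrFun (congrFun h m) l
  rw [Matrix.mul_apply, Matrix.one_apply] at this
  exact this

lemma contDiffOn_det_fin_three {s : Set E3} {A : E3 → Matrix (Fin 3) (Fin 3) ℝ}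
    (hA : ∀ i j, ContDiffOn ℝ ∞ (fun y ↦ A y i j) s) : ContDiffOn ℝ ∞ (fun y ↦ (A y).det) s := by
  simp only [Matrix.det_apply]
  refine ContDiffOn.sum fun σ _ ↦ ?_
  simp only [Units.smul_def, zsmul_eq_mul]
  exact contDiffOn_const.mul (contDiffOn_prod fun i _ ↦ hA _ _)

lemma contDiffOn_invCoeff (c : M) (i j : Fin 3) :
    ContDiffOn ℝ ∞ (invCoeff g c i j) (extChartAt (𝓡 3) c).target := by
  have h1 : ∀ k l, ContDiffOn ℝ ∞ (fun y ↦ (Matrix.of fun k l ↦ metricCoeff g c k l y) k l)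
      (extChartAt (𝓡 3) c).target := fun k l ↦ contDiffOn_metricCoeff g c k l
  have h2 : ContDiffOn ℝ ∞ (fun y ↦ ((Matrix.of fun k l ↦ metricCoeff g c k l y).det)⁻¹ *
      (Matrix.of fun k l ↦ metricCoeff g c k l y).adjugate i j) (extChartAt (𝓡 3) c).target := by
    refine ((contDiffOn_det_fin_three h1).inv fun y hy ↦ metricMatrix_det_ne_zero g hy).mul ?_
    simp only [Matrix.adjugate_apply]
    refine contDiffOn_det_fin_three fun k l ↦ ?_
    simp only [Matrix.updateRow_apply]
    split_ifs
    · exact contDiffOn_const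
    · exact h1 k l
  refine h2.congr fun y _ ↦ ?_
  rw [invCoeff, Matrix.inv_def, Matrix.smul_apply, Ring.inverse_eq_inv', smul_eq_mul]

lemma contDiffOn_pd {s : Set E3} (hs : IsOpen s) {f : E3 → ℝ} (hf : ContDiffOn ℝ ∞ f s)
    (k : Fin 3) : ContDiffOn ℝ ∞ (pd k f) s :=
  (hf.fderiv_of_isOpen hs (by simp)).clm_apply contDiffOn_const

lemma contDiffOn_christoffel (c : M) (k i j : Fin 3) :
    ContDiffOn ℝ ∞ (christoffel g c k i j) (extChartAt (𝓡 3) c).target := by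
  have hg : ∀ k i j, ContDiffOn ℝ ∞ (pd k (metricCoeff g c i j)) (extChartAt (𝓡 3) c).target :=
    fun k i j ↦ contDiffOn_pd (isOpen_extChartAt_target c) (contDiffOn_metricCoeff g c i j) k
  exact contDiffOn_const.mul (ContDiffOn.sum fun l _ ↦ (contDiffOn_invCoeff g c k l).mul
    (((hg i j l).add (hg j i l)).sub (hg l i j)))

lemma contDiffOn_chartMetric (c : M) :
    ContDiffOn ℝ ∞ (chartMetric g c) (extChartAt (𝓡 3) c).target :=
  ContDiffOn.sum fun i _ ↦ ContDiffOn.sum fun j _ ↦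
    (contDiffOn_metricCoeff g c i j).smul contDiffOn_const

lemma contDiffOn_chartChristoffel (c : M) :
    ContDiffOn ℝ ∞ (chartChristoffel g c) (extChartAt (𝓡 3) c).target :=
  ContDiffOn.sum fun k _ ↦ ContDiffOn.sum fun i _ ↦ ContDiffOn.sum fun j _ ↦
    (contDiffOn_christoffel g c k i j).smul contDiffOn_const

lemma chartMetric_single (c : M) (y : E3) (i j : Fin 3) :
    chartMetric g c y (EuclideanSpace.single i 1) (EuclideanSpace.single j 1)
      = metricCoeff g c i j y := by
  simp [chartMetric_apply]

lemma chartChristoffel_single (c : M) (y : E3) (k i j : Fin 3) :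
    chartChristoffel g c y (EuclideanSpace.single i 1) (EuclideanSpace.single j 1) k
      = christoffel g c k i j y := by
  simp [chartChristoffel_apply_coord]

lemma fderiv_chartMetric_single {c : M} {y : E3} (hy : y ∈ (extChartAt (𝓡 3) c).target)
    (k i j : Fin 3) :
    fderiv ℝ (chartMetric g c) y (EuclideanSpace.single k 1) (EuclideanSpace.single i 1)
      (EuclideanSpace.single j 1) = pd k (metricCoeff g c i j) y := by
  have h : HasFDerivAt (chartMetric g c) _ y := ((contDiffOn_chartMetric g c).contDiffAt
    ((isOpen_extChartAt_target c).mem_nhds hy)).hasFDerivAt_infty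
  have h1 : HasFDerivAt (fun y ↦ chartMetric g c y (EuclideanSpace.single i 1)
      (EuclideanSpace.single j 1)) _ y :=
    (h.clm_apply (hasFDerivAt_const _ y)).clm_apply (hasFDerivAt_const _ y)
  simp only [chartMetric_single] at h1
  rw [pd, h1.fderiv]
  simp

lemma fderiv_chartChristoffel_single {c : M} {y : E3} (hy : y ∈ (extChartAt (𝓡 3) c).target)
    (l k i j : Fin 3) :
    fderiv ℝ (chartChristoffel g c) y (EuclideanSpace.single k 1) (EuclideanSpace.single i 1)
      (EuclideanSpace.single j 1) l = pd k (christoffel g c l i j) y := by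
  have h : HasFDerivAt (chartChristoffel g c) _ y := ((contDiffOn_chartChristoffel g c).contDiffAt
    ((isOpen_extChartAt_target c).mem_nhds hy)).hasFDerivAt_infty
  have h1 : HasFDerivAt (fun y ↦ chartChristoffel g c y (EuclideanSpace.single i 1)
      (EuclideanSpace.single j 1)) _ y :=
    (h.clm_apply (hasFDerivAt_const _ y)).clm_apply (hasFDerivAt_const _ y)
  have h2 := (EuclideanSpace.proj l : E3 →L[ℝ] ℝ).hasFDerivAt.comp y h1
  have h3 : ((EuclideanSpace.proj l : E3 →L[ℝ] ℝ) ∘ fun y ↦ chartChristoffel g c y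
      (EuclideanSpace.single i 1) (EuclideanSpace.single j 1)) = christoffel g c l i j := by
    funext y; exact chartChristoffel_single g c y l i j
  rw [h3] at h2
  rw [pd, h2.fderiv]
  simp

lemma isLeviCivita_chart (c : M) :
    IsLeviCivita (extChartAt (𝓡 3) c).target (chartMetric g c) (chartChristoffel g c) where
  isOpen := isOpen_extChartAt_target c
  contDiff_metric := contDiffOn_chartMetric g c
  contDiff_christoffel := contDiffOn_chartChristoffel g c
  symm y _ u v := chartMetric_symm g c y u v
  pos y hy v hv := chartMetric_pos g hy hv
  koszul y hy u v w := by
    -- On coordinate vectors the inverse metric in the Christoffel symbol cancels against the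
    -- metric. The facts `hw`, `hv` and the final lines then extend the formula by linearity, one
    -- argument at a time.
    have key : ∀ i j m : Fin 3, 2 * chartMetric g c y (chartChristoffel g c y
        (EuclideanSpace.single i 1) (EuclideanSpace.single j 1)) (EuclideanSpace.single m 1) =
        fderiv ℝ (chartMetric g c) y (EuclideanSpace.single i 1) (EuclideanSpace.single j 1)
          (EuclideanSpace.single m 1) + fderiv ℝ (chartMetric g c) y (EuclideanSpace.single j 1)
          (EuclideanSpace.single i 1) (EuclideanSpace.single m 1)
          - fderiv ℝ (chartMetric g c) y (EuclideanSpace.single m 1)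
          (EuclideanSpace.single i 1) (EuclideanSpace.single j 1) := by
      intro i j m
      simp only [fderiv_chartMetric_single g hy]
      have h1 : chartMetric g c y (chartChristoffel g c y
          (EuclideanSpace.single i 1) (EuclideanSpace.single j 1)) (EuclideanSpace.single m 1)
          = ∑ l, metricCoeff g c m l y * christoffel g c l i j y := by
        rw [chartMetric_apply]
        simp [chartChristoffel_single, metricCoeff_symm g c _ m]
      rw [h1]
      simp only [christoffel, Finset.mul_sum]
      rw [Finset.sum_comm]
      have h2 : ∀ l, ∑ k, 2 * (metricCoeff g c m k y * (1 / 2 * (invCoeff g c k l y *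
          (pd i (metricCoeff g c j l) y + pd j (metricCoeff g c i l) y
            - pd l (metricCoeff g c i j) y)))) = (if m = l then 1 else 0) *
          (pd i (metricCoeff g c j l) y + pd j (metricCoeff g c i l) y
            - pd l (metricCoeff g c i j) y) := by
        intro l
        rw [← sum_metricCoeff_invCoeff g hy m l, Finset.sum_mul]
        exact Finset.sum_congr rfl fun k _ ↦ by ring
      rw [Finset.sum_congr rfl fun l _ ↦ h2 l]
      simp
    have hw : ∀ i j : Fin 3, ∀ w : E3, 2 * chartMetric g c y (chartChristoffel g c y
        (EuclideanSpace.single i 1) (EuclideanSpace.single j 1)) w =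
        fderiv ℝ (chartMetric g c) y (EuclideanSpace.single i 1) (EuclideanSpace.single j 1) w
          + fderiv ℝ (chartMetric g c) y (EuclideanSpace.single j 1) (EuclideanSpace.single i 1) w
          - fderiv ℝ (chartMetric g c) y w
          (EuclideanSpace.single i 1) (EuclideanSpace.single j 1) := by
      intro i j w
      conv_lhs => rw [E3_eq_sum w]
      conv_rhs => rw [E3_eq_sum w]
      simp only [map_sum, map_smul, FunLike.coe_sum, Finset.sum_apply, smul_apply, smul_eq_mul,
        Finset.mul_sum, ← Finset.sum_add_distrib, ← Finset.sum_sub_distrib]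
      exact Finset.sum_congr rfl fun m _ ↦ by linear_combination w m * key i j m
    have hv : ∀ i : Fin 3, ∀ v w : E3, 2 * chartMetric g c y (chartChristoffel g c y
        (EuclideanSpace.single i 1) v) w =
        fderiv ℝ (chartMetric g c) y (EuclideanSpace.single i 1) v w
          + fderiv ℝ (chartMetric g c) y v (EuclideanSpace.single i 1) w
          - fderiv ℝ (chartMetric g c) y w (EuclideanSpace.single i 1) v := by
      intro i v w
      conv_lhs => rw [E3_eq_sum v]
      conv_rhs => rw [E3_eq_sum v]
      simp only [map_sum, map_smul, FunLike.coe_sum, Finset.sum_apply, smul_apply, smul_eq_mul,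
        Finset.mul_sum, ← Finset.sum_add_distrib, ← Finset.sum_sub_distrib]
      exact Finset.sum_congr rfl fun m _ ↦ by linear_combination v m * hw i m w
    conv_lhs => rw [E3_eq_sum u]
    conv_rhs => rw [E3_eq_sum u]
    simp only [map_sum, map_smul, FunLike.coe_sum, Finset.sum_apply, smul_apply, smul_eq_mul,
      Finset.mul_sum, ← Finset.sum_add_distrib, ← Finset.sum_sub_distrib]
    exact Finset.sum_congr rfl fun m _ ↦ by linear_combination u m * hv m v w

/-- The transition map from the chart around `c` to the chart around `c'`. -/
def transition (c c' : M) (y : E3) : E3 := extChartAt (𝓡 3) c' ((extChartAt (𝓡 3) c).symm y)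

/-- The domain of the transition map from the chart around `c` to the chart around `c'`. -/
def transitionDomain (c c' : M) : Set E3 :=
  (extChartAt (𝓡 3) c).target ∩ (extChartAt (𝓡 3) c).symm ⁻¹' (extChartAt (𝓡 3) c').source

omit [IsManifold (𝓡 3) ∞ M] in
lemma isOpen_transitionDomain (c c' : M) : IsOpen (transitionDomain c c') :=
  (continuousOn_extChartAt_symm c).isOpen_inter_preimage (isOpen_extChartAt_target c)
    (isOpen_extChartAt_source c')

omit [IsManifold (𝓡 3) ∞ M] in
lemma mem_transitionDomain {c c' p : M} (hc : p ∈ (extChartAt (𝓡 3) c).source)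
    (hc' : p ∈ (extChartAt (𝓡 3) c').source) : extChartAt (𝓡 3) c p ∈ transitionDomain c c' :=
  ⟨(extChartAt (𝓡 3) c).map_source hc, by
    rw [mem_preimage, (extChartAt (𝓡 3) c).left_inv hc]; exact hc'⟩

lemma contDiffOn_transition (c c' : M) :
    ContDiffOn ℝ ∞ (transition c c') (transitionDomain c c') := fun y hy ↦
  contDiffWithinAt_extChartAt ((contMDiffOn_extChartAt_symm c y hy.1).mono inter_subset_left) hy.2

omit [IsManifold (𝓡 3) ∞ M] in
lemma mapsTo_transition (c c' : M) :
    MapsTo (transition c c') (transitionDomain c c') (extChartAt (𝓡 3) c').target :=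
  fun _ hy ↦ (extChartAt (𝓡 3) c').map_source hy.2

omit [IsManifold (𝓡 3) ∞ M] in
lemma transition_extChartAt {c p : M} (c' : M) (hc : p ∈ (extChartAt (𝓡 3) c).source) :
    transition c c' (extChartAt (𝓡 3) c p) = extChartAt (𝓡 3) c' p := by
  rw [transition, (extChartAt (𝓡 3) c).left_inv hc]

lemma toCoord_transition {c c' p : M} (hc : p ∈ (extChartAt (𝓡 3) c).source)
    (hc' : p ∈ (extChartAt (𝓡 3) c').source) (v : TangentSpace (𝓡 3) p) :
    toCoord c' p v = fderiv ℝ (transition c c') (extChartAt (𝓡 3) c p) (toCoord c p v) := by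
  have h1 : MDifferentiableAt (𝓡 3) 𝓘(ℝ, E3) (extChartAt (𝓡 3) c) p :=
    mdifferentiableAt_extChartAt (by rwa [extChartAt_source] at hc)
  have hd : DifferentiableAt ℝ (transition c c') (extChartAt (𝓡 3) c p) :=
    ((contDiffOn_transition c c').contDiffAt
      ((isOpen_transitionDomain c c').mem_nhds (mem_transitionDomain hc hc'))).differentiableAt
      (by simp)
  have h2 : extChartAt (𝓡 3) c' =ᶠ[𝓝 p] transition c c' ∘ extChartAt (𝓡 3) c := by
    filter_upwards [(isOpen_extChartAt_source c).mem_nhds hc] with q hq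
    exact (transition_extChartAt c' hq).symm
  rw [toCoord, h2.mfderiv_eq, mfderiv_comp p hd.mdifferentiableAt h1, mfderiv_eq_fderiv]
  rfl

lemma fderiv_transition_surjective {c c' : M} {y : E3} (hy : y ∈ transitionDomain c c') :
    Function.Surjective (fderiv ℝ (transition c c') y) := by
  intro v
  have hc := (extChartAt (𝓡 3) c).map_target hy.1
  refine ⟨toCoord c _ (fromCoord c' ((extChartAt (𝓡 3) c).symm y) v), ?_⟩
  have := toCoord_transition hc hy.2 (fromCoord c' ((extChartAt (𝓡 3) c).symm y) v)
  rw [(extChartAt (𝓡 3) c).right_inv hy.1, toCoord_fromCoord hy.2] at this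
  exact this.symm

/-- Both sides are the same inner product on M, so transition maps are isometries and the
transformation laws above apply to them. -/
lemma chartMetric_transition {c c' : M} {y : E3} (hy : y ∈ transitionDomain c c') (u v : E3) :
    chartMetric g c y u v = chartMetric g c' (transition c c' y)
      (fderiv ℝ (transition c c') y u) (fderiv ℝ (transition c c') y v) := by
  have hc := (extChartAt (𝓡 3) c).map_target hy.1
  have key : ∀ u, fderiv ℝ (transition c c') y u = toCoord c' ((extChartAt (𝓡 3) c).symm y)
      (fromCoord c ((extChartAt (𝓡 3) c).symm y) u) := by
    intro u
    rw [toCoord_transition hc hy.2, (extChartAt (𝓡 3) c).right_inv hy.1, toCoord_fromCoord hc]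
  rw [chartMetric_eq_inner, inner_eq_chartMetric g hy.2, key, key]
  rfl

/-- The curvature `R(u, v) w` in the chart around `c`. -/
def chartCurvature (c : M) (y u v w : E3) : E3 := curvature (chartChristoffel g c) y u v w

lemma chartCurvature_transition {c c' p : M} (hc : p ∈ (extChartAt (𝓡 3) c).source)
    (hc' : p ∈ (extChartAt (𝓡 3) c').source) (u v w : TangentSpace (𝓡 3) p) :
    chartCurvature g c' (extChartAt (𝓡 3) c' p) (toCoord c' p u) (toCoord c' p v) (toCoord c' p w) =
      fderiv ℝ (transition c c') (extChartAt (𝓡 3) c p) (chartCurvature g c (extChartAt (𝓡 3) c p)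
        (toCoord c p u) (toCoord c p v) (toCoord c p w)) := by
  rw [toCoord_transition hc hc' u, toCoord_transition hc hc' v, toCoord_transition hc hc' w,
    ← transition_extChartAt c' hc]
  exact (IsLeviCivita.curvature_transform (isLeviCivita_chart g c) (isLeviCivita_chart g c')
    (isOpen_transitionDomain c c') inter_subset_left (contDiffOn_transition c c')
    (mapsTo_transition c c') (fun y hy ↦ fderiv_transition_surjective hy)
    (fun y hy ↦ chartMetric_transition g hy) (mem_transitionDomain hc hc') _ _ _).symm

lemma chartCurvature_single {c : M} {y : E3} (hy : y ∈ (extChartAt (𝓡 3) c).target)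
    (i j k l : Fin 3) :
    chartCurvature g c y (EuclideanSpace.single i 1) (EuclideanSpace.single j 1)
      (EuclideanSpace.single l 1) k = riemann g c i j k l y := by
  simp only [chartCurvature, curvature, PiLp.sub_apply, PiLp.add_apply,
    fderiv_chartChristoffel_single g hy, riemann, chartChristoffel_apply_coord g c y _
      (chartChristoffel g c y _ _)]
  simp [chartChristoffel_single, Finset.sum_sub_distrib]
  ring

end ChartMetric

/-! ### Curvature in an orthonormal frame -/

section Schouten

variable (g : Metric3 M)

lemma IsOrthonormal.eq_sum {p : M} {f : Fin 3 → TangentSpace (𝓡 3) p} (hf : IsOrthonormal g f)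
    (v : TangentSpace (𝓡 3) p) : v = ∑ a, g.inner p v (f a) • f a := by
  have hli : LinearIndependent ℝ f := by
    rw [Fintype.linearIndependent_iff]
    intro c hc i
    have := congrArg (fun w ↦ g.inner p w (f i)) hc
    simpa [hf _ i] using this
  have hcard : Fintype.card (Fin 3) = Module.finrank ℝ (TangentSpace (𝓡 3) p) := by
    have : Module.finrank ℝ (TangentSpace (𝓡 3) p) = Module.finrank ℝ E3 := rfl
    rw [this]; simp
  have : FiniteDimensional ℝ (TangentSpace (𝓡 3) p) := inferInstanceAs (FiniteDimensional ℝ E3)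
  have hspan : v ∈ Submodule.span ℝ (range f) := by
    rw [hli.span_eq_top_of_card_eq_finrank' hcard]; trivial
  obtain ⟨c, rfl⟩ := (Submodule.mem_span_range_iff_exists_fun ℝ).1 hspan
  refine Finset.sum_congr rfl fun a _ ↦ ?_
  simp [hf _ a]

lemma IsOrthonormal.inner_eq {p : M} {f : Fin 3 → TangentSpace (𝓡 3) p} (hf : IsOrthonormal g f)
    (v w : TangentSpace (𝓡 3) p) :
    g.inner p v w = ∑ a, g.inner p v (f a) * g.inner p w (f a) := by
  conv_lhs => rw [hf.eq_sum g w]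
  simp [mul_comm]

section
variable {E : Type*} [NormedAddCommGroup E] [NormedSpace ℝ E]

lemma curvature_add_left (Γ : E → E →L[ℝ] E →L[ℝ] E) (y u u' v w : E) :
    curvature Γ y (u + u') v w = curvature Γ y u v w + curvature Γ y u' v w := by
  simp [curvature]; abel

lemma curvature_smul_left (Γ : E → E →L[ℝ] E →L[ℝ] E) (y v w : E) (r : ℝ) (u : E) :
    curvature Γ y (r • u) v w = r • curvature Γ y u v w := by
  simp [curvature, smul_sub, smul_add]

/-- The endomorphism `u ↦ R(u, v) w`. -/
def curvatureLin (Γ : E → E →L[ℝ] E →L[ℝ] E) (y v w : E) : E →ₗ[ℝ] E where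
  toFun u := curvature Γ y u v w
  map_add' u u' := curvature_add_left Γ y u u' v w
  map_smul' r u := curvature_smul_left Γ y v w r u

lemma curvature_sum_mid (Γ : E → E →L[ℝ] E →L[ℝ] E) (y u w : E) (r : Fin 3 → ℝ) (v : Fin 3 → E) :
    curvature Γ y u (∑ i, r i • v i) w = ∑ i, r i • curvature Γ y u (v i) w := by
  simp [curvature, smul_sub, smul_add, Finset.sum_sub_distrib, Finset.sum_add_distrib]

lemma curvature_sum_right (Γ : E → E →L[ℝ] E →L[ℝ] E) (y u v : E) (r : Fin 3 → ℝ)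
    (w : Fin 3 → E) :
    curvature Γ y u v (∑ i, r i • w i) = ∑ i, r i • curvature Γ y u v (w i) := by
  simp [curvature, smul_sub, smul_add, Finset.sum_sub_distrib, Finset.sum_add_distrib]

end

/-- `g(R(u, v) w, z)`. -/
def curv4 (p : M) (u v w z : TangentSpace (𝓡 3) p) : ℝ :=
  chartMetric g p (extChartAt (𝓡 3) p p) (chartCurvature g p (extChartAt (𝓡 3) p p)
    (toCoord p p u) (toCoord p p v) (toCoord p p w)) (toCoord p p z)

lemma curv4_eq_chart {c p : M} (hc : p ∈ (extChartAt (𝓡 3) c).source)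
    (u v w z : TangentSpace (𝓡 3) p) :
    curv4 g p u v w z = chartMetric g c (extChartAt (𝓡 3) c p) (chartCurvature g c
      (extChartAt (𝓡 3) c p) (toCoord c p u) (toCoord c p v) (toCoord c p w)) (toCoord c p z) := by
  rw [curv4, chartCurvature_transition g hc (mem_source_self p),
    toCoord_transition hc (mem_source_self p) z,
    chartMetric_transition g (mem_transitionDomain hc (mem_source_self p)),
    transition_extChartAt p hc]

lemma curv4_add_left (p : M) (u u' v w z : TangentSpace (𝓡 3) p) :
    curv4 g p (u + u') v w z = curv4 g p u v w z + curv4 g p u' v w z := by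
  simp only [curv4, chartCurvature, map_add, curvature_add_left, add_apply]

lemma curv4_smul_left (p : M) (r : ℝ) (u v w z : TangentSpace (𝓡 3) p) :
    curv4 g p (r • u) v w z = r * curv4 g p u v w z := by
  simp only [curv4, chartCurvature, map_smul, curvature_smul_left, smul_apply, smul_eq_mul]

lemma curv4_swap (p : M) (u v w z : TangentSpace (𝓡 3) p) :
    curv4 g p u v w z = -curv4 g p v u w z := by
  simp only [curv4, chartCurvature]
  rw [IsLeviCivita.curvature_swap]
  simp

lemma curv4_antisymm (p : M) (u v w z : TangentSpace (𝓡 3) p) :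
    curv4 g p u v w z = -curv4 g p u v z w := by
  simp only [curv4, chartCurvature]
  rw [(isLeviCivita_chart g p).curvature_antisymm (mem_extChartAt_target p), chartMetric_symm]

lemma curv4_smul_mid (p : M) (r : ℝ) (u v w z : TangentSpace (𝓡 3) p) :
    curv4 g p u (r • v) w z = r * curv4 g p u v w z := by
  rw [curv4_swap, curv4_smul_left, curv4_swap g p v u]; ring

lemma curv4_bianchi (p : M) (u v w z : TangentSpace (𝓡 3) p) :
    curv4 g p u v w z + curv4 g p v w u z + curv4 g p w u v z = 0 := by
  simp only [curv4, chartCurvature, ← add_apply, ← map_add]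
  rw [(isLeviCivita_chart g p).bianchi (mem_extChartAt_target p)]
  simp

/-- Both sides are the trace of L. The Ricci tensor is defined as a trace over coordinate vectors
but is needed as a trace over an orthonormal frame. -/
lemma sum_coord_eq_trace {p : M} {f : Fin 3 → TangentSpace (𝓡 3) p} (hf : IsOrthonormal g f)
    (L : E3 →ₗ[ℝ] E3) :
    ∑ k, L (EuclideanSpace.single k 1) k = ∑ a, chartMetric g p (extChartAt (𝓡 3) p p)
      (L (toCoord p p (f a))) (toCoord p p (f a)) := by
  have h1 : ∀ u : E3, u = ∑ a, chartMetric g p (extChartAt (𝓡 3) p p) u (toCoord p p (f a)) •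
      toCoord p p (f a) := by
    intro u
    have := congrArg (toCoord p p) (hf.eq_sum g (fromCoord p p u))
    simp only [map_sum, map_smul, toCoord_fromCoord (mem_source_self p),
      inner_eq_chartMetric g (mem_source_self p)] at this
    exact this
  have h2 : ∀ k, L (EuclideanSpace.single k 1) k = ∑ a, chartMetric g p (extChartAt (𝓡 3) p p)
      (EuclideanSpace.single k 1) (toCoord p p (f a)) * L (toCoord p p (f a)) k := by
    intro k
    conv_lhs => rw [h1 (EuclideanSpace.single k 1)]
    simp [map_sum]
  rw [Finset.sum_congr rfl fun k _ ↦ h2 k, Finset.sum_comm]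
  refine Finset.sum_congr rfl fun a _ ↦ ?_
  conv_rhs => rw [E3_eq_sum (L (toCoord p p (f a)))]
  simp [map_sum, mul_comm]

lemma inner_schoutenOp {p : M} {f : Fin 3 → TangentSpace (𝓡 3) p} (hf : IsOrthonormal g f)
    (u w : TangentSpace (𝓡 3) p) :
    g.inner p (schoutenOp g p u) w = ∑ a, curv4 g p (f a) w u (f a)
      - (1 / 4) * scalarCurv g p (extChartAt (𝓡 3) p p) * g.inner p u w := by
  have hy := mem_extChartAt_target (I := 𝓡 3) p
  have h1 : ∑ a, curv4 g p (f a) w u (f a) = ∑ k, ∑ j,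
      ricci g p k j (extChartAt (𝓡 3) p p) * toCoord p p u j * toCoord p p w k := by
    have e1 := sum_coord_eq_trace g hf (curvatureLin (chartChristoffel g p)
      (extChartAt (𝓡 3) p p) (toCoord p p w) (toCoord p p u))
    have e2 : ∀ l, curvature (chartChristoffel g p) (extChartAt (𝓡 3) p p)
        (EuclideanSpace.single l 1) (toCoord p p w) (toCoord p p u) l = ∑ k, ∑ j,
        riemann g p l k l j (extChartAt (𝓡 3) p p) * toCoord p p u j * toCoord p p w k := by
      intro l
      conv_lhs => rw [E3_eq_sum (toCoord p p w), curvature_sum_mid]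
      conv_lhs =>
        enter [1, 2, k]
        rw [E3_eq_sum (toCoord p p u), curvature_sum_right]
      have := fun k j ↦ chartCurvature_single g hy l k l j
      simp only [chartCurvature] at this
      simp only [WithLp.ofLp_sum, WithLp.ofLp_smul, Finset.sum_apply, Pi.smul_apply, smul_eq_mul,
        this, Finset.mul_sum]
      refine Finset.sum_congr rfl fun i _ ↦ Finset.sum_congr rfl fun j _ ↦ by ring
    have e3 : ∑ a, curv4 g p (f a) w u (f a) = ∑ l, curvature (chartChristoffel g p)
        (extChartAt (𝓡 3) p p) (EuclideanSpace.single l 1) (toCoord p p w) (toCoord p p u) l :=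
      e1.symm
    rw [e3, Finset.sum_congr rfl fun l _ ↦ e2 l, Finset.sum_comm]
    refine Finset.sum_congr rfl fun k _ ↦ ?_
    rw [Finset.sum_comm]
    refine Finset.sum_congr rfl fun j _ ↦ ?_
    rw [ricci, Finset.sum_mul, Finset.sum_mul]
  have h2 : g.inner p (schoutenOp g p u) w = ∑ k, ∑ j,
      schouten g p k j (extChartAt (𝓡 3) p p) * toCoord p p u j * toCoord p p w k := by
    have e1 : ∀ i, g.inner p (coordVec p p i) w =
        ∑ m, metricCoeff g p m i (extChartAt (𝓡 3) p p) * toCoord p p w m := by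
      intro i
      rw [inner_eq_chartMetric g (mem_source_self p), coordVec,
        toCoord_fromCoord (mem_source_self p), chartMetric_apply]
      simp [metricCoeff_symm g p i]
    simp only [schoutenOp, map_sum, map_smul, FunLike.coe_sum, Finset.sum_apply, smul_apply,
      smul_eq_mul, e1]
    have e2 : ∀ k j, ∑ m, ∑ i, invCoeff g p i k (extChartAt (𝓡 3) p p) *
        schouten g p k j (extChartAt (𝓡 3) p p) * toCoord p p u j *
        (metricCoeff g p m i (extChartAt (𝓡 3) p p) * toCoord p p w m) =
        schouten g p k j (extChartAt (𝓡 3) p p) * toCoord p p u j * toCoord p p w k := by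
      intro k j
      have e3 : ∀ m, ∑ i, invCoeff g p i k (extChartAt (𝓡 3) p p) *
        schouten g p k j (extChartAt (𝓡 3) p p) * toCoord p p u j *
        (metricCoeff g p m i (extChartAt (𝓡 3) p p) * toCoord p p w m) =
        (if m = k then 1 else 0) * (schouten g p k j (extChartAt (𝓡 3) p p) * toCoord p p u j *
          toCoord p p w m) := by
        intro m
        rw [← sum_metricCoeff_invCoeff g hy m k, Finset.sum_mul]
        exact Finset.sum_congr rfl fun i _ ↦ by ring
      rw [Finset.sum_congr rfl fun m _ ↦ e3 m]
      simp
    simp only [← e2, Finset.sum_mul]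
    simp only [Finset.mul_sum]
    rw [Finset.sum_comm]
    refine Finset.sum_congr rfl fun k _ ↦ ?_
    rw [Finset.sum_comm]
    refine Finset.sum_congr rfl fun j _ ↦ ?_
    rw [Finset.sum_comm]
  rw [h2, h1, g.symm, inner_eq_chartMetric g (mem_source_self p), chartMetric_apply,
    Finset.mul_sum, ← Finset.sum_sub_distrib]
  refine Finset.sum_congr rfl fun k _ ↦ ?_
  rw [Finset.mul_sum, ← Finset.sum_sub_distrib]
  refine Finset.sum_congr rfl fun j _ ↦ ?_
  rw [schouten]
  ring

/-- This is where dimension three enters: in the trace for an off-diagonal Ricci component only the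
third index survives, and the scalar curvature term drops out by orthogonality. The Bianchi identity
then exchanges the two middle arguments. -/
lemma inner_schoutenOp_of_ne {p : M} {f : Fin 3 → TangentSpace (𝓡 3) p} (hf : IsOrthonormal g f) :
    g.inner p (schoutenOp g p (f 2)) (f 0) = curv4 g p (f 1) (f 2) (f 0) (f 1) := by
  have h1 : curv4 g p (f 0) (f 0) (f 2) (f 0) = 0 := by
    linarith [curv4_swap g p (f 0) (f 0) (f 2) (f 0)]
  have h2 : curv4 g p (f 2) (f 0) (f 2) (f 2) = 0 := by
    linarith [curv4_antisymm g p (f 2) (f 0) (f 2) (f 2)]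
  have h3 := curv4_bianchi g p (f 1) (f 0) (f 2) (f 1)
  have h4 : curv4 g p (f 0) (f 2) (f 1) (f 1) = 0 := by
    linarith [curv4_antisymm g p (f 0) (f 2) (f 1) (f 1)]
  rw [inner_schoutenOp g hf, Fin.sum_univ_three, h1, h2, hf 2 0]
  have h5 := curv4_swap g p (f 2) (f 1) (f 0) (f 1)
  simp
  linarith

lemma schoutenOp_smul (p : M) (r : ℝ) (u : TangentSpace (𝓡 3) p) :
    schoutenOp g p (r • u) = r • schoutenOp g p u := by
  simp only [schoutenOp, map_smul, PiLp.smul_apply, smul_eq_mul, Finset.smul_sum, smul_smul,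
    Finset.mul_sum]
  refine Finset.sum_congr rfl fun i _ ↦ ?_
  congr 1
  refine Finset.sum_congr rfl fun k _ ↦ Finset.sum_congr rfl fun j _ ↦ by ring

end Schouten

/-! ### The Levi-Civita connection along a map -/

section Pullback

variable {P : Type*} [NormedAddCommGroup P] [NormedSpace ℝ P] {X : P → M} {S : Set P} {z : P}

/-- Smoothness on `S` of a vector field along `X`. -/
abbrev SmoothField (X : P → M) (V : ∀ z, TangentSpace (𝓡 3) (X z)) (S : Set P) : Prop :=
  ContMDiffOn 𝓘(ℝ, P) (𝓡 3).tangent ∞ (fun w ↦ (⟨X w, V w⟩ : TangentBundle (𝓡 3) M)) S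

lemma SmoothField.smoothFieldAt {V : ∀ z, TangentSpace (𝓡 3) (X z)} (hV : SmoothField X V S)
    (hz : z ∈ S) : SmoothFieldAt X V S z := hV z hz

lemma SmoothField.base {V : ∀ z, TangentSpace (𝓡 3) (X z)} (hV : SmoothField X V S) :
    ContMDiffOn 𝓘(ℝ, P) (𝓡 3) ∞ X S :=
  fun _ hz ↦ (hV.smoothFieldAt hz).base

/-- The derivative of `X` within `S` in the direction `d`. -/
def pvel (X : P → M) (S : Set P) (d z : P) : TangentSpace (𝓡 3) (X z) :=
  mfderivWithin 𝓘(ℝ, P) (𝓡 3) X S z d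

variable (g : Metric3 M)

/-- The covariant derivative within `S`, in the direction `d`, of a vector field along `X`. -/
def pcov (X : P → M) (S : Set P) (d : P) (V : ∀ z, TangentSpace (𝓡 3) (X z)) (z : P) :
    TangentSpace (𝓡 3) (X z) :=
  fromCoord (X z) (X z) (covAlong (chartChristoffel g (X z))
    (fun w ↦ extChartAt (𝓡 3) (X z) (X w)) (fun w ↦ toCoord (X z) (X w) (V w)) S d z)

lemma toCoord_pvel {c : M} (hX : ContMDiffWithinAt 𝓘(ℝ, P) (𝓡 3) ∞ X S z)
    (hS : UniqueDiffWithinAt ℝ S z) (hc : X z ∈ (extChartAt (𝓡 3) c).source) (d : P) :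
    toCoord c (X z) (pvel X S d z) = fderivWithin ℝ (fun w ↦ extChartAt (𝓡 3) c (X w)) S z d := by
  have h1 : MDifferentiableAt (𝓡 3) 𝓘(ℝ, E3) (extChartAt (𝓡 3) c) (X z) :=
    mdifferentiableAt_extChartAt (by rwa [extChartAt_source] at hc)
  have h2 := mfderiv_comp_mfderivWithin z h1 (hX.mdifferentiableWithinAt (by simp))
    hS.uniqueMDiffWithinAt
  rw [mfderivWithin_eq_fderivWithin] at h2
  have h3 := DFunLike.congr_fun h2 d
  exact h3.symm

/-- The definition of `pcov` uses the chart around X z, which changes with z. Since transition maps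
are isometries, any fixed chart gives the same vector; this is what makes `pcov` smooth in z and
allows it to be iterated. -/
lemma toCoord_pcov {c : M} {V : ∀ z, TangentSpace (𝓡 3) (X z)} (hV : SmoothFieldAt X V S z)
    (hz : z ∈ S) (hS : UniqueDiffWithinAt ℝ S z) (hc : X z ∈ (extChartAt (𝓡 3) c).source) (d : P) :
    toCoord c (X z) (pcov g X S d V z) = covAlong (chartChristoffel g c)
      (fun w ↦ extChartAt (𝓡 3) c (X w)) (fun w ↦ toCoord c (X w) (V w)) S d z := by
  have hs := mem_source_self (X z)
  have hX := hV.base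
  rw [pcov, toCoord_transition hs hc, toCoord_fromCoord hs]
  symm
  have he : ∀ᶠ w in 𝓝[S] z, X w ∈ (extChartAt (𝓡 3) (X z)).source :=
    eventually_mem_source hX.continuousWithinAt hs
  have he' : ∀ᶠ w in 𝓝[S] z, X w ∈ (extChartAt (𝓡 3) c).source :=
    eventually_mem_source hX.continuousWithinAt hc
  refine IsLeviCivita.covAlong_transform (isLeviCivita_chart g (X z)) (isLeviCivita_chart g c)
    (isOpen_transitionDomain (X z) c) inter_subset_left (contDiffOn_transition _ _)
    (mapsTo_transition _ _) (fun y hy ↦ fderiv_transition_surjective hy)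
    (fun y hy ↦ chartMetric_transition g hy) hS hz (contDiffWithinAt_extChartAt hX hs)
    (hV.contDiffWithinAt hz hs) (mem_transitionDomain hs hc) ?_ ?_ d
  · filter_upwards [he] with w hw using (transition_extChartAt c hw).symm
  · filter_upwards [he, he'] with w hw hw' using toCoord_transition hw hw' _

variable (hS : UniqueDiffOn ℝ S)
include hS

lemma smoothField_pvel (hX : ContMDiffOn 𝓘(ℝ, P) (𝓡 3) ∞ X S) (d : P) :
    SmoothField X (pvel X S d) S := by
  intro z hz
  have hs := mem_source_self (X z)
  refine (smoothFieldAt_iff (hX z hz) hz hs).2 ?_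
  have h1 : ContDiffWithinAt ℝ ∞ (fderivWithin ℝ (fun w ↦ extChartAt (𝓡 3) (X z) (X w)) S) S z :=
    (contDiffWithinAt_extChartAt (hX z hz) hs).fderivWithin_right hS (by simp) hz
  refine (h1.clm_apply (contDiffWithinAt_const (c := d))).congr_of_eventuallyEq_of_mem ?_ hz
  filter_upwards [eventually_mem_source (hX z hz).continuousWithinAt hs, self_mem_nhdsWithin]
    with w hw hwS
  exact toCoord_pvel (hX w hwS) (hS w hwS) hw d

lemma smoothField_pcov {V : ∀ z, TangentSpace (𝓡 3) (X z)} (hV : SmoothField X V S) (d : P) :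
    SmoothField X (pcov g X S d V) S := by
  intro z hz
  have hs := mem_source_self (X z)
  have hX := hV.base z hz
  refine (smoothFieldAt_iff hX hz hs).2 ?_
  have h1 := (isLeviCivita_chart g (X z)).contDiffWithinAt_covAlong hS hz
    (contDiffWithinAt_extChartAt hX hs) ((hV.smoothFieldAt hz).contDiffWithinAt hz hs)
    (mem_extChartAt_target (X z)) d
  refine h1.congr_of_eventuallyEq_of_mem ?_ hz
  filter_upwards [eventually_mem_source hX.continuousWithinAt hs, self_mem_nhdsWithin]
    with w hw hwS
  exact toCoord_pcov g (hV w hwS) hwS (hS w hwS) hw d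

lemma fderivWithin_inner {V W : ∀ z, TangentSpace (𝓡 3) (X z)} (hz : z ∈ S)
    (hV : SmoothFieldAt X V S z) (hW : SmoothFieldAt X W S z) (d : P) :
    fderivWithin ℝ (fun w ↦ g.inner (X w) (V w) (W w)) S z d =
      g.inner (X z) (pcov g X S d V z) (W z) + g.inner (X z) (V z) (pcov g X S d W z) := by
  have hs := mem_source_self (X z)
  have hX := hV.base
  have h1 : (fun w ↦ g.inner (X w) (V w) (W w)) =ᶠ[𝓝[S] z] fun w ↦ chartMetric g (X z)
      (extChartAt (𝓡 3) (X z) (X w)) (toCoord (X z) (X w) (V w)) (toCoord (X z) (X w) (W w)) := by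
    filter_upwards [eventually_mem_source hX.continuousWithinAt hs] with w hw
    exact inner_eq_chartMetric g hw _ _
  rw [h1.fderivWithin_eq (h1.self_of_nhdsWithin hz),
    (isLeviCivita_chart g (X z)).fderivWithin_inner (hS z hz) (contDiffWithinAt_extChartAt hX hs)
      (hV.contDiffWithinAt hz hs) (hW.contDiffWithinAt hz hs) (mem_extChartAt_target (X z)),
    inner_eq_chartMetric g hs, inner_eq_chartMetric g hs, toCoord_pcov g hV hz (hS z hz) hs,
    toCoord_pcov g hW hz (hS z hz) hs]

lemma pcov_pvel_comm (hX : ContMDiffOn 𝓘(ℝ, P) (𝓡 3) ∞ X S) (hz : S ∈ 𝓝 z) (d d' : P) :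
    pcov g X S d (pvel X S d') z = pcov g X S d' (pvel X S d) z := by
  have hzS := mem_of_mem_nhds hz
  have hs := mem_source_self (X z)
  apply toCoord_injective hs
  have key : ∀ d d', toCoord (X z) (X z) (pcov g X S d (pvel X S d') z) =
      covAlong (chartChristoffel g (X z)) (fun w ↦ extChartAt (𝓡 3) (X z) (X w))
        (fun w ↦ fderivWithin ℝ (fun w ↦ extChartAt (𝓡 3) (X z) (X w)) S w d') S d z := by
    intro d d'
    rw [toCoord_pcov g (smoothField_pvel hS hX d' z hzS) hzS (hS z hzS) hs]
    refine covAlong_congr .rfl ?_ hzS d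
    filter_upwards [eventually_mem_source (hX z hzS).continuousWithinAt hs, self_mem_nhdsWithin]
      with w hw hwS
    exact toCoord_pvel (hX w hwS) (hS w hwS) hw d'
  rw [key, key]
  exact (isLeviCivita_chart g (X z)).covAlong_torsion_free hz
    ((contDiffWithinAt_extChartAt (hX z hzS) hs).contDiffAt hz) (mem_extChartAt_target (X z)) d d'

lemma inner_pcov_commutator {V : ∀ z, TangentSpace (𝓡 3) (X z)} (hV : SmoothField X V S)
    (hz : S ∈ 𝓝 z) (d d' : P) (u : TangentSpace (𝓡 3) (X z)) :
    g.inner (X z) (pcov g X S d (pcov g X S d' V) z) u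
      - g.inner (X z) (pcov g X S d' (pcov g X S d V) z) u =
      curv4 g (X z) (pvel X S d z) (pvel X S d' z) (V z) u := by
  have hzS := mem_of_mem_nhds hz
  have hs := mem_source_self (X z)
  have hX : ContMDiffOn 𝓘(ℝ, P) (𝓡 3) ∞ X S := hV.base
  -- Near z the inner derivative is replaced by its expression in one fixed chart, so that the
  -- commutator formula in coordinates applies.
  have key : ∀ d d', toCoord (X z) (X z) (pcov g X S d (pcov g X S d' V) z) =
      covAlong (chartChristoffel g (X z)) (fun w ↦ extChartAt (𝓡 3) (X z) (X w))
        (covAlong (chartChristoffel g (X z)) (fun w ↦ extChartAt (𝓡 3) (X z) (X w))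
          (fun w ↦ toCoord (X z) (X w) (V w)) S d') S d z := by
    intro d d'
    rw [toCoord_pcov g (smoothField_pcov g hS hV d' z hzS) hzS (hS z hzS) hs]
    refine covAlong_congr .rfl ?_ hzS d
    filter_upwards [eventually_mem_source (hX z hzS).continuousWithinAt hs, self_mem_nhdsWithin]
      with w hw hwS
    exact toCoord_pcov g (hV w hwS) hwS (hS w hwS) hw d'
  have h1 := (isLeviCivita_chart g (X z)).covAlong_commutator hz
    ((contDiffWithinAt_extChartAt (hX z hzS) hs).contDiffAt hz)
    (((hV.smoothFieldAt hzS).contDiffWithinAt hzS hs).contDiffAt hz) (mem_extChartAt_target (X z)) d d'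
  rw [← key, ← key, ← toCoord_pvel (hX z hzS) (hS z hzS) hs,
    ← toCoord_pvel (hX z hzS) (hS z hzS) hs] at h1
  rw [curv4, chartCurvature, ← h1, inner_eq_chartMetric g hs, inner_eq_chartMetric g hs]
  simp only [map_sub, sub_apply]

end Pullback

/-! ### Restriction along a map of parameters -/

section Restriction

variable {P : Type*} [NormedAddCommGroup P] [NormedSpace ℝ P] {X : P → M} {S : Set P}
  {Q : Type*} [NormedAddCommGroup Q] [NormedSpace ℝ Q] {T : Set Q} {q : Q} {ι : Q → P}
  {ι' : Q →L[ℝ] P} (hι : HasFDerivWithinAt ι ι' T q) (hT : UniqueDiffWithinAt ℝ T q)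
  (hST : MapsTo ι T S) (hq : q ∈ T) (hS : UniqueDiffWithinAt ℝ S (ι q))
include hι hT hST

omit [IsManifold (𝓡 3) ∞ M] in
lemma pvel_comp (hX : ContMDiffWithinAt 𝓘(ℝ, P) (𝓡 3) ∞ X S (ι q)) (d : Q) :
    pvel (fun s ↦ X (ι s)) T d q = pvel X S (ι' d) (ι q) := by
  have h := mfderivWithin_comp (I := 𝓘(ℝ, Q)) (I' := 𝓘(ℝ, P)) (I'' := 𝓡 3) q
    (hX.mdifferentiableWithinAt (by simp)) hι.differentiableWithinAt.mdifferentiableWithinAt hST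
    hT.uniqueMDiffWithinAt
  rw [mfderivWithin_eq_fderivWithin, hι.fderivWithin hT] at h
  exact DFunLike.congr_fun h d

include hq hS
-- The chain rule, used to pass from the rectangle of a variation to its individual curves and to
-- its ends.
lemma pcov_comp (g : Metric3 M) {V : ∀ z, TangentSpace (𝓡 3) (X z)}
    (hV : SmoothFieldAt X V S (ι q)) (d : Q) :
    pcov g (fun s ↦ X (ι s)) T d (fun s ↦ V (ι s)) q = pcov g X S (ι' d) V (ι q) := by
  have hs := mem_source_self (X (ι q))
  have h1 : HasFDerivWithinAt (fun s ↦ extChartAt (𝓡 3) (X (ι q)) (X (ι s))) _ T q :=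
    (contDiffWithinAt_extChartAt hV.base hs).hasFDerivWithinAt_infty.comp q hι hST
  have h2 : HasFDerivWithinAt (fun s ↦ toCoord (X (ι q)) (X (ι s)) (V (ι s))) _ T q :=
    (hV.contDiffWithinAt (hST hq) hs).hasFDerivWithinAt_infty.comp q hι hST
  simp only [pcov, covAlong, h1.fderivWithin hT, h2.fderivWithin hT]
  rfl

end Restriction

section CurveDerivative

variable (g : Metric3 M) {a b : ℝ} {γ : ℝ → M}

omit [IsManifold (𝓡 3) ∞ M] in
lemma velocity_eq_pvel (t : ℝ) : velocity a b γ t = pvel γ (Icc a b) 1 t := rfl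

lemma covDeriv_eq_pcov {V : ∀ t, TangentSpace (𝓡 3) (γ t)} {t : ℝ} (hab : a < b)
    (ht : t ∈ Icc a b) (hV : SmoothFieldAt γ V (Icc a b) t) :
    covDeriv g a b γ V t = pcov g γ (Icc a b) 1 V t := by
  have hs := mem_source_self (γ t)
  have hu : UniqueDiffWithinAt ℝ (Icc a b) t := uniqueDiffOn_Icc hab t ht
  rw [pcov, fromCoord_eq_sum, covDeriv]
  refine Finset.sum_congr rfl fun k _ ↦ ?_
  congr 1
  rw [covAlong, PiLp.add_apply, chartChristoffel_apply_coord]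
  congr 1
  · have h1 := (hV.contDiffWithinAt ht hs).hasFDerivWithinAt_infty
    have h2 := ((EuclideanSpace.proj k : E3 →L[ℝ] ℝ).hasFDerivAt.comp_hasFDerivWithinAt t h1)
    have h3 := h2.hasDerivWithinAt.derivWithin hu
    exact h3
  · rw [velocity_eq_pvel, toCoord_pvel hV.base hu hs]

end CurveDerivative

/-! ### Algebraic operations on smooth fields -/

section FieldAlgebra

variable {P : Type*} [NormedAddCommGroup P] [NormedSpace ℝ P] {X : P → M} {S : Set P}
  {V W : ∀ z, TangentSpace (𝓡 3) (X z)}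

lemma SmoothField.add (hV : SmoothField X V S) (hW : SmoothField X W S) :
    SmoothField X (fun z ↦ V z + W z) S := by
  intro z hz
  have hs := mem_source_self (X z)
  refine (smoothFieldAt_iff (hV.base z hz) hz hs).2 ?_
  simp only [map_add]
  exact (SmoothFieldAt.contDiffWithinAt (hV z hz) hz hs).add
    (SmoothFieldAt.contDiffWithinAt (hW z hz) hz hs)

lemma SmoothField.smul {f : P → ℝ} (hf : ContDiffOn ℝ ∞ f S) (hV : SmoothField X V S) :
    SmoothField X (fun z ↦ f z • V z) S := by
  intro z hz
  have hs := mem_source_self (X z)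
  refine (smoothFieldAt_iff (hV.base z hz) hz hs).2 ?_
  simp only [map_smul]
  exact (hf z hz).smul (SmoothFieldAt.contDiffWithinAt (hV z hz) hz hs)

lemma SmoothField.sub (hV : SmoothField X V S) (hW : SmoothField X W S) :
    SmoothField X (fun z ↦ V z - W z) S := by
  intro z hz
  have hs := mem_source_self (X z)
  refine (smoothFieldAt_iff (hV.base z hz) hz hs).2 ?_
  simp only [map_sub]
  exact (SmoothFieldAt.contDiffWithinAt (hV z hz) hz hs).sub
    (SmoothFieldAt.contDiffWithinAt (hW z hz) hz hs)

lemma SmoothField.inner (g : Metric3 M) (hV : SmoothField X V S) (hW : SmoothField X W S) :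
    ContDiffOn ℝ ∞ (fun z ↦ g.inner (X z) (V z) (W z)) S :=
  fun z hz ↦ smoothFieldAt_inner g (hV z hz) (hW z hz)

lemma SmoothField.comp {Q : Type*} [NormedAddCommGroup Q] [NormedSpace ℝ Q] {T : Set Q}
    {ι : Q → P} (hV : SmoothField X V S) (hι : ContDiffOn ℝ ∞ ι T) (hST : MapsTo ι T S) :
    SmoothField (fun q ↦ X (ι q)) (fun q ↦ V (ι q)) T :=
  ContMDiffOn.comp hV hι.contMDiffOn hST

end FieldAlgebra

/-! ### Moving frames -/

section MovingFrame

variable (g : Metric3 M)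

lemma inner_self_pos {p : M} {u : TangentSpace (𝓡 3) p} (hu : u ≠ 0) : 0 < g.inner p u u :=
  g.pos p u hu

lemma inner_self_nonneg (p : M) (u : TangentSpace (𝓡 3) p) : 0 ≤ g.inner p u u := by
  by_cases hu : u = 0
  · simp [hu]
  · exact (inner_self_pos g hu).le

lemma len_pos {p : M} {u : TangentSpace (𝓡 3) p} (hu : u ≠ 0) : 0 < len g u :=
  Real.sqrt_pos.2 (inner_self_pos g hu)

lemma len_sq {p : M} (u : TangentSpace (𝓡 3) p) : len g u ^ 2 = g.inner p u u :=
  Real.sq_sqrt (inner_self_nonneg g p u)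

variable {P : Type*} [NormedAddCommGroup P] [NormedSpace ℝ P]

/-- A smooth orthonormal frame along `X` whose last vector is the normalized derivative of `X` in
the direction `d`. -/
structure IsAdaptedFrame (X : P → M) (S : Set P) (d : P)
    (E : ∀ z, Fin 3 → TangentSpace (𝓡 3) (X z)) : Prop where
  smooth : ∀ i, SmoothField X (fun z ↦ E z i) S
  orthonormal : ∀ z ∈ S, IsOrthonormal g (E z)
  pvel_ne : ∀ z ∈ S, pvel X S d z ≠ 0
  tangent : ∀ z ∈ S, E z 2 = (len g (pvel X S d z))⁻¹ • pvel X S d z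

/-- The connection coefficients `g(∇_d E_i, E_j)` of a frame. -/
def frameConn (X : P → M) (S : Set P) (d : P) (E : ∀ z, Fin 3 → TangentSpace (𝓡 3) (X z))
    (i j : Fin 3) (z : P) : ℝ :=
  g.inner (X z) (pcov g X S d (fun w ↦ E w i) z) (E z j)

/-- The components of a vector field in a frame. -/
def frameComp (X : P → M) (V : ∀ z, TangentSpace (𝓡 3) (X z))
    (E : ∀ z, Fin 3 → TangentSpace (𝓡 3) (X z)) (i : Fin 3) (z : P) : ℝ :=
  g.inner (X z) (V z) (E z i)

variable {X : P → M} {S : Set P} {E : ∀ z, Fin 3 → TangentSpace (𝓡 3) (X z)}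
  (hS : UniqueDiffOn ℝ S)

lemma contDiffOn_frameComp (hE : ∀ i, SmoothField X (fun z ↦ E z i) S)
    {V : ∀ z, TangentSpace (𝓡 3) (X z)} (hV : SmoothField X V S) (i : Fin 3) :
    ContDiffOn ℝ ∞ (frameComp g X V E i) S :=
  hV.inner g (hE i)

include hS

lemma contDiffOn_frameConn (hE : ∀ i, SmoothField X (fun z ↦ E z i) S) (d : P) (i j : Fin 3) :
    ContDiffOn ℝ ∞ (frameConn g X S d E i j) S :=
  (smoothField_pcov g hS (hE i) d).inner g (hE j)

/-- The functions g(Eᵢ, Eⱼ) are constant. -/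
lemma frameConn_antisymm (hE : ∀ i, SmoothField X (fun z ↦ E z i) S)
    (ho : ∀ z ∈ S, IsOrthonormal g (E z)) {z : P} (hz : z ∈ S) (d : P) (i j : Fin 3) :
    frameConn g X S d E i j z = -frameConn g X S d E j i z := by
  have h1 := fderivWithin_inner g hS hz (hE i z hz) (hE j z hz) d
  have h2 : fderivWithin ℝ (fun w ↦ g.inner (X w) (E w i) (E w j)) S z =
      fderivWithin ℝ (fun _ ↦ if i = j then (1 : ℝ) else 0) S z :=
    fderivWithin_congr (fun w hw ↦ ho w hw i j) (ho z hz i j)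
  rw [h2, fderivWithin_fun_const] at h1
  rw [frameConn, frameConn, ← g.symm (X z) (E z i)]
  simp at h1
  linarith

/-- The components of a covariant derivative. -/
lemma inner_pcov (hE : ∀ i, SmoothField X (fun z ↦ E z i) S)
    (ho : ∀ z ∈ S, IsOrthonormal g (E z)) {V : ∀ z, TangentSpace (𝓡 3) (X z)}
    (hV : SmoothField X V S) {z : P} (hz : z ∈ S) (d : P) (i : Fin 3) :
    g.inner (X z) (pcov g X S d V z) (E z i) = fderivWithin ℝ (frameComp g X V E i) S z d
      - ∑ k, frameComp g X V E k z * frameConn g X S d E i k z := by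
  have h1 := fderivWithin_inner g hS hz (hV z hz) (hE i z hz) d
  have h2 := (ho z hz).inner_eq g (V z) (pcov g X S d (fun w ↦ E w i) z)
  have h3 : fderivWithin ℝ (frameComp g X V E i) S z d = _ := h1
  rw [h3, h2]
  simp [frameComp, frameConn]

/-- Cartan's second structure equation. Differentiating g(∇_{d'} Eᵢ, Eⱼ) along d gives a second
covariant derivative and a product of connection coefficients; antisymmetrizing in d and d' turns
the former into curvature. -/
lemma structure_equation (hE : ∀ i, SmoothField X (fun z ↦ E z i) S)
    (ho : ∀ z ∈ S, IsOrthonormal g (E z)) {z : P} (hz : S ∈ 𝓝 z) (d d' : P) (i j : Fin 3) :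
    fderivWithin ℝ (frameConn g X S d' E i j) S z d - fderivWithin ℝ (frameConn g X S d E i j) S z d'
      = curv4 g (X z) (pvel X S d z) (pvel X S d' z) (E z i) (E z j)
        + ∑ k, (frameConn g X S d' E i k z * frameConn g X S d E j k z
          - frameConn g X S d E i k z * frameConn g X S d' E j k z) := by
  have hzS := mem_of_mem_nhds hz
  have key : ∀ d d', fderivWithin ℝ (frameConn g X S d' E i j) S z d =
      g.inner (X z) (pcov g X S d (pcov g X S d' (fun w ↦ E w i)) z) (E z j)
        + ∑ k, frameConn g X S d' E i k z * frameConn g X S d E j k z := by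
    intro d d'
    have h1 := fderivWithin_inner g hS hzS (smoothField_pcov g hS (hE i) d' z hzS) (hE j z hzS) d
    have h2 := (ho z hzS).inner_eq g (pcov g X S d' (fun w ↦ E w i) z)
      (pcov g X S d (fun w ↦ E w j) z)
    rw [h2] at h1
    exact h1
  rw [key, key, ← inner_pcov_commutator g hS (hE i) hz d d' (E z j), Finset.sum_sub_distrib]
  ring

namespace IsAdaptedFrame

variable {g} {d : P} (hE : IsAdaptedFrame g X S d E)
include hE

omit hS in
lemma base : ContMDiffOn 𝓘(ℝ, P) (𝓡 3) ∞ X S := (hE.smooth 0).base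

omit hS in
lemma pvel_eq {z : P} (hz : z ∈ S) : pvel X S d z = len g (pvel X S d z) • E z 2 := by
  rw [hE.tangent z hz, smul_smul, mul_inv_cancel₀ (len_pos g (hE.pvel_ne z hz)).ne', one_smul]

omit hS in
lemma pvel_comp {z : P} (hz : z ∈ S) (i : Fin 3) :
    frameComp g X (pvel X S d) E i z = if i = 2 then len g (pvel X S d z) else 0 := by
  rw [frameComp, hE.pvel_eq hz, map_smul, smul_apply, hE.orthonormal z hz 2 i, ← hE.pvel_eq hz]
  split_ifs <;> simp_all

omit hS in
lemma len_pvel {z : P} (hz : z ∈ S) : len g (pvel X S d z) = frameComp g X (pvel X S d) E 2 z := by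
  rw [hE.pvel_comp hz]; simp

lemma contDiffOn_speed : ContDiffOn ℝ ∞ (fun z ↦ len g (pvel X S d z)) S :=
  (contDiffOn_frameComp g hE.smooth (smoothField_pvel hS hE.base d) 2).congr
    fun _ hz ↦ hE.len_pvel hz

lemma frameConn_self {z : P} (hz : z ∈ S) (d' : P) (i : Fin 3) :
    frameConn g X S d' E i i z = 0 := by
  linarith [frameConn_antisymm g hS hE.smooth hE.orthonormal hz d' i i]

omit hS in
lemma fderivWithin_pvel_comp {z : P} (hz : z ∈ S) (d' : P) {i : Fin 3} (hi : i ≠ 2) :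
    fderivWithin ℝ (frameComp g X (pvel X S d) E i) S z d' = 0 := by
  have h2 : fderivWithin ℝ (frameComp g X (pvel X S d) E i) S z =
      fderivWithin ℝ (fun _ ↦ (0 : ℝ)) S z :=
    fderivWithin_congr (fun w hw ↦ by rw [hE.pvel_comp hw, if_neg hi])
      (by rw [hE.pvel_comp hz, if_neg hi])
  rw [h2]; simp

omit hS in
lemma fderivWithin_speed {z : P} (hz : z ∈ S) (d' : P) :
    fderivWithin ℝ (frameComp g X (pvel X S d) E 2) S z d' =
      fderivWithin ℝ (fun z ↦ len g (pvel X S d z)) S z d' := by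
  rw [fderivWithin_congr (fun w hw ↦ hE.len_pvel hw) (hE.len_pvel hz)]

lemma accel_comp {z : P} (hz : z ∈ S) {i : Fin 3} (hi : i ≠ 2) :
    g.inner (X z) (pcov g X S d (pvel X S d) z) (E z i) =
      -(len g (pvel X S d z) * frameConn g X S d E i 2 z) := by
  rw [inner_pcov g hS hE.smooth hE.orthonormal (smoothField_pvel hS hE.base d) hz,
    hE.fderivWithin_pvel_comp hz d hi, Fin.sum_univ_three]
  simp [hE.pvel_comp hz]

lemma accel_comp_two {z : P} (hz : z ∈ S) :
    g.inner (X z) (pcov g X S d (pvel X S d) z) (E z 2) =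
      fderivWithin ℝ (fun z ↦ len g (pvel X S d z)) S z d := by
  rw [inner_pcov g hS hE.smooth hE.orthonormal (smoothField_pvel hS hE.base d) hz,
    hE.fderivWithin_speed hz d, Fin.sum_univ_three, hE.frameConn_self hS hz]
  simp [hE.pvel_comp hz]

/-- The `E_i`-component, `i ≠ 2`, of the left-hand side of the conformal geodesic equation. -/
lemma geodesic_comp {z : P} (hz : z ∈ S) {i j : Fin 3} (hi : i ≠ 2) (hj : j ≠ 2) (hij : i ≠ j) :
    g.inner (X z) (pcov g X S d (pcov g X S d (pvel X S d)) z
      - (3 * g.inner (X z) (pvel X S d z) (pcov g X S d (pvel X S d) z)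
        / (len g (pvel X S d z)) ^ 2) • pcov g X S d (pvel X S d) z
      - (len g (pvel X S d z)) ^ 2 • schoutenOp g (X z) (pvel X S d z)) (E z i) =
    -(len g (pvel X S d z) * fderivWithin ℝ (frameConn g X S d E i 2) S z d)
      + fderivWithin ℝ (fun z ↦ len g (pvel X S d z)) S z d * frameConn g X S d E i 2 z
      + len g (pvel X S d z) * frameConn g X S d E j 2 z * frameConn g X S d E i j z
      - len g (pvel X S d z) ^ 3 * g.inner (X z) (schoutenOp g (X z) (E z 2)) (E z i) := by
  set v := len g (pvel X S d z) with hv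
  have hv0 : v ≠ 0 := (len_pos g (hE.pvel_ne z hz)).ne'
  have hA := smoothField_pcov g hS (smoothField_pvel hS hE.base d) d
  have h1 : g.inner (X z) (pvel X S d z) (pcov g X S d (pvel X S d) z) =
      v * fderivWithin ℝ (fun z ↦ len g (pvel X S d z)) S z d := by
    rw [hE.pvel_eq hz, map_smul, smul_apply, g.symm, hE.accel_comp_two hS hz, smul_eq_mul]
  have h2 : g.inner (X z) (pcov g X S d (pcov g X S d (pvel X S d)) z) (E z i) =
      -(v * fderivWithin ℝ (frameConn g X S d E i 2) S z d
        + fderivWithin ℝ (fun z ↦ len g (pvel X S d z)) S z d * frameConn g X S d E i 2 z)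
      + v * frameConn g X S d E j 2 z * frameConn g X S d E i j z
      - fderivWithin ℝ (fun z ↦ len g (pvel X S d z)) S z d * frameConn g X S d E i 2 z := by
    rw [inner_pcov g hS hE.smooth hE.orthonormal hA hz]
    have h3 : fderivWithin ℝ (frameComp g X (pcov g X S d (pvel X S d)) E i) S z =
        fderivWithin ℝ (fun z ↦ -(len g (pvel X S d z) * frameConn g X S d E i 2 z)) S z :=
      fderivWithin_congr (fun w hw ↦ hE.accel_comp hS hw hi) (hE.accel_comp hS hz hi)
    have h4 : HasFDerivWithinAt (fun z ↦ -(len g (pvel X S d z) * frameConn g X S d E i 2 z)) _ S z :=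
      ((hE.contDiffOn_speed hS z hz).hasFDerivWithinAt_infty.mul
      (contDiffOn_frameConn g hS hE.smooth d i 2 z hz).hasFDerivWithinAt_infty).neg
    have h5 : ∑ k, frameComp g X (pcov g X S d (pvel X S d)) E k z * frameConn g X S d E i k z =
        -(v * frameConn g X S d E j 2 z) * frameConn g X S d E i j z
        + fderivWithin ℝ (fun z ↦ len g (pvel X S d z)) S z d * frameConn g X S d E i 2 z := by
      -- The indices i, j and 2 exhaust the frame.
      have h6 : ∀ f : Fin 3 → ℝ, ∑ k, f k = f i + f j + f 2 := by
        intro f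
        rw [Fin.sum_univ_three]
        fin_cases i <;> fin_cases j <;> simp_all; ring
      rw [h6, hE.frameConn_self hS hz, frameComp, frameComp, frameComp, hE.accel_comp hS hz hj,
        hE.accel_comp_two hS hz]
      ring
    rw [h3, h4.fderivWithin (hS z hz), h5]
    simp
    ring
  have h3 : g.inner (X z) (schoutenOp g (X z) (pvel X S d z)) (E z i) =
      v * g.inner (X z) (schoutenOp g (X z) (E z 2)) (E z i) := by
    rw [hE.pvel_eq hz, schoutenOp_smul, map_smul, smul_apply, smul_eq_mul]
  simp only [map_sub, sub_apply, map_smul, smul_apply, smul_eq_mul]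
  -- The derivative of the speed multiplies ωᵢ₂ with coefficient -1 - 1 from the third derivative
  -- and +3 from the correction term. The total +1 leaves -v ωᵢ₂' + v' ωᵢ₂ = -v² (ωᵢ₂/v)', the form
  -- needed in the first variation.
  rw [h1, h2, h3, hE.accel_comp hS hz hi]
  field_simp
  ring

/-- The first variation formula, in infinitesimal form. -/
lemma first_variation {z : P} (hz : S ∈ 𝓝 z) (e : P) (J : TangentSpace (𝓡 3) (X z))
    (hJ : J = pcov g X S d (pcov g X S d (pvel X S d)) z
      - (3 * g.inner (X z) (pvel X S d z) (pcov g X S d (pvel X S d) z)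
        / (len g (pvel X S d z)) ^ 2) • pcov g X S d (pvel X S d) z
      - (len g (pvel X S d z)) ^ 2 • schoutenOp g (X z) (pvel X S d z)) :
    fderivWithin ℝ (frameConn g X S d E 0 1) S z e =
      fderivWithin ℝ (fun w ↦ frameConn g X S e E 0 1 w + (len g (pvel X S d w))⁻¹ *
        (frameConn g X S d E 1 2 w * frameComp g X (pvel X S e) E 0 w
          - frameConn g X S d E 0 2 w * frameComp g X (pvel X S e) E 1 w)) S z d
      + ((len g (pvel X S d z)) ^ 2)⁻¹ *
        (frameComp g X (pvel X S e) E 0 z * g.inner (X z) J (E z 1)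
          - frameComp g X (pvel X S e) E 1 z * g.inner (X z) J (E z 0)) := by
  have hzS := mem_of_mem_nhds hz
  have hv0 : len g (pvel X S d z) ≠ 0 := (len_pos g (hE.pvel_ne z hzS)).ne'
  have hW := smoothField_pvel hS hE.base e
  have hU := smoothField_pvel hS hE.base d
  have ho := hE.orthonormal z hzS
  have se := structure_equation g hS hE.smooth hE.orthonormal hz e d 0 1
  have tor := pcov_pvel_comm g hS hE.base hz e d
  -- The normal components of ∇_e ẋ = ∇_d W. The velocity has only an E₂-component, so the left side
  -- reduces to the coefficient ωᵢ₂ in the direction e.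
  have tors : ∀ i : Fin 3, i ≠ 2 → -(len g (pvel X S d z) * frameConn g X S e E i 2 z) =
      fderivWithin ℝ (frameComp g X (pvel X S e) E i) S z d
      - ∑ k, frameComp g X (pvel X S e) E k z * frameConn g X S d E i k z := by
    intro i hi
    rw [← inner_pcov g hS hE.smooth hE.orthonormal hW hzS, ← tor,
      inner_pcov g hS hE.smooth hE.orthonormal hU hzS, hE.fderivWithin_pvel_comp hzS e hi,
      Fin.sum_univ_three]
    simp [hE.pvel_comp hzS]
  have t0 := tors 0 (by decide)
  have t1 := tors 1 (by decide)
  have J0 := hE.geodesic_comp hS hzS (i := 0) (j := 1) (by decide) (by decide) (by decide)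
  have J1 := hE.geodesic_comp hS hzS (i := 1) (j := 0) (by decide) (by decide) (by decide)
  rw [← hJ] at J0 J1
  rw [inner_schoutenOp_of_ne g ho] at J0
  -- The curvature identity for Schouten components is used for (E₀, E₁, E₂) and for the frame with
  -- E₀ and E₁ exchanged; it does not depend on orientation.
  have ho' : IsOrthonormal g (fun i ↦ E z (Equiv.swap 0 1 i)) := by
    intro i j
    rw [ho]; simp
  have hP1 := inner_schoutenOp_of_ne g ho'
  have s0 : Equiv.swap (0 : Fin 3) 1 0 = 1 := by decide
  have s1 : Equiv.swap (0 : Fin 3) 1 1 = 0 := by decide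
  have s2 : Equiv.swap (0 : Fin 3) 1 2 = 2 := by decide
  simp only [s0, s1, s2] at hP1
  rw [hP1] at J1
  -- Expanding W in the frame, its tangential part contributes nothing because R(E₂, E₂) = 0.
  have hR : curv4 g (X z) (pvel X S e z) (pvel X S d z) (E z 0) (E z 1) = len g (pvel X S d z) *
      (frameComp g X (pvel X S e) E 1 z * curv4 g (X z) (E z 1) (E z 2) (E z 0) (E z 1)
        - frameComp g X (pvel X S e) E 0 z * curv4 g (X z) (E z 0) (E z 2) (E z 1) (E z 0)) := by
    have hd := ho.eq_sum g (pvel X S e z)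
    have h22 : curv4 g (X z) (E z 2) (E z 2) (E z 0) (E z 1) = 0 := by
      linarith [curv4_swap g (X z) (E z 2) (E z 2) (E z 0) (E z 1)]
    have h01 := curv4_antisymm g (X z) (E z 0) (E z 2) (E z 0) (E z 1)
    rw [hE.pvel_eq hzS, curv4_smul_mid, ← hE.pvel_eq hzS]
    conv_lhs => rw [hd, Fin.sum_univ_three, curv4_add_left, curv4_add_left, curv4_smul_left,
      curv4_smul_left, curv4_smul_left, h22, h01]
    simp only [frameComp]
    ring
  have hv := (hE.contDiffOn_speed hS z hzS).hasFDerivWithinAt_infty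
  have hc := fun i j ↦ (contDiffOn_frameConn g hS hE.smooth d i j z hzS).hasFDerivWithinAt_infty
  have hw := fun i ↦ (contDiffOn_frameComp g hE.smooth hW i z hzS).hasFDerivWithinAt_infty
  have hce := (contDiffOn_frameConn g hS hE.smooth e 0 1 z hzS).hasFDerivWithinAt_infty
  have hvi : HasFDerivWithinAt (fun w ↦ (len g (pvel X S d w))⁻¹) _ S z :=
    (hasDerivAt_inv hv0).comp_hasFDerivWithinAt z hv
  have hB : HasFDerivWithinAt (fun w ↦ frameConn g X S e E 0 1 w + (len g (pvel X S d w))⁻¹ *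
        (frameConn g X S d E 1 2 w * frameComp g X (pvel X S e) E 0 w
          - frameConn g X S d E 0 2 w * frameComp g X (pvel X S e) E 1 w)) _ S z :=
    hce.add (hvi.mul (((hc 1 2).mul (hw 0)).sub ((hc 0 2).mul (hw 1))))
  rw [hB.fderivWithin (hS z hzS), J0, J1]
  rw [Fin.sum_univ_three, hE.frameConn_self hS hzS, hE.frameConn_self hS hzS,
    hE.frameConn_self hS hzS, hE.frameConn_self hS hzS, hR] at se
  rw [Fin.sum_univ_three, hE.frameConn_self hS hzS] at t0 t1
  have a10 := frameConn_antisymm g hS hE.smooth hE.orthonormal hzS d 1 0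
  rw [a10] at t1 ⊢
  simp only [add_apply, smul_apply, sub_apply, smul_eq_mul]
  generalize frameConn g X S d E 0 1 z = o at *
  generalize frameConn g X S d E 0 2 z = p at *
  generalize frameConn g X S d E 1 2 z = q at *
  generalize frameComp g X (pvel X S e) E 0 z = w0 at *
  generalize frameComp g X (pvel X S e) E 1 z = w1 at *
  generalize frameComp g X (pvel X S e) E 2 z = w2 at *
  generalize fderivWithin ℝ (frameComp g X (pvel X S e) E 0) S z d = w0' at *
  generalize fderivWithin ℝ (frameComp g X (pvel X S e) E 1) S z d = w1' at *
  generalize fderivWithin ℝ (frameConn g X S d E 0 1) S z e = A at *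
  generalize fderivWithin ℝ (frameConn g X S e E 0 1) S z d = B at *
  generalize fderivWithin ℝ (frameConn g X S d E 0 2) S z d = p' at *
  generalize fderivWithin ℝ (frameConn g X S d E 1 2) S z d = q' at *
  generalize fderivWithin ℝ (fun z ↦ len g (pvel X S d z)) S z d = v' at *
  generalize frameConn g X S e E 0 2 z = m0 at *
  generalize frameConn g X S e E 1 2 z = m1 at *
  generalize len g (pvel X S d z) = v at *
  generalize curv4 g (X z) (E z 1) (E z 2) (E z 0) (E z 1) = P0 at *
  generalize curv4 g (X z) (E z 0) (E z 2) (E z 1) (E z 0) = P1 at *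
  -- Torsion-freeness is solved for ω₀₂(e) and, next, for ω₁₂(e). After substitution into the
  -- structure equation the claim is a rational identity; the tangential component w2 cancels, and
  -- the derivatives w0', w1' are matched by the product rule in the exact term.
  have hm0 : m0 = -v⁻¹ * (w0' - (w0 * 0 + w1 * o + w2 * p)) := by
    rw [← t0]; field_simp
  have hm1 : m1 = -v⁻¹ * (w1' - (w0 * -o + w1 * 0 + w2 * q)) := by
    rw [← t1]; field_simp
  rw [eq_add_of_sub_eq se, hm0, hm1]
  field_simp
  ring

end IsAdaptedFrame

end MovingFrame

/-! ### Strips -/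

section Strip

/-- The closed rectangle `[-δ, δ] × [a, b]`. -/
def strip (δ a b : ℝ) : Set (ℝ × ℝ) := Icc (-δ) δ ×ˢ Icc a b

variable {δ a b : ℝ}

lemma uniqueDiffOn_strip (hδ : 0 < δ) (hab : a < b) : UniqueDiffOn ℝ (strip δ a b) :=
  (uniqueDiffOn_Icc (by linarith)).prod (uniqueDiffOn_Icc hab)

lemma isCompact_strip : IsCompact (strip δ a b) := isCompact_Icc.prod isCompact_Icc

lemma strip_mem_nhds {ε t : ℝ} (hε : ε ∈ Ioo (-δ) δ) (ht : t ∈ Ioo a b) :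
    strip δ a b ∈ 𝓝 (ε, t) :=
  prod_mem_nhds (Icc_mem_nhds hε.1 hε.2) (Icc_mem_nhds ht.1 ht.2)

lemma zero_mem_Icc (hδ : 0 < δ) : (0 : ℝ) ∈ Icc (-δ) δ := ⟨by linarith, hδ.le⟩

lemma hasFDerivWithinAt_inl (ε t : ℝ) (T : Set ℝ) :
    HasFDerivWithinAt (fun s : ℝ ↦ (s, t)) (ContinuousLinearMap.inl ℝ ℝ ℝ) T ε :=
  (hasFDerivAt_prodMk_left ε t).hasFDerivWithinAt

lemma hasFDerivWithinAt_inr (ε t : ℝ) (T : Set ℝ) :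
    HasFDerivWithinAt (fun s : ℝ ↦ (ε, s)) (ContinuousLinearMap.inr ℝ ℝ ℝ) T t :=
  (hasFDerivAt_prodMk_right ε t).hasFDerivWithinAt

lemma mapsTo_inl {t : ℝ} (ht : t ∈ Icc a b) :
    MapsTo (fun s : ℝ ↦ (s, t)) (Icc (-δ) δ) (strip δ a b) := fun _ hs ↦ ⟨hs, ht⟩

lemma mapsTo_inr {ε : ℝ} (hε : ε ∈ Icc (-δ) δ) :
    MapsTo (fun s : ℝ ↦ (ε, s)) (Icc a b) (strip δ a b) := fun _ hs ↦ ⟨hε, hs⟩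

section Functions

variable {h : ℝ × ℝ → ℝ} (hh : ContDiffOn ℝ ∞ h (strip δ a b))
include hh

lemma hasDerivWithinAt_fst {ε t : ℝ} (hε : ε ∈ Icc (-δ) δ) (ht : t ∈ Icc a b) :
    HasDerivWithinAt (fun s ↦ h (s, t)) (fderivWithin ℝ h (strip δ a b) (ε, t) (1, 0))
      (Icc (-δ) δ) ε := by
  have h1 := (hh (ε, t) ⟨hε, ht⟩).hasFDerivWithinAt_infty.comp ε (hasFDerivWithinAt_inl ε t _)
    (mapsTo_inl ht)
  have h2 := h1.hasDerivWithinAt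
  rw [ContinuousLinearMap.comp_apply, ContinuousLinearMap.inl_apply] at h2
  exact h2

lemma hasDerivWithinAt_snd {ε t : ℝ} (hε : ε ∈ Icc (-δ) δ) (ht : t ∈ Icc a b) :
    HasDerivWithinAt (fun s ↦ h (ε, s)) (fderivWithin ℝ h (strip δ a b) (ε, t) (0, 1))
      (Icc a b) t := by
  have h1 := (hh (ε, t) ⟨hε, ht⟩).hasFDerivWithinAt_infty.comp t (hasFDerivWithinAt_inr ε t _)
    (mapsTo_inr hε)
  have h2 := h1.hasDerivWithinAt
  rw [ContinuousLinearMap.comp_apply, ContinuousLinearMap.inr_apply] at h2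
  exact h2

omit hh in
lemma continuousOn_slice {f : ℝ × ℝ → ℝ} (hf : ContinuousOn f (strip δ a b)) {ε : ℝ}
    (hε : ε ∈ Icc (-δ) δ) : ContinuousOn (fun t ↦ f (ε, t)) (Icc a b) :=
  hf.comp (by fun_prop) (mapsTo_inr hε)

lemma contDiffOn_fderivWithin_apply (hδ : 0 < δ) (hab : a < b) (d : ℝ × ℝ) :
    ContDiffOn ℝ ∞ (fun z ↦ fderivWithin ℝ h (strip δ a b) z d) (strip δ a b) :=
  (hh.fderivWithin (uniqueDiffOn_strip hδ hab) (by simp)).clm_apply contDiffOn_const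

/-- Differentiation under the integral sign, with the bound on the ε-derivative provided by
compactness of the rectangle. -/
lemma hasDerivAt_integral_strip (hδ : 0 < δ) (hab : a < b) :
    HasDerivAt (fun ε ↦ ∫ t in a..b, h (ε, t))
      (∫ t in a..b, fderivWithin ℝ h (strip δ a b) (0, t) (1, 0)) 0 := by
  have hd := (contDiffOn_fderivWithin_apply hh hδ hab (1, 0)).continuousOn
  obtain ⟨C, hC⟩ := isCompact_strip.exists_bound_of_continuousOn hd
  have hsub : uIoc a b ⊆ Icc a b := by rw [uIoc_of_le hab.le]; exact Ioc_subset_Icc_self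
  have hmeas : ∀ f : ℝ → ℝ, ContinuousOn f (Icc a b) →
      AEStronglyMeasurable f (volume.restrict (uIoc a b)) := fun f hf ↦
    (hf.aestronglyMeasurable measurableSet_Icc).mono_measure
      (Measure.restrict_mono hsub le_rfl)
  refine (intervalIntegral.hasDerivAt_integral_of_dominated_loc_of_deriv_le
    (F := fun ε t ↦ h (ε, t))
    (F' := fun ε t ↦ fderivWithin ℝ h (strip δ a b) (ε, t) (1, 0)) (bound := fun _ ↦ C)
    (s := Ioo (-δ) δ) (Ioo_mem_nhds (by linarith) hδ) ?_ ?_ ?_ ?_ ?_ ?_).2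
  · filter_upwards [Ioo_mem_nhds (show -δ < 0 by linarith) hδ] with ε hε
    exact hmeas _ (continuousOn_slice hh.continuousOn (Ioo_subset_Icc_self hε))
  · refine ContinuousOn.intervalIntegrable ?_
    rw [uIcc_of_le hab.le]
    exact continuousOn_slice hh.continuousOn (zero_mem_Icc hδ)
  · exact hmeas _ (continuousOn_slice hd (zero_mem_Icc hδ))
  · exact .of_forall fun t ht ε hε ↦ hC (ε, t) ⟨Ioo_subset_Icc_self hε, hsub ht⟩
  · exact intervalIntegrable_const
  · exact .of_forall fun t ht ε hε ↦ (hasDerivWithinAt_fst hh (Ioo_subset_Icc_self hε)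
      (hsub ht)).hasDerivAt (Icc_mem_nhds hε.1 hε.2)

lemma integral_fderivWithin_snd (hδ : 0 < δ) (hab : a < b) :
    ∫ t in a..b, fderivWithin ℝ h (strip δ a b) (0, t) (0, 1) = h (0, b) - h (0, a) := by
  refine intervalIntegral.integral_eq_sub_of_hasDerivAt_of_le (f := fun t ↦ h (0, t)) hab.le
    (continuousOn_slice hh.continuousOn (zero_mem_Icc hδ)) (fun t ht ↦ ?_) ?_
  · exact (hasDerivWithinAt_snd hh (zero_mem_Icc hδ) (Ioo_subset_Icc_self ht)).hasDerivAt
      (Icc_mem_nhds ht.1 ht.2)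
  · refine ContinuousOn.intervalIntegrable ?_
    rw [uIcc_of_le hab.le]
    exact continuousOn_slice (contDiffOn_fderivWithin_apply hh hδ hab (0, 1)).continuousOn
      (zero_mem_Icc hδ)

end Functions

variable (g : Metric3 M)

lemma pcov_congr {P : Type*} [NormedAddCommGroup P] [NormedSpace ℝ P] {X : P → M} {S : Set P}
    {V V' : ∀ z, TangentSpace (𝓡 3) (X z)} (h : ∀ z ∈ S, V z = V' z) {z : P} (hz : z ∈ S) (d : P) :
    pcov g X S d V z = pcov g X S d V' z := by
  rw [pcov, pcov]
  congr 1
  refine covAlong_congr .rfl ?_ hz d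
  filter_upwards [self_mem_nhdsWithin] with w hw
  rw [h w hw]

variable {X : ℝ → ℝ → M} (hδ : 0 < δ) (hab : a < b)
  (hX : ContMDiffOn 𝓘(ℝ, ℝ × ℝ) (𝓡 3) ∞ (fun z : ℝ × ℝ ↦ X z.1 z.2) (strip δ a b))
include hab hX

omit [IsManifold (𝓡 3) ∞ M] in
lemma velocity_eq_strip {ε t : ℝ} (hε : ε ∈ Icc (-δ) δ) (ht : t ∈ Icc a b) :
    velocity a b (X ε) t = pvel (fun z : ℝ × ℝ ↦ X z.1 z.2) (strip δ a b) (0, 1) (ε, t) := by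
  have := pvel_comp (X := fun z : ℝ × ℝ ↦ X z.1 z.2) (S := strip δ a b)
    (hasFDerivWithinAt_inr ε t (Icc a b)) (uniqueDiffOn_Icc hab t ht) (mapsTo_inr hε)
    (hX (ε, t) ⟨hε, ht⟩) 1
  rw [ContinuousLinearMap.inr_apply] at this
  exact this

omit [IsManifold (𝓡 3) ∞ M] in
lemma smooth_slice {ε : ℝ} (hε : ε ∈ Icc (-δ) δ) : ContMDiffOn 𝓘(ℝ, ℝ) (𝓡 3) ∞ (X ε) (Icc a b) :=
  have h : ContMDiffOn 𝓘(ℝ, ℝ) 𝓘(ℝ, ℝ × ℝ) ∞ (fun s : ℝ ↦ (ε, s)) (Icc a b) :=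
    ContDiffOn.contMDiffOn (by fun_prop)
  hX.comp h (mapsTo_inr hε)

include hδ

lemma covDeriv_eq_strip {V : ∀ z : ℝ × ℝ, TangentSpace (𝓡 3) (X z.1 z.2)}
    (hV : SmoothField (fun z : ℝ × ℝ ↦ X z.1 z.2) V (strip δ a b)) {ε t : ℝ}
    {V' : ∀ t, TangentSpace (𝓡 3) (X ε t)} (hVV' : ∀ t ∈ Icc a b, V' t = V (ε, t))
    (hε : ε ∈ Icc (-δ) δ) (ht : t ∈ Icc a b) :
    covDeriv g a b (X ε) V' t =
      pcov g (fun z : ℝ × ℝ ↦ X z.1 z.2) (strip δ a b) (0, 1) V (ε, t) := by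
  have h1 : SmoothField (X ε) (fun t ↦ V (ε, t)) (Icc a b) :=
    hV.comp (by fun_prop : ContDiffOn ℝ ∞ (fun s : ℝ ↦ (ε, s)) (Icc a b)) (mapsTo_inr hε)
  have h2 : SmoothField (X ε) V' (Icc a b) := by
    refine ContMDiffOn.congr h1 fun t ht ↦ ?_
    rw [hVV' t ht]
  rw [covDeriv_eq_pcov g hab ht (h2 t ht), pcov_congr g hVV' ht]
  have := pcov_comp (X := fun z : ℝ × ℝ ↦ X z.1 z.2) (S := strip δ a b)
    (hasFDerivWithinAt_inr ε t (Icc a b)) (uniqueDiffOn_Icc hab t ht) (mapsTo_inr hε) ht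
    (uniqueDiffOn_strip hδ hab (ε, t) ⟨hε, ht⟩) g (hV (ε, t) ⟨hε, ht⟩) 1
  simpa using this

lemma accel_eq_strip {ε t : ℝ} (hε : ε ∈ Icc (-δ) δ) (ht : t ∈ Icc a b) :
    accel g a b (X ε) t = pcov g (fun z : ℝ × ℝ ↦ X z.1 z.2) (strip δ a b) (0, 1)
      (pvel (fun z : ℝ × ℝ ↦ X z.1 z.2) (strip δ a b) (0, 1)) (ε, t) :=
  covDeriv_eq_strip g hδ hab hX (smoothField_pvel (uniqueDiffOn_strip hδ hab) hX _)
    (fun _ ht ↦ velocity_eq_strip hab hX hε ht) hε ht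

lemma jerk_eq_strip {ε t : ℝ} (hε : ε ∈ Icc (-δ) δ) (ht : t ∈ Icc a b) :
    jerk g a b (X ε) t = pcov g (fun z : ℝ × ℝ ↦ X z.1 z.2) (strip δ a b) (0, 1)
      (pcov g (fun z : ℝ × ℝ ↦ X z.1 z.2) (strip δ a b) (0, 1)
        (pvel (fun z : ℝ × ℝ ↦ X z.1 z.2) (strip δ a b) (0, 1))) (ε, t) :=
  covDeriv_eq_strip g hδ hab hX (smoothField_pcov g (uniqueDiffOn_strip hδ hab)
    (smoothField_pvel (uniqueDiffOn_strip hδ hab) hX _) _)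
    (fun _ ht ↦ accel_eq_strip g hδ hab hX hε ht) hε ht

end Strip

/-- The vector whose wedge product with the velocity vanishes along conformal geodesics. -/
def geodesicDefect (g : Metric3 M) (a b : ℝ) (γ : ℝ → M) (t : ℝ) : TangentSpace (𝓡 3) (γ t) :=
  jerk g a b γ t
    - (3 * g.inner (γ t) (velocity a b γ t) (accel g a b γ t)
        / (len g (velocity a b γ t)) ^ 2) • accel g a b γ t
    - (len g (velocity a b γ t)) ^ 2 • schoutenOp g (γ t) (velocity a b γ t)

/-! ### The first variation of the integrated connection form -/

section FirstVariation

variable {δ a b : ℝ} {X : ℝ → ℝ → M} {g : Metric3 M}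

lemma toCoord_congr {p q : M} {u : TangentSpace (𝓡 3) p} {v : TangentSpace (𝓡 3) q}
    (h : (⟨p, u⟩ : TangentBundle (𝓡 3) M) = ⟨q, v⟩) (c : M) : toCoord c p u = toCoord c q v :=
  congrArg (fun w : TangentBundle (𝓡 3) M ↦ toCoord c w.1 w.2) h

omit [IsManifold (𝓡 3) ∞ M] in
lemma base_congr {p q : M} {u : TangentSpace (𝓡 3) p} {v : TangentSpace (𝓡 3) q}
    (h : (⟨p, u⟩ : TangentBundle (𝓡 3) M) = ⟨q, v⟩) : p = q :=
  congrArg (fun w : TangentBundle (𝓡 3) M ↦ w.1) h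

lemma inner_congr (g : Metric3 M) {p q : M} {u u' : TangentSpace (𝓡 3) p}
    {v v' : TangentSpace (𝓡 3) q}
    (h : (⟨p, u⟩ : TangentBundle (𝓡 3) M) = ⟨q, v⟩)
    (h' : (⟨p, u'⟩ : TangentBundle (𝓡 3) M) = ⟨q, v'⟩) : g.inner p u u' = g.inner q v v' := by
  obtain rfl := base_congr h
  have h1 : u = v := by simpa using h
  have h2 : u' = v' := by simpa using h'
  rw [h1, h2]

lemma pvel_fst_eq_zero (hδ : 0 < δ)
    (hX : ContMDiffOn 𝓘(ℝ, ℝ × ℝ) (𝓡 3) ∞ (fun z : ℝ × ℝ ↦ X z.1 z.2) (strip δ a b)) {t : ℝ}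
    (ht : t ∈ Icc a b) (h : ∀ ε ∈ Icc (-δ) δ, X ε t = X 0 t) :
    pvel (fun z : ℝ × ℝ ↦ X z.1 z.2) (strip δ a b) (1, 0) (0, t) = 0 := by
  have hu : UniqueDiffOn ℝ (Icc (-δ) δ) := uniqueDiffOn_Icc (by linarith)
  have h1 := pvel_comp (X := fun z : ℝ × ℝ ↦ X z.1 z.2) (S := strip δ a b)
    (hasFDerivWithinAt_inl 0 t (Icc (-δ) δ)) (hu 0 (zero_mem_Icc hδ)) (mapsTo_inl ht)
    (hX (0, t) ⟨zero_mem_Icc hδ, ht⟩) 1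
  have h2 : toCoord (X 0 t) (X 0 t) (pvel (fun s ↦ X s t) (Icc (-δ) δ) 1 0) = 0 := by
    have hX' : ContMDiffWithinAt 𝓘(ℝ, ℝ) (𝓡 3) ∞ (fun s ↦ X s t) (Icc (-δ) δ) 0 := by
      refine (contMDiffWithinAt_const (c := X 0 t)).congr (fun s hs ↦ h s hs) rfl
    rw [toCoord_pvel (X := fun s ↦ X s t) hX' (hu 0 (zero_mem_Icc hδ)) (mem_source_self (X 0 t))]
    have h3 : fderivWithin ℝ (fun w ↦ extChartAt (𝓡 3) (X 0 t) (X w t)) (Icc (-δ) δ) 0 =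
        fderivWithin ℝ (fun _ ↦ extChartAt (𝓡 3) (X 0 t) (X 0 t)) (Icc (-δ) δ) 0 :=
      fderivWithin_congr (fun s hs ↦ by simp only [h s hs]) rfl
    rw [h3]
    simp
  have h3 : pvel (fun s ↦ X s t) (Icc (-δ) δ) 1 0 = 0 :=
    toCoord_injective (mem_source_self (X 0 t)) (by rw [h2, map_zero])
  simpa [h3] using h1.symm

/-- In a fixed chart the field and its base point do not move with ε. This kills the boundary term
of the first variation. -/
lemma pcov_fst_eq_zero (hδ : 0 < δ) (hab : a < b)
    {V : ∀ z : ℝ × ℝ, TangentSpace (𝓡 3) (X z.1 z.2)}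
    (hV : SmoothField (fun z : ℝ × ℝ ↦ X z.1 z.2) V (strip δ a b)) {t : ℝ}
    (ht : t ∈ Icc a b)
    (h : ∀ ε ∈ Icc (-δ) δ, (⟨X ε t, V (ε, t)⟩ : TangentBundle (𝓡 3) M) = ⟨X 0 t, V (0, t)⟩) :
    pcov g (fun z : ℝ × ℝ ↦ X z.1 z.2) (strip δ a b) (1, 0) V (0, t) = 0 := by
  have hu : UniqueDiffOn ℝ (Icc (-δ) δ) := uniqueDiffOn_Icc (by linarith)
  have h1 := pcov_comp (X := fun z : ℝ × ℝ ↦ X z.1 z.2) (S := strip δ a b)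
    (hasFDerivWithinAt_inl 0 t (Icc (-δ) δ)) (hu 0 (zero_mem_Icc hδ)) (mapsTo_inl ht)
    (zero_mem_Icc hδ) (uniqueDiffOn_strip hδ hab (0, t) ⟨zero_mem_Icc hδ, ht⟩) g
    (hV (0, t) ⟨zero_mem_Icc hδ, ht⟩) 1
  have h2 : pcov g (fun s ↦ X s t) (Icc (-δ) δ) 1 (fun s ↦ V (s, t)) 0 = 0 := by
    have e1 : fderivWithin ℝ (fun w ↦ toCoord (X 0 t) (X w t) (V (w, t))) (Icc (-δ) δ) 0 = 0 := by
      rw [fderivWithin_congr (f := fun _ ↦ toCoord (X 0 t) (X 0 t) (V (0, t)))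
        (fun s hs ↦ toCoord_congr (h s hs) _) rfl]
      simp
    have e2 : fderivWithin ℝ (fun w ↦ extChartAt (𝓡 3) (X 0 t) (X w t)) (Icc (-δ) δ) 0 = 0 := by
      have h3 : fderivWithin ℝ (fun w ↦ extChartAt (𝓡 3) (X 0 t) (X w t)) (Icc (-δ) δ) 0 =
          fderivWithin ℝ (fun _ ↦ extChartAt (𝓡 3) (X 0 t) (X 0 t)) (Icc (-δ) δ) 0 :=
        fderivWithin_congr (fun s hs ↦ by simp only [base_congr (h s hs)]) rfl
      rw [h3]
      simp
    rw [pcov, covAlong, e1, e2]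
    simp
  simpa [h2] using h1.symm

/-- The integrated form of `first_variation`. The exact term integrates to its boundary values,
which vanish since the points and frames at the ends are fixed. -/
lemma hasDerivAt_integral_frameConn (hδ : 0 < δ) (hab : a < b)
    {E : ∀ z : ℝ × ℝ, Fin 3 → TangentSpace (𝓡 3) (X z.1 z.2)}
    (hE : IsAdaptedFrame g (fun z : ℝ × ℝ ↦ X z.1 z.2) (strip δ a b) (0, 1) E)
    (ha : ∀ ε ∈ Icc (-δ) δ, ∀ i,
      (⟨X ε a, E (ε, a) i⟩ : TangentBundle (𝓡 3) M) = ⟨X 0 a, E (0, a) i⟩)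
    (hb : ∀ ε ∈ Icc (-δ) δ, ∀ i,
      (⟨X ε b, E (ε, b) i⟩ : TangentBundle (𝓡 3) M) = ⟨X 0 b, E (0, b) i⟩) :
    HasDerivAt (fun ε ↦ ∫ t in a..b, frameConn g (fun z : ℝ × ℝ ↦ X z.1 z.2) (strip δ a b) (0, 1)
        E 0 1 (ε, t))
      (∫ t in a..b, ((len g (velocity a b (X 0) t)) ^ 2)⁻¹ *
        (frameComp g _ (pvel (fun z : ℝ × ℝ ↦ X z.1 z.2) (strip δ a b) (1, 0)) E 0 (0, t) *
          g.inner (X 0 t) (geodesicDefect g a b (X 0) t) (E (0, t) 1)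
        - frameComp g _ (pvel (fun z : ℝ × ℝ ↦ X z.1 z.2) (strip δ a b) (1, 0)) E 1 (0, t) *
          g.inner (X 0 t) (geodesicDefect g a b (X 0) t) (E (0, t) 0))) 0 := by
  have hS := uniqueDiffOn_strip hδ hab
  have hX := hE.base
  have hz := zero_mem_Icc hδ
  have haI : a ∈ Icc a b := left_mem_Icc.2 hab.le
  have hbI : b ∈ Icc a b := right_mem_Icc.2 hab.le
  have hc := contDiffOn_frameConn g hS hE.smooth (0, 1) 0 1
  have hW := smoothField_pvel hS hX (1, 0)
  set B : ℝ × ℝ → ℝ := fun w ↦ frameConn g (fun z : ℝ × ℝ ↦ X z.1 z.2) (strip δ a b) (1, 0) E 0 1 w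
    + (len g (pvel (fun z : ℝ × ℝ ↦ X z.1 z.2) (strip δ a b) (0, 1) w))⁻¹ *
      (frameConn g _ (strip δ a b) (0, 1) E 1 2 w * frameComp g _ (pvel _ (strip δ a b) (1, 0)) E 0 w
      - frameConn g _ (strip δ a b) (0, 1) E 0 2 w * frameComp g _ (pvel _ (strip δ a b) (1, 0)) E 1 w)
    with hB
  have hBs : ContDiffOn ℝ ∞ B (strip δ a b) :=
    (contDiffOn_frameConn g hS hE.smooth (1, 0) 0 1).add
      (((hE.contDiffOn_speed hS).inv fun z hz ↦ (len_pos g (hE.pvel_ne z hz)).ne').mul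
        (((contDiffOn_frameConn g hS hE.smooth (0, 1) 1 2).mul
          (contDiffOn_frameComp g hE.smooth hW 0)).sub
        ((contDiffOn_frameConn g hS hE.smooth (0, 1) 0 2).mul
          (contDiffOn_frameComp g hE.smooth hW 1))))
  -- At the ends both W and ∇_ε E₀ vanish.
  have hBa : B (0, a) = 0 := by
    have h1 := pvel_fst_eq_zero hδ hX haI fun ε hε ↦ base_congr (ha ε hε 0)
    have h2 := pcov_fst_eq_zero (g := g) hδ hab (hE.smooth 0) haI fun ε hε ↦ ha ε hε 0
    simp [hB, frameComp, frameConn, h1, h2]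
  have hBb : B (0, b) = 0 := by
    have h1 := pvel_fst_eq_zero hδ hX hbI fun ε hε ↦ base_congr (hb ε hε 0)
    have h2 := pcov_fst_eq_zero (g := g) hδ hab (hE.smooth 0) hbI fun ε hε ↦ hb ε hε 0
    simp [hB, frameComp, frameConn, h1, h2]
  have h1 := hasDerivAt_integral_strip hc hδ hab
  have h2 := integral_fderivWithin_snd hBs hδ hab
  rw [hBa, hBb, sub_zero] at h2
  have hint : ∀ f : ℝ × ℝ → ℝ, ContDiffOn ℝ ∞ f (strip δ a b) → ∀ d, IntervalIntegrable
      (fun t ↦ fderivWithin ℝ f (strip δ a b) (0, t) d) volume a b := by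
    intro f hf d
    refine ContinuousOn.intervalIntegrable ?_
    rw [uIcc_of_le hab.le]
    exact continuousOn_slice (contDiffOn_fderivWithin_apply hf hδ hab d).continuousOn hz
  -- Subtracting the integral of ∂_t B, which is zero, leaves an integrand that can be compared
  -- pointwise.
  have h3 := intervalIntegral.integral_sub (hint _ hc (1, 0)) (hint _ hBs (0, 1))
  rw [h2, sub_zero] at h3
  rw [← h3] at h1
  convert h1 using 1
  refine intervalIntegral.integral_congr_ae ?_
  -- The infinitesimal formula holds at interior points only. The half-open interval already
  -- excludes a, and b is a null set.
  have hne : ∀ᵐ t ∂(volume : Measure ℝ), t ≠ b := by simp [ae_iff]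
  filter_upwards [hne] with t htb ht
  rw [uIoc_of_le hab.le] at ht
  have htI : t ∈ Ioo a b := ⟨ht.1, lt_of_le_of_ne ht.2 htb⟩
  have htI' := Ioo_subset_Icc_self htI
  have key := hE.first_variation hS (strip_mem_nhds (δ := δ) ⟨by linarith, hδ⟩ htI) (1, 0)
    (geodesicDefect g a b (X 0) t) (by
      rw [geodesicDefect, jerk_eq_strip g hδ hab hX hz htI', accel_eq_strip g hδ hab hX hz htI',
        velocity_eq_strip hab hX hz htI'])
  rw [key, velocity_eq_strip hab hX hz htI']
  simp [hB]

end FirstVariation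

/-! ### Smooth approximation of continuous frames -/

section Continuity

variable (g : Metric3 M) {P : Type*} [TopologicalSpace P] {X : P → M} {S : Set P} {z : P}

lemma continuousWithinAt_toCoord {V : ∀ z, TangentSpace (𝓡 3) (X z)} (hz : z ∈ S)
    (hV : ContinuousWithinAt (fun w ↦ (⟨X w, V w⟩ : TangentBundle (𝓡 3) M)) S z) :
    ContinuousWithinAt X S z ∧
      ContinuousWithinAt (fun w ↦ toCoord (X z) (X w) (V w)) S z := by
  obtain ⟨h1, h2⟩ := (FiberBundle.continuousWithinAt_totalSpace E3
    (fun w ↦ (⟨X w, V w⟩ : TangentBundle (𝓡 3) M))).1 hV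
  have h1' : ContinuousWithinAt X S z := h1
  refine ⟨h1', ?_⟩
  have he : ∀ᶠ w in 𝓝[S] z, X w ∈ (extChartAt (𝓡 3) (X z)).source :=
    h1'.eventually_mem ((isOpen_extChartAt_source (X z)).mem_nhds (mem_source_self (X z)))
  have he' : (fun w ↦ toCoord (X z) (X w) (V w)) =ᶠ[𝓝[S] z] fun w ↦
      (trivializationAt E3 (TangentSpace (𝓡 3)) (X z) (⟨X w, V w⟩ : TangentBundle (𝓡 3) M)).2 := by
    filter_upwards [he] with w hw using (toCoord_eq_trivializationAt hw (V w)).symm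
  exact h2.congr_of_eventuallyEq he' (he'.self_of_nhdsWithin hz)

lemma continuousWithinAt_chartMetric (hX : ContinuousWithinAt X S z) :
    ContinuousWithinAt (fun w ↦ chartMetric g (X z) (extChartAt (𝓡 3) (X z) (X w))) S z := by
  have h1 := ((contDiffOn_chartMetric g (X z)).continuousOn.continuousAt
    ((isOpen_extChartAt_target (X z)).mem_nhds (mem_extChartAt_target (X z))))
  have h2 : ContinuousWithinAt (fun w ↦ extChartAt (𝓡 3) (X z) (X w)) S z :=
    (continuousAt_extChartAt (X z)).comp_continuousWithinAt hX
  exact ContinuousAt.comp_continuousWithinAt (g := chartMetric g (X z)) h1 h2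

lemma continuousWithinAt_inner {V W : ∀ z, TangentSpace (𝓡 3) (X z)} (hz : z ∈ S)
    (hV : ContinuousWithinAt (fun w ↦ (⟨X w, V w⟩ : TangentBundle (𝓡 3) M)) S z)
    (hW : ContinuousWithinAt (fun w ↦ (⟨X w, W w⟩ : TangentBundle (𝓡 3) M)) S z) :
    ContinuousWithinAt (fun w ↦ g.inner (X w) (V w) (W w)) S z := by
  obtain ⟨hX, hV⟩ := continuousWithinAt_toCoord hz hV
  obtain ⟨-, hW⟩ := continuousWithinAt_toCoord hz hW
  have hs := mem_source_self (X z)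
  have he : ∀ᶠ w in 𝓝[S] z, X w ∈ (extChartAt (𝓡 3) (X z)).source :=
    hX.eventually_mem ((isOpen_extChartAt_source (X z)).mem_nhds hs)
  have he' : (fun w ↦ g.inner (X w) (V w) (W w)) =ᶠ[𝓝[S] z] fun w ↦ chartMetric g (X z)
      (extChartAt (𝓡 3) (X z) (X w)) (toCoord (X z) (X w) (V w)) (toCoord (X z) (X w) (W w)) := by
    filter_upwards [he] with w hw
    exact inner_eq_chartMetric g hw _ _
  exact (((continuousWithinAt_chartMetric g hX).clm_apply hV).clm_apply hW).congr_of_eventuallyEq he' (he'.self_of_nhdsWithin hz)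

end Continuity

/-! ### Sums, normalization and localization of smooth fields -/

section FieldSum

variable {P : Type*} [NormedAddCommGroup P] [NormedSpace ℝ P] {X : P → M} {S : Set P}

lemma smoothField_zero (hX : ContMDiffOn 𝓘(ℝ, P) (𝓡 3) ∞ X S) :
    SmoothField X (fun _ ↦ 0) S := by
  intro z hz
  refine (smoothFieldAt_iff (hX z hz) hz (mem_source_self (X z))).2 ?_
  simp only [map_zero]
  exact contDiffWithinAt_const

lemma SmoothField.sum {ι : Type*} (s : Finset ι) (hX : ContMDiffOn 𝓘(ℝ, P) (𝓡 3) ∞ X S)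
    {V : ι → ∀ z, TangentSpace (𝓡 3) (X z)} (hV : ∀ i, SmoothField X (V i) S) :
    SmoothField X (fun z ↦ ∑ i ∈ s, V i z) S := by
  classical
  induction s using Finset.induction_on with
  | empty => simpa using smoothField_zero hX
  | insert i s hi ih =>
    simp only [Finset.sum_insert hi]
    exact (hV i).add ih

lemma SmoothField.normalize (g : Metric3 M) {V : ∀ z, TangentSpace (𝓡 3) (X z)}
    (hV : SmoothField X V S) (h : ∀ z ∈ S, V z ≠ 0) :
    SmoothField X (fun z ↦ (len g (V z))⁻¹ • V z) S := by
  refine SmoothField.smul ?_ hV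
  have h1 : ContDiffOn ℝ ∞ (fun z ↦ len g (V z)) S :=
    (hV.inner g hV).sqrt fun z hz ↦ (inner_self_pos g (h z hz)).ne'
  exact h1.inv fun z hz ↦ (len_pos g (h z hz)).ne'

/-- A bump function times a field with constant components in a chart. -/
lemma smoothField_smul_fromCoord {X : P → M} {c : M} {v : E3} {ρ : P → ℝ} (hρ : ContDiff ℝ ∞ ρ)
    (hX : ContMDiffOn 𝓘(ℝ, P) (𝓡 3) ∞ X S)
    (h : ∀ z ∈ S, z ∈ tsupport ρ → X z ∈ (extChartAt (𝓡 3) c).source) :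
    SmoothField X (fun z ↦ ρ z • fromCoord c (X z) v) S := by
  intro z hz
  by_cases hzρ : z ∈ tsupport ρ
  · have hc := h z hz hzρ
    refine (smoothFieldAt_iff (hX z hz) hz hc).2 ?_
    refine (hρ.contDiffAt.contDiffWithinAt.smul (contDiffWithinAt_const (c := v))).congr_of_eventuallyEq_of_mem ?_ hz
    filter_upwards [eventually_mem_source (hX z hz).continuousWithinAt hc] with w hw
    rw [map_smul, toCoord_fromCoord hw]
    rfl
  · refine (smoothFieldAt_iff (hX z hz) hz (mem_source_self (X z))).2 ?_
    refine (contDiffWithinAt_const (c := (0 : E3))).congr_of_eventuallyEq_of_mem ?_ hz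
    filter_upwards [nhdsWithin_le_nhds (notMem_tsupport_iff_eventuallyEq.1 hzρ)] with w hw
    rw [hw]
    simp

end FieldSum

/-! ### Conditions on the initial curve that persist on a thin strip -/

section Tube

variable {δ a b : ℝ}

lemma strip_mono {δ' : ℝ} (h : δ' ≤ δ) : strip δ' a b ⊆ strip δ a b :=
  prod_mono (Icc_subset_Icc (by linarith) h) Subset.rfl

/-- The tube lemma: compactness of [a, b] gives a uniform width. It lets open conditions on the
initial curve be extended to nearby curves. -/
lemma exists_strip_of_eventually (hδ : 0 < δ) {p : ℝ × ℝ → Prop}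
    (h : ∀ t ∈ Icc a b, ∀ᶠ z in 𝓝[strip δ a b] (0, t), p z) :
    ∃ δ', 0 < δ' ∧ δ' ≤ δ ∧ ∀ z ∈ strip δ' a b, p z := by
  have h1 := IsCompact.eventually_forall_of_forall_eventually (x₀ := (0 : ℝ)) (K := Icc a b)
    isCompact_Icc (P := fun ε t ↦ (ε, t) ∈ strip δ a b → p (ε, t))
    fun t ht ↦ eventually_nhdsWithin_iff.1 (h t ht)
  obtain ⟨η, hη, hη'⟩ := Metric.eventually_nhds_iff.1 h1
  refine ⟨min (η / 2) δ, by positivity, min_le_right _ _, fun z hz ↦ ?_⟩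
  refine hη' (y := z.1) ?_ z.2 hz.2 (strip_mono (min_le_right _ _) hz)
  rw [Real.dist_eq, sub_zero]
  have := abs_le.2 hz.1
  linarith [min_le_left (η / 2) δ]

lemma exists_strip_ne_zero (hδ : 0 < δ) {f : ℝ × ℝ → ℝ} (hf : ContinuousOn f (strip δ a b))
    (h : ∀ t ∈ Icc a b, f (0, t) ≠ 0) :
    ∃ δ', 0 < δ' ∧ δ' ≤ δ ∧ ∀ z ∈ strip δ' a b, f z ≠ 0 :=
  exists_strip_of_eventually hδ fun t ht ↦
    (hf (0, t) ⟨zero_mem_Icc hδ, ht⟩).eventually_ne (h t ht)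

end Tube

/-! ### Smoothing a continuous frame -/

section Approximation

variable (g : Metric3 M) {δ a b : ℝ} {X : ℝ → ℝ → M}

/-- Smooth vector fields near a curve which approximate a continuous orthonormal frame. -/
lemma exists_smooth_fields (hδ : 0 < δ)
    (hX : ContMDiffOn 𝓘(ℝ, ℝ × ℝ) (𝓡 3) ∞ (fun z : ℝ × ℝ ↦ X z.1 z.2) (strip δ a b))
    {F : ∀ t, Fin 3 → TangentSpace (𝓡 3) (X 0 t)} (hF : IsFrameAlong g a b (X 0) F) :
    ∃ (f : ℝ → ∀ p : M, Fin 3 → TangentSpace (𝓡 3) p) (δ' : ℝ), 0 < δ' ∧ δ' ≤ δ ∧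
      (∀ i, SmoothField (fun z : ℝ × ℝ ↦ X z.1 z.2) (fun z ↦ f z.2 (X z.1 z.2) i)
        (strip δ' a b)) ∧
      ∀ t ∈ Icc a b, ∀ i j,
        |g.inner (X 0 t) (f t (X 0 t) i) (F t j) - if i = j then 1 else 0| ≤ 1 / 8 := by
  have hz := zero_mem_Icc hδ
  have hx : ContinuousOn (X 0) (Icc a b) := by
    have : ContinuousOn (fun t : ℝ ↦ ((0, t) : ℝ × ℝ)) (Icc a b) := by fun_prop
    exact hX.continuousOn.comp this (mapsTo_inr hz)
  -- The local model near time s: the frame vectors at s, extended with constant components in the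
  -- chart around X 0 s.
  set v : ℝ → Fin 3 → E3 := fun s i ↦ toCoord (X 0 s) (X 0 s) (F s i) with hv
  have key : ∀ s ∈ Icc a b, ∀ᶠ t in 𝓝[Icc a b] s, X 0 t ∈ (extChartAt (𝓡 3) (X 0 s)).source ∧
      ∀ i j, |g.inner (X 0 t) (fromCoord (X 0 s) (X 0 t) (v s i)) (F t j)
        - if i = j then 1 else 0| ≤ 1 / 8 := by
    intro s hs
    have h0 : ∀ᶠ t in 𝓝[Icc a b] s, X 0 t ∈ (extChartAt (𝓡 3) (X 0 s)).source :=
      (hx s hs).eventually_mem ((isOpen_extChartAt_source (X 0 s)).mem_nhds (mem_source_self _))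
    refine h0.and ?_
    simp only [eventually_all]
    intro i j
    have hF' := hF.continuous j s hs
    obtain ⟨-, hFc⟩ := continuousWithinAt_toCoord (X := X 0) (V := fun t ↦ F t j) hs hF'
    have hG : ContinuousWithinAt (fun t ↦ chartMetric g (X 0 s) (extChartAt (𝓡 3) (X 0 s) (X 0 t))
        (v s i) (toCoord (X 0 s) (X 0 t) (F t j))) (Icc a b) s :=
      ((continuousWithinAt_chartMetric g (hx s hs)).clm_apply
        continuousWithinAt_const).clm_apply hFc
    have hval : chartMetric g (X 0 s) (extChartAt (𝓡 3) (X 0 s) (X 0 s))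
        (v s i) (toCoord (X 0 s) (X 0 s) (F s j)) = if i = j then 1 else 0 := by
      rw [← hF.orthonormal s hs i j, inner_eq_chartMetric g (mem_source_self (X 0 s))]
    have h3 := Metric.tendsto_nhds.1 hG (1 / 8) (by norm_num)
    beta_reduce at h3
    rw [hval] at h3
    filter_upwards [h3, h0] with t ht ht0
    rw [inner_eq_chartMetric g ht0, toCoord_fromCoord ht0]
    exact ht.le
  have key' : ∀ s ∈ Icc a b, ∃ U : Set ℝ, IsOpen U ∧ s ∈ U ∧ ∀ t ∈ U, t ∈ Icc a b →
      X 0 t ∈ (extChartAt (𝓡 3) (X 0 s)).source ∧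
      ∀ i j, |g.inner (X 0 t) (fromCoord (X 0 s) (X 0 t) (v s i)) (F t j)
        - if i = j then 1 else 0| ≤ 1 / 8 := by
    intro s hs
    obtain ⟨U, hU, hUo, hsU⟩ := eventually_nhds_iff.1 (eventually_nhdsWithin_iff.1 (key s hs))
    exact ⟨U, hUo, hsU, hU⟩
  choose! U hUo hsU hU using key'
  obtain ⟨I, hI, hIU⟩ := isCompact_Icc.elim_nhds_subcover U
    fun s hs ↦ (hUo s hs).mem_nhds (hsU s hs)
  obtain ⟨ρ, hρ⟩ := SmoothPartitionOfUnity.exists_isSubordinate 𝓘(ℝ, ℝ) (isClosed_Icc (a := a) (b := b))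
    (fun k : I ↦ U k) (fun k ↦ hUo k (hI k k.2)) (by
      intro t ht
      obtain ⟨s, hs, hts⟩ := mem_iUnion₂.1 (hIU ht)
      exact mem_iUnion.2 ⟨⟨s, hs⟩, hts⟩)
  -- The local models must make sense off the initial curve: wherever the partition function does
  -- not vanish, the nearby curves have to stay in the corresponding chart.
  have htube : ∀ t ∈ Icc a b, ∀ᶠ z : ℝ × ℝ in 𝓝[strip δ a b] (0, t),
      ∀ k : I, z.2 ∈ tsupport (ρ k) → X z.1 z.2 ∈ (extChartAt (𝓡 3) (X 0 k)).source := by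
    intro t ht
    rw [eventually_all]
    intro k
    by_cases htk : t ∈ tsupport (ρ k)
    · have h1 := (hU k (hI k k.2) t (hρ k htk) ht).1
      have h2 := eventually_mem_source (X := fun z : ℝ × ℝ ↦ X z.1 z.2)
        (hX (0, t) ⟨hz, ht⟩).continuousWithinAt h1
      filter_upwards [h2] with z hz _ using hz
    · have h1 : ∀ᶠ z : ℝ × ℝ in 𝓝 (0, t), z.2 ∉ tsupport (ρ k) :=
        (continuous_snd.continuousAt (x := ((0 : ℝ), t))).eventually_mem
          ((isClosed_tsupport (ρ k)).isOpen_compl.mem_nhds htk)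
      filter_upwards [nhdsWithin_le_nhds h1] with z hz hz' using absurd hz' hz
  obtain ⟨δ', hδ', hδδ', hd⟩ := exists_strip_of_eventually hδ htube
  -- The field depends on the time and on the point, but not on ε. This is what will make the
  -- adapted frame constant at fixed ends.
  refine ⟨fun t p i ↦ ∑ k : I, ρ k t • fromCoord (X 0 k) p (v k i), δ', hδ', hδδ', ?_, ?_⟩
  · intro i
    have hX' := hX.mono (strip_mono hδδ')
    refine SmoothField.sum Finset.univ hX' fun k ↦ ?_
    have hρk : ContDiff ℝ ∞ (fun z : ℝ × ℝ ↦ ρ k z.2) :=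
      (contMDiff_iff_contDiff.1 (ρ k).contMDiff).comp contDiff_snd
    refine smoothField_smul_fromCoord hρk hX' fun z hz hzs ↦ hd z hz k ?_
    exact tsupport_comp_subset_preimage (ρ k) continuous_snd hzs
  · intro t ht i j
    have h1 : ∑ k : I, ρ k t = 1 := by
      rw [← finsum_eq_sum_of_fintype]; exact ρ.sum_eq_one ht
    have h2 : g.inner (X 0 t) (∑ k : I, ρ k t • fromCoord (X 0 k) (X 0 t) (v k i)) (F t j)
        - (if i = j then 1 else 0) = ∑ k : I, ρ k t *
          (g.inner (X 0 t) (fromCoord (X 0 k) (X 0 t) (v k i)) (F t j)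
            - if i = j then 1 else 0) := by
      simp only [mul_sub, Finset.sum_sub_distrib, ← Finset.sum_mul, h1, one_mul]
      simp [map_sum]
    rw [h2]
    calc _ ≤ ∑ k : I, |ρ k t * (g.inner (X 0 t) (fromCoord (X 0 k) (X 0 t) (v k i)) (F t j)
            - if i = j then 1 else 0)| := Finset.abs_sum_le_sum_abs _ _
      _ ≤ ∑ k : I, ρ k t * (1 / 8) := by
        refine Finset.sum_le_sum fun k _ ↦ ?_
        rw [abs_mul, abs_of_nonneg (ρ.nonneg k t)]
        by_cases hk : ρ k t = 0
        · simp [hk]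
        · refine mul_le_mul_of_nonneg_left ?_ (ρ.nonneg k t)
          exact (hU k (hI k k.2) t (hρ k (subset_tsupport _ hk)) ht).2 i j
      _ = 1 / 8 := by rw [← Finset.sum_mul, h1, one_mul]

/-- Diagonal dominance: a relation with coefficients c gives |cⱼ| ≤ (1/8) ∑ |cᵢ| for each j, and
summing over the three indices forces ∑ |cᵢ| ≤ (3/8) ∑ |cᵢ|, hence c = 0. The approximate frame is
thus a basis. -/
lemma eq_zero_of_sum_smul_eq_zero {p : M} {f F : Fin 3 → TangentSpace (𝓡 3) p}
    (h : ∀ i j, |g.inner p (f i) (F j) - if i = j then 1 else 0| ≤ 1 / 8) {c : Fin 3 → ℝ}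
    (hc : ∑ i, c i • f i = 0) : c = 0 := by
  set e : Fin 3 → Fin 3 → ℝ := fun i j ↦ g.inner p (f i) (F j) - if i = j then 1 else 0 with he
  have h1 : ∀ j, c j = -∑ i, c i * e i j := by
    intro j
    have := congrArg (fun w ↦ g.inner p w (F j)) hc
    simp only [map_sum, FunLike.coe_sum, Finset.sum_apply, map_smul, smul_apply, smul_eq_mul,
      map_zero, zero_apply] at this
    simp [he, mul_sub, Finset.sum_sub_distrib, this]
  have h2 : ∀ i j, |c i * e i j| ≤ |c i| * (1 / 8) := fun i j ↦ by
    rw [abs_mul]; exact mul_le_mul_of_nonneg_left (h i j) (abs_nonneg _)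
  have h3 : ∀ j, |c j| ≤ (|c 0| + |c 1| + |c 2|) * (1 / 8) := by
    intro j
    have h4 := abs_add_three (c 0 * e 0 j) (c 1 * e 1 j) (c 2 * e 2 j)
    have h5 : |c j| = |c 0 * e 0 j + c 1 * e 1 j + c 2 * e 2 j| := by
      conv_lhs => rw [h1 j, abs_neg, Fin.sum_univ_three]
    linarith [h2 0 j, h2 1 j, h2 2 j]
  have h0 := abs_nonneg (c 0)
  have h0' := abs_nonneg (c 1)
  have h0'' := abs_nonneg (c 2)
  have : |c 0| + |c 1| + |c 2| = 0 := by linarith [h3 0, h3 1, h3 2]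
  ext i
  have : |c i| ≤ 0 := by rw [this] at h3; simpa using h3 i
  simpa using this

end Approximation

/-! ### Existence of adapted frames -/

section FrameConstruction

variable (g : Metric3 M)

/-- The vector with components `c` in `f`. -/
def combination {p : M} (f : Fin 3 → TangentSpace (𝓡 3) p) (c : Fin 3 → ℝ) : TangentSpace (𝓡 3) p :=
  ∑ i, c i • f i

/-- The pairings of `τ` with the vectors of `f`. -/
def pairing {p : M} (f : Fin 3 → TangentSpace (𝓡 3) p) (τ : TangentSpace (𝓡 3) p) : Fin 3 → ℝ :=
  fun i ↦ g.inner p τ (f i)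

/-- A vector orthogonal to `τ`, depending on a parameter `n`. -/
def firstNormal {p : M} (f : Fin 3 → TangentSpace (𝓡 3) p) (n : Fin 3 → ℝ)
    (τ : TangentSpace (𝓡 3) p) : TangentSpace (𝓡 3) p :=
  combination f (n ⨯₃ pairing g f τ)

/-- A vector orthogonal to `τ` and to `firstNormal g f n τ`. -/
def secondNormal {p : M} (f : Fin 3 → TangentSpace (𝓡 3) p) (n : Fin 3 → ℝ)
    (τ : TangentSpace (𝓡 3) p) : TangentSpace (𝓡 3) p :=
  g.inner p (firstNormal g f n τ) (firstNormal g f n τ) •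
      combination f (pairing g f τ ⨯₃ (n ⨯₃ pairing g f τ))
    - g.inner p (combination f (pairing g f τ ⨯₃ (n ⨯₃ pairing g f τ))) (firstNormal g f n τ) •
      firstNormal g f n τ

/-- An orthonormal frame with last vector `τ`, obtained from a basis `f`, a generic parameter `n`
and a sign `s`. -/
def completedFrame {p : M} (f : Fin 3 → TangentSpace (𝓡 3) p) (n : Fin 3 → ℝ) (s : ℝ)
    (τ : TangentSpace (𝓡 3) p) : Fin 3 → TangentSpace (𝓡 3) p :=
  ![(len g (firstNormal g f n τ))⁻¹ • firstNormal g f n τ,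
    s • (len g (secondNormal g f n τ))⁻¹ • secondNormal g f n τ, τ]

lemma inner_combination {p : M} (f : Fin 3 → TangentSpace (𝓡 3) p) (c : Fin 3 → ℝ)
    (τ : TangentSpace (𝓡 3) p) : g.inner p (combination f c) τ = c ⬝ᵥ pairing g f τ := by
  simp [combination, pairing, dotProduct, map_sum, g.symm p τ]

lemma inner_firstNormal {p : M} (f : Fin 3 → TangentSpace (𝓡 3) p) (n : Fin 3 → ℝ)
    (τ : TangentSpace (𝓡 3) p) : g.inner p (firstNormal g f n τ) τ = 0 := by
  rw [firstNormal, inner_combination, dotProduct_comm, dot_cross_self]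

lemma inner_secondNormal {p : M} (f : Fin 3 → TangentSpace (𝓡 3) p) (n : Fin 3 → ℝ)
    (τ : TangentSpace (𝓡 3) p) : g.inner p (secondNormal g f n τ) τ = 0 := by
  rw [secondNormal, map_sub, sub_apply, map_smul, smul_apply, map_smul, smul_apply,
    inner_firstNormal, inner_combination, dotProduct_comm, dot_self_cross]
  simp

lemma inner_secondNormal_firstNormal {p : M} (f : Fin 3 → TangentSpace (𝓡 3) p) (n : Fin 3 → ℝ)
    (τ : TangentSpace (𝓡 3) p) :
    g.inner p (secondNormal g f n τ) (firstNormal g f n τ) = 0 := by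
  rw [secondNormal, map_sub, sub_apply, map_smul, smul_apply, map_smul, smul_apply]
  simp only [smul_eq_mul]
  ring

lemma inner_normalize {p : M} {u : TangentSpace (𝓡 3) p} (hu : u ≠ 0) :
    g.inner p ((len g u)⁻¹ • u) ((len g u)⁻¹ • u) = 1 := by
  have h := (len_pos g hu).ne'
  simp only [map_smul, smul_apply, smul_eq_mul, ← len_sq]
  field_simp

lemma isOrthonormal_completedFrame {p : M} {f : Fin 3 → TangentSpace (𝓡 3) p} {n : Fin 3 → ℝ}
    {s : ℝ} {τ : TangentSpace (𝓡 3) p} (hs : s * s = 1) (hτ : g.inner p τ τ = 1)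
    (h1 : firstNormal g f n τ ≠ 0) (h2 : secondNormal g f n τ ≠ 0) :
    IsOrthonormal g (completedFrame g f n s τ) := by
  have e1 := inner_normalize g h1
  have e2 := inner_normalize g h2
  have e3 := inner_firstNormal g f n τ
  have e4 := inner_secondNormal g f n τ
  have e5 := inner_secondNormal_firstNormal g f n τ
  have e3' := (g.symm p τ (firstNormal g f n τ)).trans e3
  have e4' := (g.symm p τ (secondNormal g f n τ)).trans e4
  have e5' := (g.symm p (firstNormal g f n τ) (secondNormal g f n τ)).trans e5
  have e6 : g.inner p (s • (len g (secondNormal g f n τ))⁻¹ • secondNormal g f n τ)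
      (s • (len g (secondNormal g f n τ))⁻¹ • secondNormal g f n τ) = 1 := by
    generalize (len g (secondNormal g f n τ))⁻¹ • secondNormal g f n τ = w at *
    simp only [map_smul, smul_apply, e2, smul_eq_mul, mul_one, hs]
  intro i j
  fin_cases i <;> fin_cases j
  · simpa [completedFrame] using e1
  · simp [completedFrame, e5']
  · simp [completedFrame, e3]
  · simp [completedFrame, e5]
  · simpa [completedFrame] using e6
  · simp [completedFrame, e4]
  · simp [completedFrame, e3']
  · simp [completedFrame, e4']
  · simpa [completedFrame] using hτ

/-- By Lagrange's identity, orthogonal vectors satisfy |u × c|² = |u|² |c|². -/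
lemma cross_cross_self_ne_zero {u c : Fin 3 → ℝ} (hu : u ≠ 0) (hc : c ≠ 0) (h : u ⬝ᵥ c = 0) :
    u ⨯₃ c ≠ 0 := by
  intro h0
  have h1 : (u ⨯₃ c) ⬝ᵥ (u ⨯₃ c) = (u ⬝ᵥ u) * (c ⬝ᵥ c) := by
    rw [cross_dot_cross, h]; ring
  rw [h0, zero_dotProduct, eq_comm, mul_eq_zero, dotProduct_self_eq_zero,
    dotProduct_self_eq_zero] at h1
  tauto

lemma firstNormal_ne_zero {p : M} {f : Fin 3 → TangentSpace (𝓡 3) p} {n : Fin 3 → ℝ}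
    {τ : TangentSpace (𝓡 3) p} (hf : ∀ c, combination f c = 0 → c = 0)
    (hn : n ⨯₃ pairing g f τ ≠ 0) : firstNormal g f n τ ≠ 0 :=
  fun h ↦ hn (hf _ h)

lemma secondNormal_ne_zero {p : M} {f : Fin 3 → TangentSpace (𝓡 3) p} {n : Fin 3 → ℝ}
    {τ : TangentSpace (𝓡 3) p} (hf : ∀ c, combination f c = 0 → c = 0)
    (hn : n ⨯₃ pairing g f τ ≠ 0) : secondNormal g f n τ ≠ 0 := by
  have hV := inner_self_pos g (firstNormal_ne_zero g hf hn)
  set u := pairing g f τ with hu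
  intro h
  have h1 : combination f (g.inner p (firstNormal g f n τ) (firstNormal g f n τ) •
      (u ⨯₃ (n ⨯₃ u)) - g.inner p (combination f (u ⨯₃ (n ⨯₃ u))) (firstNormal g f n τ) •
      (n ⨯₃ u)) = 0 := by
    rw [← h, secondNormal, ← hu]
    simp only [combination, firstNormal, Pi.sub_apply, Pi.smul_apply, smul_eq_mul, sub_smul,
      mul_smul, Finset.sum_sub_distrib, ← Finset.smul_sum, ← hu]
  have h2 := hf _ h1
  generalize g.inner p (firstNormal g f n τ) (firstNormal g f n τ) = A at *
  generalize g.inner p (combination f (u ⨯₃ (n ⨯₃ u))) (firstNormal g f n τ) = B at *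
  have hu0 : u ≠ 0 := by rintro h0; exact hn (by rw [h0, map_zero])
  have hne := cross_cross_self_ne_zero hu0 hn (by rw [dot_cross_self])
  -- The coefficient relation A (u × (n × u)) = B (n × u) is paired with u × (n × u), which is
  -- orthogonal to n × u. Only the term with A survives.
  have h3 := congrArg (fun w ↦ w ⬝ᵥ (u ⨯₃ (n ⨯₃ u))) h2
  simp only [sub_dotProduct, smul_dotProduct, zero_dotProduct, smul_eq_mul, dot_cross_self,
    mul_zero, sub_zero, mul_eq_zero, dotProduct_self_eq_zero] at h3
  rcases h3 with h3 | h3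
  · exact hV.ne' h3
  · exact hne h3

lemma combination_pairing_ne_zero {p : M} {f : Fin 3 → TangentSpace (𝓡 3) p}
    {τ : TangentSpace (𝓡 3) p} (hf : ∀ c, combination f c = 0 → c = 0) (hτ : τ ≠ 0) :
    pairing g f τ ≠ 0 := by
  have hli : LinearIndependent ℝ f :=
    Fintype.linearIndependent_iff.2 fun c hc i ↦ congrFun (hf c hc) i
  have hd : Module.finrank ℝ (TangentSpace (𝓡 3) p) = 3 := by
    change Module.finrank ℝ E3 = 3
    simp
  have : FiniteDimensional ℝ (TangentSpace (𝓡 3) p) :=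
    inferInstanceAs (FiniteDimensional ℝ E3)
  have hspan := hli.span_eq_top_of_card_eq_finrank (by simp [hd])
  obtain ⟨c, hc⟩ := (Submodule.mem_span_range_iff_exists_fun ℝ).1
    (hspan ▸ Submodule.mem_top : τ ∈ Submodule.span ℝ (range f))
  intro h
  have h1 := inner_combination g f c τ
  rw [h, dotProduct_zero, combination, hc] at h1
  exact (inner_self_pos g hτ).ne' h1

/-- The lines spanned by the vectors u t sweep out a C¹ image of a two-dimensional set, and the
complement of such an image is dense in ℝ³. A vector n outside it is parallel to no u t. This avoids
any patching of normal fields along the curve. -/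
lemma exists_generic_vector {a b : ℝ} {u : ℝ → Fin 3 → ℝ} (hu : ContDiffOn ℝ 1 u (Icc a b))
    (h0 : ∀ t ∈ Icc a b, u t ≠ 0) : ∃ n : Fin 3 → ℝ, ∀ t ∈ Icc a b, n ⨯₃ u t ≠ 0 := by
  have h1 : ContDiffOn ℝ 1 (fun z : ℝ × ℝ ↦ z.2 • u z.1) (Icc a b ×ˢ univ) :=
    contDiff_snd.contDiffOn.smul (hu.comp contDiff_fst.contDiffOn fun z hz ↦ hz.1)
  have h2 := h1.dense_compl_image_of_dimH_lt_finrank ((convex_Icc a b).prod convex_univ)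
    (t := Icc a b ×ˢ univ) Subset.rfl (by
      refine (dimH_mono (subset_univ _)).trans_lt ?_
      rw [Real.dimH_univ_eq_finrank]
      simp
      norm_num)
  obtain ⟨n, hn⟩ := h2.nonempty
  -- If n × u t = 0, then n is its own orthogonal projection to the line of u t, so it lies in the
  -- swept set.
  refine ⟨n, fun t ht h ↦ hn ⟨(t, (u t ⬝ᵥ n) / (u t ⬝ᵥ u t)), ⟨ht, mem_univ _⟩, ?_⟩⟩
  have hd : u t ⬝ᵥ u t ≠ 0 := fun h ↦ h0 t ht (dotProduct_self_eq_zero.1 h)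
  have e := fun i ↦ congrFun h i
  have e0 := e 0
  have e1 := e 1
  have e2 := e 2
  simp only [cross_apply, Matrix.cons_val, Pi.zero_apply] at e0 e1 e2
  simp only [dotProduct, Fin.sum_univ_three] at hd ⊢
  ext i
  fin_cases i <;> simp <;> rw [div_mul_eq_mul_div, div_eq_iff hd]
  · linear_combination u t 1 * -e2 + u t 2 * e1
  · linear_combination u t 0 * e2 - u t 2 * e0
  · linear_combination -u t 0 * e1 + u t 1 * e0

section

variable {P : Type*} [NormedAddCommGroup P] [NormedSpace ℝ P] {X : P → M} {S : Set P}
  {f : ∀ z, Fin 3 → TangentSpace (𝓡 3) (X z)} {τ : ∀ z, TangentSpace (𝓡 3) (X z)}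
  (hf : ∀ i, SmoothField X (fun z ↦ f z i) S) (hτ : SmoothField X τ S)

lemma contDiffOn_cross {u v : P → Fin 3 → ℝ} (hu : ContDiffOn ℝ ∞ u S) (hv : ContDiffOn ℝ ∞ v S) :
    ContDiffOn ℝ ∞ (fun z ↦ u z ⨯₃ v z) S := by
  rw [contDiffOn_pi] at *
  intro i
  have e : ∀ j k l m, ContDiffOn ℝ ∞ (fun z ↦ u z j * v z k - u z l * v z m) S := fun j k l m ↦
    ((hu j).mul (hv k)).sub ((hu l).mul (hv m))
  fin_cases i <;> simp only [cross_apply] <;> exact e _ _ _ _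

include hf

lemma smoothField_combination {c : P → Fin 3 → ℝ} (hc : ContDiffOn ℝ ∞ c S) :
    SmoothField X (fun z ↦ combination (f z) (c z)) S :=
  SmoothField.sum Finset.univ (hf 0).base fun i ↦
    SmoothField.smul (contDiffOn_pi.1 hc i) (hf i)

include hτ

lemma contDiffOn_pairing : ContDiffOn ℝ ∞ (fun z ↦ pairing g (f z) (τ z)) S :=
  contDiffOn_pi.2 fun i ↦ hτ.inner g (hf i)

lemma smoothField_firstNormal (n : Fin 3 → ℝ) :
    SmoothField X (fun z ↦ firstNormal g (f z) n (τ z)) S :=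
  smoothField_combination hf (contDiffOn_cross contDiffOn_const (contDiffOn_pairing g hf hτ))

lemma smoothField_secondNormal (n : Fin 3 → ℝ) :
    SmoothField X (fun z ↦ secondNormal g (f z) n (τ z)) S := by
  have hp := contDiffOn_pairing g hf hτ
  have h1 := smoothField_firstNormal g hf hτ n
  have h2 := smoothField_combination hf
    (contDiffOn_cross hp (contDiffOn_cross (contDiffOn_const (c := n)) hp))
  exact (h2.smul (h1.inner g h1)).sub (h1.smul (h2.inner g h1))

lemma smoothField_completedFrame (n : Fin 3 → ℝ) (s : ℝ)
    (h1 : ∀ z ∈ S, firstNormal g (f z) n (τ z) ≠ 0)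
    (h2 : ∀ z ∈ S, secondNormal g (f z) n (τ z) ≠ 0) (i : Fin 3) :
    SmoothField X (fun z ↦ completedFrame g (f z) n s (τ z) i) S := by
  fin_cases i
  · exact (smoothField_firstNormal g hf hτ n).normalize g h1
  · exact ((smoothField_secondNormal g hf hτ n).normalize g h2).smul contDiffOn_const
  · exact hτ

end

end FrameConstruction

/-! ### Determinants and orientations of orthonormal frames -/

section Determinant

variable (g : Metric3 M)

lemma det3_eq {p : M} (f : Fin 3 → TangentSpace (𝓡 3) p) (u v w : TangentSpace (𝓡 3) p) :
    det3 g f u v w = g.inner p (f 0) u * g.inner p (f 1) v * g.inner p (f 2) w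
      - g.inner p (f 0) u * g.inner p (f 1) w * g.inner p (f 2) v
      - g.inner p (f 0) v * g.inner p (f 1) u * g.inner p (f 2) w
      + g.inner p (f 0) v * g.inner p (f 1) w * g.inner p (f 2) u
      + g.inner p (f 0) w * g.inner p (f 1) u * g.inner p (f 2) v
      - g.inner p (f 0) w * g.inner p (f 1) v * g.inner p (f 2) u := by
  simp [det3, Matrix.det_fin_three]

/-- The matrix of inner products with f factors through the components in the orthonormal frame E.
-/
lemma det3_eq_det_mul {p : M} {f E : Fin 3 → TangentSpace (𝓡 3) p} (hE : IsOrthonormal g E)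
    (u v w : TangentSpace (𝓡 3) p) :
    det3 g f u v w = det3 g f (E 0) (E 1) (E 2) * det3 g E u v w := by
  rw [det3, det3, det3, ← Matrix.det_mul]
  congr 1
  ext i j
  simp only [Matrix.of_apply, Matrix.mul_apply]
  rw [hE.inner_eq g (f i)]
  refine Finset.sum_congr rfl fun k _ ↦ ?_
  congr 1
  · congr 1
    fin_cases k <;> rfl
  · exact g.symm p _ _

lemma det3_self {p : M} {f : Fin 3 → TangentSpace (𝓡 3) p} (hf : IsOrthonormal g f) :
    det3 g f (f 0) (f 1) (f 2) = 1 := by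
  rw [det3_eq]
  simp [hf _ _]

lemma det3_mul_self {p : M} {f E : Fin 3 → TangentSpace (𝓡 3) p} (hf : IsOrthonormal g f)
    (hE : IsOrthonormal g E) :
    det3 g f (E 0) (E 1) (E 2) * det3 g f (E 0) (E 1) (E 2) = 1 := by
  have h1 := det3_eq_det_mul g hE (f := f) (f 0) (f 1) (f 2)
  rw [det3_self g hf] at h1
  have h2 : det3 g E (f 0) (f 1) (f 2) = det3 g f (E 0) (E 1) (E 2) := by
    rw [det3_eq, det3_eq]
    simp only [g.symm p (E _) (f _)]
    ring
  rw [h2] at h1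
  exact h1.symm

lemma continuousOn_det3 {P : Type*} [TopologicalSpace P] {X : P → M} {S : Set P}
    {F E : ∀ z, Fin 3 → TangentSpace (𝓡 3) (X z)}
    (hF : ∀ i, ContinuousOn (fun z ↦ (⟨X z, F z i⟩ : TangentBundle (𝓡 3) M)) S)
    (hE : ∀ i, ContinuousOn (fun z ↦ (⟨X z, E z i⟩ : TangentBundle (𝓡 3) M)) S) :
    ContinuousOn (fun z ↦ det3 g (F z) (E z 0) (E z 1) (E z 2)) S := by
  have h : ∀ i j, ContinuousOn (fun z ↦ g.inner (X z) (F z i) (E z j)) S := fun i j z hz ↦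
    continuousWithinAt_inner g hz (hF i z hz) (hE j z hz)
  simp only [det3_eq]
  fun_prop

/-- The determinant between two orthonormal frames squares to 1, so it never vanishes, and by
continuity its sign cannot change. -/
lemma det3_pos_of_continuousOn {a b : ℝ} {γ : ℝ → M} {F E : ∀ t, Fin 3 → TangentSpace (𝓡 3) (γ t)}
    (hF : IsFrameAlong g a b γ F) (hE : IsFrameAlong g a b γ E) {t₀ : ℝ} (ht₀ : t₀ ∈ Icc a b)
    (h : 0 < det3 g (F t₀) (E t₀ 0) (E t₀ 1) (E t₀ 2)) {t : ℝ} (ht : t ∈ Icc a b) :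
    0 < det3 g (F t) (E t 0) (E t 1) (E t 2) := by
  have hc := continuousOn_det3 g hF.continuous hE.continuous
  by_contra hneg
  obtain ⟨s, hs, hs0⟩ := isPreconnected_Icc.intermediate_value ht ht₀ hc
    ⟨not_lt.1 hneg, h.le⟩
  have := det3_mul_self g (hF.orthonormal s hs) (hE.orthonormal s hs)
  beta_reduce at hs0
  rw [hs0] at this
  simp at this

end Determinant

/-! ### The adapted frame of a variation -/

section AdaptedFrame

variable (g : Metric3 M) {δ a b : ℝ} {X : ℝ → ℝ → M}

/-- A variation of a curve carries an orthonormal frame adapted to the unit tangents, which is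
positive along the initial curve and constant at the endpoints. -/
lemma exists_adaptedFrame (hδ : 0 < δ) (hab : a < b)
    (hX : ContMDiffOn 𝓘(ℝ, ℝ × ℝ) (𝓡 3) ∞ (fun z : ℝ × ℝ ↦ X z.1 z.2) (strip δ a b))
    (hreg : ∀ ε ∈ Icc (-δ) δ, ∀ t ∈ Icc a b, velocity a b (X ε) t ≠ 0)
    {F : ∀ t, Fin 3 → TangentSpace (𝓡 3) (X 0 t)} (hF : IsFrameAlong g a b (X 0) F) :
    ∃ (δ' : ℝ) (E : ∀ z : ℝ × ℝ, Fin 3 → TangentSpace (𝓡 3) (X z.1 z.2)), 0 < δ' ∧ δ' ≤ δ ∧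
      IsAdaptedFrame g (fun z : ℝ × ℝ ↦ X z.1 z.2) (strip δ' a b) (0, 1) E ∧
      (∀ ε t, (⟨X ε t, unitTangent g a b (X ε) t⟩ : TangentBundle (𝓡 3) M)
          = ⟨X 0 t, unitTangent g a b (X 0) t⟩ →
        ∀ i, (⟨X ε t, E (ε, t) i⟩ : TangentBundle (𝓡 3) M) = ⟨X 0 t, E (0, t) i⟩) ∧
      ∀ t ∈ Icc a b, 0 < det3 g (F t) (E (0, t) 0) (E (0, t) 1) (E (0, t) 2) := by
  obtain ⟨f, δ₁, hδ₁, hδ₁δ, hf, hfF⟩ := exists_smooth_fields g hδ hX hF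
  have hX₁ := hX.mono (strip_mono (a := a) (b := b) hδ₁δ)
  have hI : ∀ {δ' ε}, δ' ≤ δ → ε ∈ Icc (-δ') δ' → ε ∈ Icc (-δ) δ := fun h hε ↦
    ⟨by linarith [hε.1], by linarith [hε.2]⟩
  set τ : ∀ z : ℝ × ℝ, TangentSpace (𝓡 3) (X z.1 z.2) := fun z ↦ unitTangent g a b (X z.1) z.2
    with hτdef
  have hτ : SmoothField (fun z : ℝ × ℝ ↦ X z.1 z.2) τ (strip δ₁ a b) := by
    have h1 := (smoothField_pvel (uniqueDiffOn_strip hδ₁ hab) hX₁ (0, 1)).normalize g (fun z hz ↦ by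
      have := hreg z.1 (hI hδ₁δ hz.1) z.2 hz.2
      rwa [velocity_eq_strip hab hX₁ hz.1 hz.2] at this)
    refine ContMDiffOn.congr h1 fun z hz ↦ ?_
    rw [hτdef]
    simp only [unitTangent]
    rw [velocity_eq_strip hab hX₁ hz.1 hz.2]
  have hz := zero_mem_Icc hδ
  have hli : ∀ t ∈ Icc a b, ∀ c, combination (f t (X 0 t)) c = 0 → c = 0 := fun t ht c hc ↦
    eq_zero_of_sum_smul_eq_zero g (hfF t ht) hc
  have hτ1 : ∀ z ∈ strip δ a b, g.inner (X z.1 z.2) (τ z) (τ z) = 1 := fun z hz ↦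
    inner_normalize g (hreg z.1 hz.1 z.2 hz.2)
  have hpair := contDiffOn_pairing g hf hτ
  -- The vector n is chosen generic for the initial curve only; the next strip is thin enough for
  -- both normals to remain nonzero on the nearby curves.
  obtain ⟨n, hn⟩ := exists_generic_vector
    (u := fun t ↦ pairing g (f t (X 0 t)) (unitTangent g a b (X 0) t)) (a := a) (b := b)
    (((hpair.of_le (by norm_cast)).comp
      (by fun_prop : ContDiffOn ℝ 1 (fun t : ℝ ↦ ((0, t) : ℝ × ℝ)) (Icc a b))
      (mapsTo_inr (zero_mem_Icc hδ₁))))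
    (fun t ht ↦ combination_pairing_ne_zero g (hli t ht) (by
      intro h0
      have := hτ1 (0, t) ⟨hz, ht⟩
      simp only [hτdef, h0, map_zero] at this
      simp at this))
  have hN1 := smoothField_firstNormal g hf hτ n
  have hN2 := smoothField_secondNormal g hf hτ n
  obtain ⟨δ₂, hδ₂, hδ₂₁, h12⟩ := exists_strip_ne_zero hδ₁
    ((hN1.inner g hN1).continuousOn.mul (hN2.inner g hN2).continuousOn) fun t ht ↦
      mul_ne_zero (inner_self_pos g (firstNormal_ne_zero g (hli t ht) (hn t ht))).ne'
        (inner_self_pos g (secondNormal_ne_zero g (hli t ht) (hn t ht))).ne'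
  have h1 : ∀ z ∈ strip δ₂ a b, firstNormal g (f z.2 (X z.1 z.2)) n (τ z) ≠ 0 := fun z hz h0 ↦
    h12 z hz (by simp [h0])
  have h2 : ∀ z ∈ strip δ₂ a b, secondNormal g (f z.2 (X z.1 z.2)) n (τ z) ≠ 0 := fun z hz h0 ↦
    h12 z hz (by simp [h0])
  have hsub := strip_mono (a := a) (b := b) hδ₂₁
  have hframe : ∀ s : ℝ, s * s = 1 → IsAdaptedFrame g (fun z : ℝ × ℝ ↦ X z.1 z.2) (strip δ₂ a b)
      (0, 1) (fun z ↦ completedFrame g (f z.2 (X z.1 z.2)) n s (τ z)) := by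
    intro s hs
    refine ⟨fun i ↦ ?_, fun z hz ↦ ?_, fun z hz ↦ ?_, fun z hz ↦ ?_⟩
    · exact smoothField_completedFrame g (fun i ↦ (hf i).mono hsub) (hτ.mono hsub) n s h1 h2 i
    · exact isOrthonormal_completedFrame g hs (hτ1 z (strip_mono hδ₁δ (hsub hz))) (h1 z hz) (h2 z hz)
    · rw [← velocity_eq_strip hab (hX₁.mono hsub) hz.1 hz.2]
      exact hreg _ (hI (hδ₂₁.trans hδ₁δ) hz.1) _ hz.2
    · rw [← velocity_eq_strip hab (hX₁.mono hsub) hz.1 hz.2]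
      rfl
  have hz₂ := zero_mem_Icc hδ₂
  have hfr0 : ∀ s : ℝ, s * s = 1 → IsFrameAlong g a b (X 0)
      (fun t ↦ completedFrame g (f t (X 0 t)) n s (unitTangent g a b (X 0) t)) := by
    intro s hs
    refine ⟨fun i ↦ ?_, fun t ht ↦ (hframe s hs).orthonormal (0, t) ⟨hz₂, ht⟩⟩
    have hc : ContinuousOn (fun t : ℝ ↦ ((0, t) : ℝ × ℝ)) (Icc a b) := by fun_prop
    exact ((hframe s hs).smooth i).continuousOn.comp hc (mapsTo_inr hz₂)
  have haI : a ∈ Icc a b := left_mem_Icc.2 hab.le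
  -- The sign s of the second normal is fixed by positivity at a; continuity then gives positivity
  -- along the whole initial curve.
  have hflip : ∃ s : ℝ, s * s = 1 ∧ 0 < det3 g (F a)
      (completedFrame g (f a (X 0 a)) n s (unitTangent g a b (X 0) a) 0)
      (completedFrame g (f a (X 0 a)) n s (unitTangent g a b (X 0) a) 1)
      (completedFrame g (f a (X 0 a)) n s (unitTangent g a b (X 0) a) 2) := by
    have hd := det3_mul_self g (hF.orthonormal a haI) ((hfr0 1 (by norm_num)).orthonormal a haI)
    rcases lt_trichotomy 0 (det3 g (F a)
      (completedFrame g (f a (X 0 a)) n 1 (unitTangent g a b (X 0) a) 0)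
      (completedFrame g (f a (X 0 a)) n 1 (unitTangent g a b (X 0) a) 1)
      (completedFrame g (f a (X 0 a)) n 1 (unitTangent g a b (X 0) a) 2)) with h | h | h
    · exact ⟨1, by norm_num, h⟩
    · rw [← h] at hd; simp at hd
    · refine ⟨-1, by norm_num, ?_⟩
      have e : ∀ u v w : TangentSpace (𝓡 3) (X 0 a),
          det3 g (F a) u ((-1 : ℝ) • v) w = -det3 g (F a) u ((1 : ℝ) • v) w := by
        intro u v w
        simp only [det3_eq, map_smul, smul_eq_mul]
        ring
      have e' := e (completedFrame g (f a (X 0 a)) n 1 (unitTangent g a b (X 0) a) 0)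
        ((len g (secondNormal g (f a (X 0 a)) n (unitTangent g a b (X 0) a)))⁻¹ •
          secondNormal g (f a (X 0 a)) n (unitTangent g a b (X 0) a))
        (completedFrame g (f a (X 0 a)) n 1 (unitTangent g a b (X 0) a) 2)
      have h' := neg_pos.2 h
      exact h'.trans_eq e'.symm
  obtain ⟨s, hs, hsa⟩ := hflip
  refine ⟨δ₂, fun z ↦ completedFrame g (f z.2 (X z.1 z.2)) n s (τ z), hδ₂, hδ₂₁.trans hδ₁δ,
    hframe s hs, fun ε t h i ↦ ?_, fun t ht ↦ ?_⟩
  -- The completed frame is a function of the time, the point and the unit tangent alone, so equal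
  -- end data give equal frames.
  · exact congrArg (fun w : TangentBundle (𝓡 3) M ↦
      (⟨w.1, completedFrame g (f t w.1) n s w.2 i⟩ : TangentBundle (𝓡 3) M)) h
  · exact det3_pos_of_continuousOn g hF (hfr0 s hs) haI hsa ht

end AdaptedFrame

/-! ### Rotations and orientations -/

section Rotation

variable (g : Metric3 M)

omit [IsManifold (𝓡 3) ∞ M] in
lemma mk_smul_add_smul {p q : M} {u v : TangentSpace (𝓡 3) p} {u' v' : TangentSpace (𝓡 3) q}
    (h : (⟨p, u⟩ : TangentBundle (𝓡 3) M) = ⟨q, u'⟩)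
    (h' : (⟨p, v⟩ : TangentBundle (𝓡 3) M) = ⟨q, v'⟩) (r s : ℝ) :
    (⟨p, r • u + s • v⟩ : TangentBundle (𝓡 3) M) = ⟨q, r • u' + s • v'⟩ := by
  obtain rfl := base_congr h
  have h1 : u = u' := by simpa using h
  have h2 : v = v' := by simpa using h'
  rw [h1, h2]

lemma isOrthonormal_congr {p q : M} {u : Fin 3 → TangentSpace (𝓡 3) p}
    {v : Fin 3 → TangentSpace (𝓡 3) q} (hv : IsOrthonormal g v)
    (h : ∀ i, (⟨p, u i⟩ : TangentBundle (𝓡 3) M) = ⟨q, v i⟩) : IsOrthonormal g u :=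
  fun i j ↦ (inner_congr g (h i) (h j)).trans (hv i j)

lemma det3_pos_of_sameOrientation {p q : M} {u : Fin 3 → TangentSpace (𝓡 3) p}
    {v : Fin 3 → TangentSpace (𝓡 3) q} (h : SameOrientation u v) (hv : IsOrthonormal g v)
    {v' : Fin 3 → TangentSpace (𝓡 3) p}
    (hv' : ∀ i, (⟨p, v' i⟩ : TangentBundle (𝓡 3) M) = ⟨q, v i⟩) :
    0 < det3 g u (v' 0) (v' 1) (v' 2) := by
  obtain rfl := base_congr (hv' 0)
  have h1 : v' = v := by ext1 i; simpa using hv' i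
  subst h1
  obtain ⟨R, hR, hu⟩ := h
  have hu' : ∀ i, u i = ∑ j, R i j • v' j := fun i ↦ by simpa using hu i
  have h2 : det3 g u (v' 0) (v' 1) (v' 2) = R.det := by
    rw [det3]
    congr 1
    ext i j
    have h3 : ![v' 0, v' 1, v' 2] j = v' j := by fin_cases j <;> rfl
    rw [Matrix.of_apply, h3, hu' i]
    simp [map_sum, hv _ j]
  rwa [h2]

lemma exists_cos_sin {p q : ℝ} (h : p ^ 2 + q ^ 2 = 1) : ∃ α : ℝ, Real.cos α = p ∧ Real.sin α = q := by
  have hn : ‖(⟨p, q⟩ : ℂ)‖ = 1 := by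
    rw [Complex.norm_def, Complex.normSq_mk, ← pow_two, ← pow_two, h, Real.sqrt_one]
  refine ⟨Complex.arg ⟨p, q⟩, ?_, ?_⟩
  · rw [Complex.cos_arg (by rw [← norm_pos_iff, hn]; exact one_pos), hn, div_one]
  · rw [Complex.sin_arg, hn, div_one]

/-- `A` is obtained from `E` by the rotation by `α` about the last vector. -/
def IsRotation {p : M} (α : ℝ) (E A : Fin 3 → TangentSpace (𝓡 3) p) : Prop :=
  A 0 = Real.cos α • E 0 + Real.sin α • E 1 ∧ A 1 = (-Real.sin α) • E 0 + Real.cos α • E 1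

/-- With a common last vector the first two vectors of A are given by an orthogonal 2 × 2 matrix in
E; a positive determinant makes it a rotation. -/
lemma exists_isRotation {p : M} {E A : Fin 3 → TangentSpace (𝓡 3) p} (hE : IsOrthonormal g E)
    (hA : IsOrthonormal g A) (h2 : A 2 = E 2) (hd : 0 < det3 g E (A 0) (A 1) (A 2)) :
    ∃ α, IsRotation α E A := by
  have e02 : g.inner p (A 0) (E 2) = 0 := by rw [← h2, hA]; simp
  have e12 : g.inner p (A 1) (E 2) = 0 := by rw [← h2, hA]; simp
  have e00 := hE.inner_eq g (A 0) (A 0)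
  have e01 := hE.inner_eq g (A 0) (A 1)
  have e11 := hE.inner_eq g (A 1) (A 1)
  rw [hA, Fin.sum_univ_three, e02] at e00
  rw [hA, Fin.sum_univ_three, e02] at e01
  rw [hA, Fin.sum_univ_three, e12] at e11
  have s0 := hE.eq_sum g (A 0)
  have s1 := hE.eq_sum g (A 1)
  rw [Fin.sum_univ_three, e02, zero_smul, add_zero] at s0
  rw [Fin.sum_univ_three, e12, zero_smul, add_zero] at s1
  rw [det3_eq, h2, g.symm p (E 2) (A 0), g.symm p (E 2) (A 1), e02, e12, hE 2 2, hE 0 2, hE 1 2,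
    g.symm p (E 0) (A 0), g.symm p (E 1) (A 0), g.symm p (E 0) (A 1), g.symm p (E 1) (A 1)] at hd
  simp only [if_true, if_false, zero_mul, mul_zero, add_zero, sub_zero, mul_one,
    Fin.reduceEq] at e00 e01 e11 hd
  generalize g.inner p (A 0) (E 0) = a0 at *
  generalize g.inner p (A 0) (E 1) = a1 at *
  generalize g.inner p (A 1) (E 0) = b0 at *
  generalize g.inner p (A 1) (E 1) = b1 at *
  obtain ⟨α, hc, hs⟩ := exists_cos_sin (p := a0) (q := a1) (by linarith)
  -- Lagrange's identity for the two orthonormal rows.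
  have hD : (a0 * b1 - b0 * a1) ^ 2 = 1 := by
    linear_combination (-b0 ^ 2 - b1 ^ 2) * e00 - e11 + (a0 * b0 + a1 * b1) * e01
  have hD1 : a0 * b1 - b0 * a1 = 1 := by
    have : (a0 * b1 - b0 * a1 - 1) * (a0 * b1 - b0 * a1 + 1) = 0 := by linear_combination hD
    rcases mul_eq_zero.1 this with h | h <;> linarith
  have hb0 : b0 = -a1 := by
    linear_combination b0 * e00 - a0 * e01 - a1 * hD1
  have hb1 : b1 = a0 := by
    linear_combination b1 * e00 - a1 * e01 + a0 * hD1
  refine ⟨α, ?_, ?_⟩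
  · rw [hc, hs]; exact s0
  · rw [hc, hs, ← hb0, ← hb1]; exact s1

/-- Orthonormal frames on the same side of `F`, with the same last vector, differ by a rotation. -/
lemma exists_isRotation_of_sameOrientation {p : M} {F E A : Fin 3 → TangentSpace (𝓡 3) p}
    (hE : IsOrthonormal g E) (hA : IsOrthonormal g A) (h2 : A 2 = E 2)
    (hFE : 0 < det3 g F (E 0) (E 1) (E 2)) (hFA : SameOrientation F A) :
    ∃ α, IsRotation α E A := by
  have h1 := det3_pos_of_sameOrientation g hFA hA fun _ ↦ rfl
  rw [det3_eq_det_mul g hE] at h1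
  exact exists_isRotation g hE hA h2 (pos_of_mul_pos_right h1 hFE.le)

end Rotation

/-! ### The total torsion in terms of an adapted frame -/

section CurveFrame

variable {g : Metric3 M} {a b : ℝ} {γ : ℝ → M} {E : ∀ t, Fin 3 → TangentSpace (𝓡 3) (γ t)}

lemma IsAdaptedFrame.unitTangent_eq (hE : IsAdaptedFrame g γ (Icc a b) 1 E) {t : ℝ}
    (ht : t ∈ Icc a b) : unitTangent g a b γ t = E t 2 := (hE.tangent t ht).symm

lemma IsAdaptedFrame.inner_velocity (hE : IsAdaptedFrame g γ (Icc a b) 1 E) {t : ℝ}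
    (ht : t ∈ Icc a b) (w : TangentSpace (𝓡 3) (γ t)) :
    g.inner (γ t) w (velocity a b γ t) = len g (velocity a b γ t) * g.inner (γ t) w (E t 2) := by
  have h := hE.pvel_eq ht
  rw [← velocity_eq_pvel] at h
  conv_lhs => rw [h]
  rw [map_smul, smul_eq_mul]

lemma IsAdaptedFrame.normalPart_eq (hE : IsAdaptedFrame g γ (Icc a b) 1 E) {t : ℝ}
    (ht : t ∈ Icc a b) (w : TangentSpace (𝓡 3) (γ t)) :
    normalPart g a b γ t w = g.inner (γ t) w (E t 0) • E t 0 + g.inner (γ t) w (E t 1) • E t 1 := by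
  rw [normalPart, hE.unitTangent_eq ht]
  conv_lhs => enter [1]; rw [(hE.orthonormal t ht).eq_sum g w]
  rw [Fin.sum_univ_three]
  simp

/-- The bivector is tested on the covectors g(Eᵢ, ·) and g(E₂, ·), where the velocity contributes
only through E₂. Conversely, a vector with no E₀- and E₁-components is proportional to the velocity.
-/
lemma wedgeEqZero_iff (hE : IsAdaptedFrame g γ (Icc a b) 1 E) {t : ℝ} (ht : t ∈ Icc a b)
    (J : TangentSpace (𝓡 3) (γ t)) : WedgeEqZero (velocity a b γ t) J ↔
      g.inner (γ t) J (E t 0) = 0 ∧ g.inner (γ t) J (E t 1) = 0 := by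
  have hv : velocity a b γ t = len g (velocity a b γ t) • E t 2 := hE.pvel_eq ht
  have hl : len g (velocity a b γ t) ≠ 0 := (len_pos g (hE.pvel_ne t ht)).ne'
  have ho := hE.orthonormal t ht
  constructor
  · intro h
    have key : ∀ i : Fin 3, i ≠ 2 → g.inner (γ t) J (E t i) = 0 := by
      intro i hi
      have h1 := h (g.inner (γ t) (E t i)) (g.inner (γ t) (E t 2))
      rw [hv] at h1
      simp only [map_smul, ho i 2, ho 2 2, if_neg hi, if_true, smul_eq_mul, mul_zero, zero_mul,
        mul_one, zero_sub, neg_eq_zero, mul_eq_zero] at h1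
      rw [g.symm]
      tauto
    exact ⟨key 0 (by decide), key 1 (by decide)⟩
  · rintro ⟨h0, h1⟩ α β
    have hJ := ho.eq_sum g J
    rw [Fin.sum_univ_three, h0, h1, zero_smul, zero_smul, zero_add, zero_add] at hJ
    rw [hJ, hv]
    simp only [map_smul, smul_eq_mul]
    ring

lemma hasDerivWithinAt_integral {w : ℝ → ℝ} (hw : ContinuousOn w (Icc a b)) {t : ℝ}
    (ht : t ∈ Icc a b) :
    HasDerivWithinAt (fun t ↦ ∫ s in a..t, w s) (w t) (Icc a b) t := by
  have : Fact (t ∈ Icc a b) := ⟨ht⟩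
  refine intervalIntegral.integral_hasDerivWithinAt_right ?_ ?_ (hw t ht)
  · refine (hw.mono ?_).intervalIntegrable
    rw [uIcc_of_le ht.1]
    exact Icc_subset_Icc_right ht.2
  · exact hw.stronglyMeasurableAtFilter_nhdsWithin measurableSet_Icc t

lemma contDiffOn_of_hasDerivWithinAt (hab : a < b) {ψ w : ℝ → ℝ} (hw : ContDiffOn ℝ ∞ w (Icc a b))
    (h : ∀ t ∈ Icc a b, HasDerivWithinAt ψ (w t) (Icc a b) t) : ContDiffOn ℝ ∞ ψ (Icc a b) := by
  rw [contDiffOn_infty_iff_derivWithin (uniqueDiffOn_Icc hab)]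
  exact ⟨fun t ht ↦ (h t ht).differentiableWithinAt,
    hw.congr fun t ht ↦ (h t ht).derivWithin (uniqueDiffOn_Icc hab t ht)⟩

/-- The normal part of the derivative of cos ψ E₀ + sin ψ E₁ is (ψ' + ω₀₁)(-sin ψ E₀ + cos ψ E₁). -/
lemma isNormalParallel_of_angle (hab : a < b) (hE : IsAdaptedFrame g γ (Icc a b) 1 E) {ψ : ℝ → ℝ}
    (hψ : ∀ t ∈ Icc a b, HasDerivWithinAt ψ (-frameConn g γ (Icc a b) 1 E 0 1 t) (Icc a b) t) :
    IsNormalParallel g a b γ (fun t ↦ Real.cos (ψ t) • E t 0 + Real.sin (ψ t) • E t 1) := by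
  have hu : UniqueDiffOn ℝ (Icc a b) := uniqueDiffOn_Icc hab
  have hψs := contDiffOn_of_hasDerivWithinAt hab (contDiffOn_frameConn g hu hE.smooth 1 0 1).neg hψ
  have hN : SmoothField γ (fun t ↦ Real.cos (ψ t) • E t 0 + Real.sin (ψ t) • E t 1) (Icc a b) :=
    ((hE.smooth 0).smul hψs.cos).add ((hE.smooth 1).smul hψs.sin)
  set N : ∀ t, TangentSpace (𝓡 3) (γ t) := fun t ↦ Real.cos (ψ t) • E t 0 + Real.sin (ψ t) • E t 1
    with hNdef
  have hcomp : ∀ t ∈ Icc a b, ∀ i, frameComp g γ N E i t =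
      ![Real.cos (ψ t), Real.sin (ψ t), 0] i := by
    intro t ht i
    have ho := hE.orthonormal t ht
    rw [frameComp, hNdef]
    simp only [map_add, map_smul, add_apply, smul_apply, ho _ _]
    fin_cases i <;> simp
  refine ⟨hN, fun t ht ↦ ?_, fun t ht ↦ ?_⟩
  · rw [hE.inner_velocity ht]
    have := hcomp t ht 2
    rw [frameComp] at this
    rw [this]; simp
  · rw [hE.normalPart_eq ht, covDeriv_eq_pcov g hab ht (hN t ht)]
    rw [inner_pcov g hu hE.smooth hE.orthonormal hN ht, inner_pcov g hu hE.smooth hE.orthonormal hN ht]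
    have d0 : fderivWithin ℝ (frameComp g γ N E 0) (Icc a b) t 1 =
        -Real.sin (ψ t) * -frameConn g γ (Icc a b) 1 E 0 1 t := by
      rw [fderivWithin_congr (f := fun t ↦ Real.cos (ψ t)) (fun s hs ↦ hcomp s hs 0) (hcomp t ht 0)]
      exact (hψ t ht).cos.derivWithin (hu t ht)
    have d1 : fderivWithin ℝ (frameComp g γ N E 1) (Icc a b) t 1 =
        Real.cos (ψ t) * -frameConn g γ (Icc a b) 1 E 0 1 t := by
      rw [fderivWithin_congr (f := fun t ↦ Real.sin (ψ t)) (fun s hs ↦ hcomp s hs 1) (hcomp t ht 1)]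
      exact (hψ t ht).sin.derivWithin (hu t ht)
    rw [d0, d1, Fin.sum_univ_three, Fin.sum_univ_three, hcomp t ht, hcomp t ht, hcomp t ht,
      hE.frameConn_self hu ht, hE.frameConn_self hu ht,
      frameConn_antisymm g hu hE.smooth hE.orthonormal ht 1 1 0]
    simp

/-- The total torsion is minus the integral of the connection form of an adapted frame, corrected
by the angles between this frame and the given ones. -/
lemma isTotalTorsion_of_frame (hab : a < b) (hE : IsAdaptedFrame g γ (Icc a b) 1 E) {p q : M}
    {A EA : Fin 3 → TangentSpace (𝓡 3) p} {B EB : Fin 3 → TangentSpace (𝓡 3) q} {α β : ℝ}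
    (hA : IsRotation α EA A) (hB : IsRotation β EB B)
    (ha : ∀ i, (⟨γ a, E a i⟩ : TangentBundle (𝓡 3) M) = ⟨p, EA i⟩)
    (hb : ∀ i, (⟨γ b, E b i⟩ : TangentBundle (𝓡 3) M) = ⟨q, EB i⟩) :
    IsTotalTorsion g a b γ A B
      ((α - β - ∫ t in a..b, frameConn g γ (Icc a b) 1 E 0 1 t : ℝ) : Real.Angle) := by
  have hu : UniqueDiffOn ℝ (Icc a b) := uniqueDiffOn_Icc hab
  have hw := contDiffOn_frameConn g hu hE.smooth 1 0 1
  have hint : ∀ t ∈ Icc a b, _ := fun t ht ↦ hasDerivWithinAt_integral hw.continuousOn ht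
  set I : ℝ → ℝ := fun t ↦ ∫ s in a..t, frameConn g γ (Icc a b) 1 E 0 1 s with hI
  have hIa : I a = 0 := by simp [hI]
  have hψ : ∀ c, ∀ t ∈ Icc a b, HasDerivWithinAt (fun t ↦ c - I t)
      (-frameConn g γ (Icc a b) 1 E 0 1 t) (Icc a b) t := fun c t ht ↦ (hint t ht).const_sub c
  have e0 : ∀ u v w : ℝ, Real.cos (u - v - w) = Real.cos (u - w) * Real.cos v
      + Real.sin (u - w) * Real.sin v := fun u v w ↦ by
    rw [← Real.cos_sub]; ring_nf
  have e1 : ∀ u v w : ℝ, Real.sin (u - v - w) = Real.sin (u - w) * Real.cos v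
      - Real.cos (u - w) * Real.sin v := fun u v w ↦ by
    rw [← Real.sin_sub]; ring_nf
  have e2 : ∀ u w : ℝ, Real.cos (u + Real.pi / 2 - w) = -Real.sin (u - w) := fun u w ↦ by
    rw [← Real.cos_add_pi_div_two]; ring_nf
  have e3 : ∀ u w : ℝ, Real.sin (u + Real.pi / 2 - w) = Real.cos (u - w) := fun u w ↦ by
    rw [← Real.sin_add_pi_div_two]; ring_nf
  have hsq := Real.sin_sq_add_cos_sq β
  -- Measured in the frame E, the vectors A 0 and A 1 start at the angles α and α + π/2. At b both
  -- have turned by -∫ ω₀₁, and subtracting β expresses the result in terms of B.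
  refine ⟨_, _, isNormalParallel_of_angle hab hE (hψ α),
    isNormalParallel_of_angle hab hE (hψ (α + Real.pi / 2)), ?_, ?_, ?_, ?_⟩
  · rw [mk_smul_add_smul (ha 0) (ha 1), hIa, sub_zero, ← hA.1]
  · rw [mk_smul_add_smul (ha 0) (ha 1), hIa, e2, e3, sub_zero, ← hA.2]
  · rw [mk_smul_add_smul (hb 0) (hb 1), hB.1, hB.2, Real.Angle.cos_coe, Real.Angle.sin_coe, e0, e1]
    congr 1
    change _ = (Real.cos (α - I b) * Real.cos β + Real.sin (α - I b) * Real.sin β) • _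
      + (Real.sin (α - I b) * Real.cos β - Real.cos (α - I b) * Real.sin β) • _
    match_scalars
    · linear_combination (-(Real.cos (α - I b)) : ℝ) * hsq
    · linear_combination (-(Real.sin (α - I b)) : ℝ) * hsq
  · rw [mk_smul_add_smul (hb 0) (hb 1), hB.1, hB.2, Real.Angle.cos_coe, Real.Angle.sin_coe, e0, e1,
      e2, e3]
    congr 1
    change _ = -(Real.sin (α - I b) * Real.cos β - Real.cos (α - I b) * Real.sin β) • _
      + (Real.cos (α - I b) * Real.cos β + Real.sin (α - I b) * Real.sin β) • _
    match_scalars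
    · linear_combination Real.sin (α - I b) * hsq
    · linear_combination (-(Real.cos (α - I b)) : ℝ) * hsq

-- Normal parallel transport is isometric: the derivative of such a field is tangent to the curve,
-- hence orthogonal to every normal field.
omit E in
lemma IsNormalParallel.inner_eq (hab : a < b)
    {N N' : ∀ t, TangentSpace (𝓡 3) (γ t)}
    (hN : IsNormalParallel g a b γ N) (hN' : IsNormalParallel g a b γ N') :
    g.inner (γ b) (N b) (N' b) = g.inner (γ a) (N a) (N' a) := by
  have hu : UniqueDiffOn ℝ (Icc a b) := uniqueDiffOn_Icc hab
  have hs : ContDiffOn ℝ ∞ (fun t ↦ g.inner (γ t) (N t) (N' t)) (Icc a b) :=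
    SmoothField.inner g hN.smooth hN'.smooth
  have key : ∀ {N N' : ∀ t, TangentSpace (𝓡 3) (γ t)}, IsNormalParallel g a b γ N →
      IsNormalParallel g a b γ N' → ∀ t ∈ Icc a b,
      g.inner (γ t) (pcov g γ (Icc a b) 1 N t) (N' t) = 0 := by
    intro N N' hN hN' t ht
    have h1 := hN.parallel t ht
    rw [normalPart, sub_eq_zero, covDeriv_eq_pcov g hab ht (hN.smooth t ht)] at h1
    rw [h1, unitTangent]
    simp only [map_smul, smul_apply, smul_eq_mul]
    rw [g.symm (γ t) (velocity a b γ t) (N' t), hN'.normal t ht]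
    simp
  have hd : ∀ t ∈ Icc a b, derivWithin (fun t ↦ g.inner (γ t) (N t) (N' t)) (Icc a b) t = 0 := by
    intro t ht
    have h1 := fderivWithin_inner g hu ht (hN.smooth t ht) (hN'.smooth t ht) 1
    rw [key hN hN' t ht, g.symm, key hN' hN t ht, add_zero] at h1
    exact h1
  have := constant_of_derivWithin_zero (hs.differentiableOn (by simp))
    (fun t ht ↦ hd t (Ico_subset_Icc_self ht)) b (right_mem_Icc.2 hab.le)
  exact this

-- Two parallel fields with the same initial vector A 0 have inner product 1 at b. This reads cos θ
-- cos θ' + sin θ sin θ' = 1 and forces the angles to agree.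
omit E in
lemma IsTotalTorsion.unique (hab : a < b) {p q : M}
    {A : Fin 3 → TangentSpace (𝓡 3) p} {B : Fin 3 → TangentSpace (𝓡 3) q}
    (hA : IsOrthonormal g A) (hB : IsOrthonormal g B) {θ θ' : Real.Angle}
    (h : IsTotalTorsion g a b γ A B θ) (h' : IsTotalTorsion g a b γ A B θ') : θ = θ' := by
  obtain ⟨N, -, hN, -, hNa, -, hNb, -⟩ := h
  obtain ⟨N', -, hN', -, hNa', -, hNb', -⟩ := h'
  have h1 := hN.inner_eq hab hN'
  rw [inner_congr g hNa hNa', inner_congr g hNb hNb', hA] at h1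
  simp only [map_add, map_smul, add_apply, smul_apply, smul_eq_mul, hB _ _, if_true] at h1
  simp only [Fin.reduceEq, if_false, mul_zero, mul_one, add_zero, zero_add] at h1
  have e1 := Real.Angle.cos_sq_add_sin_sq θ
  have e2 := Real.Angle.cos_sq_add_sin_sq θ'
  have h2 : (θ.cos - θ'.cos) ^ 2 + (θ.sin - θ'.sin) ^ 2 = 0 := by
    linear_combination e1 + e2 - 2 * h1
  have h3 : (θ.cos - θ'.cos) ^ 2 = 0 := by nlinarith [sq_nonneg (θ.cos - θ'.cos), sq_nonneg (θ.sin - θ'.sin)]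
  have h4 : (θ.sin - θ'.sin) ^ 2 = 0 := by linarith
  induction θ using Real.Angle.induction_on
  induction θ' using Real.Angle.induction_on
  exact Real.Angle.cos_sin_inj (sub_eq_zero.1 (pow_eq_zero_iff two_ne_zero |>.1 h3))
    (sub_eq_zero.1 (pow_eq_zero_iff two_ne_zero |>.1 h4))

end CurveFrame

/-- The sines and cosines of the two lifts coincide near x and can be differentiated. This compares
derivatives without tracking multiples of 2π. -/
lemma deriv_eq_of_angle_eventuallyEq {f f' : ℝ → ℝ} {D D' x : ℝ} (hf : HasDerivAt f D x)
    (hf' : HasDerivAt f' D' x) (h : ∀ᶠ ε in 𝓝 x, (f ε : Real.Angle) = f' ε) : D = D' := by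
  have hc : (fun ε ↦ Real.cos (f ε)) =ᶠ[𝓝 x] fun ε ↦ Real.cos (f' ε) := h.mono fun ε hε ↦ by
    simpa using congrArg Real.Angle.cos hε
  have hs : (fun ε ↦ Real.sin (f ε)) =ᶠ[𝓝 x] fun ε ↦ Real.sin (f' ε) := h.mono fun ε hε ↦ by
    simpa using congrArg Real.Angle.sin hε
  have h1 := hf.cos.unique (hf'.cos.congr_of_eventuallyEq hc)
  have h2 := hf.sin.unique (hf'.sin.congr_of_eventuallyEq hs)
  have hcx : Real.cos (f x) = Real.cos (f' x) := hc.self_of_nhds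
  have hsx : Real.sin (f x) = Real.sin (f' x) := hs.self_of_nhds
  rw [← hcx] at h2
  rw [← hsx] at h1
  have h3 := Real.sin_sq_add_cos_sq (f x)
  linear_combination (-Real.sin (f x)) * h1 + Real.cos (f x) * h2 - (D - D') * h3

section SliceFrame

variable {g : Metric3 M} {δ a b : ℝ} {X : ℝ → ℝ → M}
  {E : ∀ z : ℝ × ℝ, Fin 3 → TangentSpace (𝓡 3) (X z.1 z.2)}

lemma IsAdaptedFrame.slice (hab : a < b)
    (hE : IsAdaptedFrame g (fun z : ℝ × ℝ ↦ X z.1 z.2) (strip δ a b) (0, 1) E) {ε : ℝ}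
    (hε : ε ∈ Icc (-δ) δ) : IsAdaptedFrame g (X ε) (Icc a b) 1 (fun t ↦ E (ε, t)) := by
  have hv : ∀ t ∈ Icc a b, pvel (X ε) (Icc a b) 1 t =
    pvel (fun z : ℝ × ℝ ↦ X z.1 z.2) (strip δ a b) (0, 1) (ε, t) := fun t ht ↦
    velocity_eq_strip hab hE.base hε ht
  refine ⟨fun i ↦ ?_, fun t ht ↦ hE.orthonormal (ε, t) ⟨hε, ht⟩, fun t ht ↦ ?_, fun t ht ↦ ?_⟩
  · exact (hE.smooth i).comp (by fun_prop : ContDiffOn ℝ ∞ (fun s : ℝ ↦ (ε, s)) (Icc a b))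
      (mapsTo_inr hε)
  · rw [hv t ht]; exact hE.pvel_ne (ε, t) ⟨hε, ht⟩
  · rw [hv t ht]; exact hE.tangent (ε, t) ⟨hε, ht⟩

lemma frameConn_slice (hδ : 0 < δ) (hab : a < b)
    (hE : IsAdaptedFrame g (fun z : ℝ × ℝ ↦ X z.1 z.2) (strip δ a b) (0, 1) E) {ε t : ℝ}
    (hε : ε ∈ Icc (-δ) δ) (ht : t ∈ Icc a b) (i j : Fin 3) :
    frameConn g (X ε) (Icc a b) 1 (fun t ↦ E (ε, t)) i j t =
      frameConn g (fun z : ℝ × ℝ ↦ X z.1 z.2) (strip δ a b) (0, 1) E i j (ε, t) := by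
  have := pcov_comp (X := fun z : ℝ × ℝ ↦ X z.1 z.2) (S := strip δ a b)
    (hasFDerivWithinAt_inr ε t (Icc a b)) (uniqueDiffOn_Icc hab t ht) (mapsTo_inr hε) ht
    (uniqueDiffOn_strip hδ hab (ε, t) ⟨hε, ht⟩) g (hE.smooth i (ε, t) ⟨hε, ht⟩) 1
  rw [ContinuousLinearMap.inr_apply] at this
  rw [frameConn, frameConn, ← this]

end SliceFrame

/-! ### The integral of torsion in terms of an adapted frame -/

lemma angle_ext {θ ψ : Real.Angle} (hc : θ.cos = ψ.cos) (hs : θ.sin = ψ.sin) : θ = ψ := by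
  induction θ using Real.Angle.induction_on
  induction ψ using Real.Angle.induction_on
  exact Real.Angle.cos_sin_inj hc hs

/-- A curve in the unit circle turns by the integral of its angular velocity. -/
lemma rotation_by_integral {a b : ℝ} (hab : a < b) {u w : ℝ → ℝ}
    (hu : ContDiffOn ℝ ∞ u (Icc a b)) (hw : ContDiffOn ℝ ∞ w (Icc a b))
    (h1 : ∀ t ∈ Icc a b, u t ^ 2 + w t ^ 2 = 1) {Θ : ℝ}
    (hΘ : Θ = ∫ t in a..b, (u t * derivWithin w (Icc a b) t - w t * derivWithin u (Icc a b) t)) :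
    u b = u a * Real.cos Θ - w a * Real.sin Θ ∧ w b = u a * Real.sin Θ + w a * Real.cos Θ := by
  have hU : UniqueDiffOn ℝ (Icc a b) := uniqueDiffOn_Icc hab
  have hdu := fun t ht ↦ (hu.differentiableOn (by simp) t ht).hasDerivWithinAt
  have hdw := fun t ht ↦ (hw.differentiableOn (by simp) t ht).hasDerivWithinAt
  have hcont : ContinuousOn (fun t ↦ u t * derivWithin w (Icc a b) t
      - w t * derivWithin u (Icc a b) t) (Icc a b) :=
    (hu.continuousOn.mul (hw.continuousOn_derivWithin hU (by simp))).sub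
      (hw.continuousOn.mul (hu.continuousOn_derivWithin hU (by simp)))
  have hφ := fun t ht ↦ hasDerivWithinAt_integral (t := t) hcont ht
  set φ : ℝ → ℝ := fun t ↦ ∫ s in a..t, (u s * derivWithin w (Icc a b) s
      - w s * derivWithin u (Icc a b) s) with hφdef
  have hφa : φ a = 0 := by simp [hφdef]
  have horth : ∀ t ∈ Icc a b, u t * derivWithin u (Icc a b) t + w t * derivWithin w (Icc a b) t = 0 := by
    intro t ht
    have h2 := ((hdu t ht).pow 2).add ((hdw t ht).pow 2)
    have h3 : HasDerivWithinAt (u ^ 2 + w ^ 2) 0 (Icc a b) t :=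
      (hasDerivWithinAt_const t (Icc a b) (1 : ℝ)).congr (fun s hs ↦ h1 s hs) (h1 t ht)
    have h4 := (hU t ht).eq_deriv _ h2 h3
    norm_num at h4
    linarith
  have key : ∀ f : ℝ → ℝ, (∀ t ∈ Icc a b, HasDerivWithinAt f 0 (Icc a b) t) → f b = f a := by
    intro f hf
    exact constant_of_derivWithin_zero (fun t ht ↦ (hf t ht).differentiableWithinAt)
      (fun t ht ↦ (hf t (Ico_subset_Icc_self ht)).derivWithin (hU t (Ico_subset_Icc_self ht))) b
      (right_mem_Icc.2 hab.le)
  -- Rotating (u, w) back by the accumulated angle φ gives a constant vector; `k1` and `k2` are its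
  -- two components.
  have k1 := key (fun t ↦ u t * Real.cos (φ t) + w t * Real.sin (φ t)) fun t ht ↦ by
    refine (((hdu t ht).mul (hφ t ht).cos).add ((hdw t ht).mul (hφ t ht).sin)).congr_deriv ?_
    linear_combination (Real.cos (φ t) * u t + Real.sin (φ t) * w t) * horth t ht
      - (Real.cos (φ t) * derivWithin u (Icc a b) t + Real.sin (φ t) * derivWithin w (Icc a b) t)
        * h1 t ht
  have k2 := key (fun t ↦ w t * Real.cos (φ t) - u t * Real.sin (φ t)) fun t ht ↦ by
    refine (((hdw t ht).mul (hφ t ht).cos).sub ((hdu t ht).mul (hφ t ht).sin)).congr_deriv ?_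
    linear_combination (Real.cos (φ t) * w t - Real.sin (φ t) * u t) * horth t ht
      - (Real.cos (φ t) * derivWithin w (Icc a b) t - Real.sin (φ t) * derivWithin u (Icc a b) t)
        * h1 t ht
  have hΘφ : Θ = φ b := hΘ
  simp only [hφa, Real.cos_zero, Real.sin_zero, mul_one, mul_zero, add_zero, sub_zero, ← hΘφ] at k1 k2
  have hsq := Real.sin_sq_add_cos_sq Θ
  constructor
  · linear_combination Real.cos Θ * k1 - Real.sin Θ * k2 - u b * hsq
  · linear_combination Real.sin Θ * k1 + Real.cos Θ * k2 - w b * hsq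

/-! ### Torsion and principal normal in an adapted frame -/

section CurveTorsion

variable {g : Metric3 M} {a b : ℝ} {γ : ℝ → M} {E F : ∀ t, Fin 3 → TangentSpace (𝓡 3) (γ t)}

lemma len_cross_sq {p : M} {f : Fin 3 → TangentSpace (𝓡 3) p} (hf : IsOrthonormal g f)
    (u v : TangentSpace (𝓡 3) p) : len g (cross g f u v) ^ 2 =
      g.inner p u u * g.inner p v v - g.inner p u v ^ 2 := by
  have hc : ∀ k, g.inner p (cross g f u v) (f k) =
      ((fun i ↦ g.inner p (f i) u) ⨯₃ (fun i ↦ g.inner p (f i) v)) k := by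
    intro k
    simp only [cross, map_sum, map_smul, FunLike.coe_sum, Finset.sum_apply, smul_apply, hf _ k,
      smul_eq_mul]
    simp
  rw [len_sq, hf.inner_eq g (cross g f u v), hf.inner_eq g u, hf.inner_eq g v, hf.inner_eq g u]
  simp only [hc, g.symm p u (f _), g.symm p v (f _), Fin.sum_univ_three, cross_apply]
  simp only [Matrix.cons_val]
  ring

omit E F in
lemma normalPart_accel_ne_zero {t : ℝ} {f : Fin 3 → TangentSpace (𝓡 3) (γ t)}
    (h : cross g f (velocity a b γ t) (accel g a b γ t) ≠ 0) :
    normalPart g a b γ t (accel g a b γ t) ≠ 0 := by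
  intro h0
  apply h
  rw [normalPart, sub_eq_zero, unitTangent, smul_smul] at h0
  rw [h0, cross]
  refine Finset.sum_eq_zero fun k _ ↦ ?_
  have : ∀ c : ℝ, (fun i ↦ g.inner (γ t) (f i) (c • velocity a b γ t)) =
      c • fun i ↦ g.inner (γ t) (f i) (velocity a b γ t) := fun c ↦ by
    ext i; simp
  rw [this, map_smul, cross_self]
  simp

omit F in
lemma IsAdaptedFrame.principalNormal_eq (hE : IsAdaptedFrame g γ (Icc a b) 1 E) {t : ℝ}
    (ht : t ∈ Icc a b) : principalNormal g a b γ t =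
      (g.inner (γ t) (accel g a b γ t) (E t 0) / √(g.inner (γ t) (accel g a b γ t) (E t 0) ^ 2
        + g.inner (γ t) (accel g a b γ t) (E t 1) ^ 2)) • E t 0
      + (g.inner (γ t) (accel g a b γ t) (E t 1) / √(g.inner (γ t) (accel g a b γ t) (E t 0) ^ 2
        + g.inner (γ t) (accel g a b γ t) (E t 1) ^ 2)) • E t 1 := by
  have ho := hE.orthonormal t ht
  rw [principalNormal, hE.normalPart_eq ht, len]
  have h1 : ∀ r s : ℝ, g.inner (γ t) (r • E t 0 + s • E t 1) (r • E t 0 + s • E t 1) =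
      r ^ 2 + s ^ 2 := by
    intro r s
    simp only [map_add, map_smul, add_apply, smul_apply, ho _ _, smul_eq_mul]
    simp
    ring
  rw [h1, smul_add, smul_smul, smul_smul, div_eq_inv_mul, div_eq_inv_mul]

/-- The torsion is the connection form of the adapted frame plus the angular velocity of the
principal normal in this frame. -/
lemma torsion_mul_len (hab : a < b) (hE : IsAdaptedFrame g γ (Icc a b) 1 E)
    (hF : IsFrameAlong g a b γ F) {t : ℝ} (ht : t ∈ Icc a b)
    (hd : det3 g (F t) (E t 0) (E t 1) (E t 2) = 1)
    (hacc : SmoothField γ (accel g a b γ) (Icc a b))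
    (hne : g.inner (γ t) (accel g a b γ t) (E t 0) ^ 2
        + g.inner (γ t) (accel g a b γ t) (E t 1) ^ 2 ≠ 0) :
    torsion g a b γ F t * len g (velocity a b γ t) =
      (g.inner (γ t) (accel g a b γ t) (E t 0) *
          derivWithin (fun t ↦ g.inner (γ t) (accel g a b γ t) (E t 1)) (Icc a b) t
        - g.inner (γ t) (accel g a b γ t) (E t 1) *
          derivWithin (fun t ↦ g.inner (γ t) (accel g a b γ t) (E t 0)) (Icc a b) t)
        / (g.inner (γ t) (accel g a b γ t) (E t 0) ^ 2
          + g.inner (γ t) (accel g a b γ t) (E t 1) ^ 2)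
      + frameConn g γ (Icc a b) 1 E 0 1 t := by
  have hu : UniqueDiffOn ℝ (Icc a b) := uniqueDiffOn_Icc hab
  have ho := hE.orthonormal t ht
  have hv : velocity a b γ t = len g (velocity a b γ t) • E t 2 := hE.pvel_eq ht
  have hl : len g (velocity a b γ t) ≠ 0 := (len_pos g (hE.pvel_ne t ht)).ne'
  have hvE : ∀ i, g.inner (γ t) (E t i) (velocity a b γ t) =
      if i = 2 then len g (velocity a b γ t) else 0 := by
    intro i
    conv_lhs => rw [hv]
    rw [map_smul, ho i 2]
    simp
  have hpv : ∀ s ∈ Icc a b, accel g a b γ s = pcov g γ (Icc a b) 1 (pvel γ (Icc a b) 1) s :=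
    fun s hs ↦ covDeriv_eq_pcov g hab hs (smoothField_pvel hu hE.base 1 s hs)
  have hj : jerk g a b γ t = pcov g γ (Icc a b) 1 (accel g a b γ) t :=
    covDeriv_eq_pcov g hab ht (hacc t ht)
  have hj' : ∀ i, g.inner (γ t) (jerk g a b γ t) (E t i) =
      derivWithin (fun t ↦ g.inner (γ t) (accel g a b γ t) (E t i)) (Icc a b) t
      - ∑ k, g.inner (γ t) (accel g a b γ t) (E t k) * frameConn g γ (Icc a b) 1 E i k t := by
    intro i
    rw [hj, inner_pcov g hu hE.smooth hE.orthonormal hacc ht]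
    rfl
  have ha : ∀ i : Fin 3, i ≠ 2 → g.inner (γ t) (accel g a b γ t) (E t i) =
      -(len g (velocity a b γ t) * frameConn g γ (Icc a b) 1 E i 2 t) := by
    intro i hi
    rw [hpv t ht, hE.accel_comp hu ht hi]
    rfl
  have a0 := ha 0 (by decide)
  have a1 := ha 1 (by decide)
  have j0 := hj' 0
  have j1 := hj' 1
  rw [Fin.sum_univ_three, hE.frameConn_self hu ht] at j0 j1
  rw [frameConn_antisymm g hu hE.smooth hE.orthonormal ht 1 1 0] at j1
  rw [torsion, len_cross_sq (hF.orthonormal t ht), det3_eq_det_mul g ho, hd, one_mul, det3_eq,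
    ho.inner_eq g (velocity a b γ t) (velocity a b γ t),
    ho.inner_eq g (velocity a b γ t) (accel g a b γ t),
    ho.inner_eq g (accel g a b γ t) (accel g a b γ t)]
  simp only [Fin.sum_univ_three, g.symm (γ t) (velocity a b γ t) (E t _),
    g.symm (γ t) (E t _) (accel g a b γ t), g.symm (γ t) (E t _) (jerk g a b γ t), hvE]
  simp only [Fin.reduceEq, if_true, if_false, j0, j1]
  generalize derivWithin (fun t ↦ g.inner (γ t) (accel g a b γ t) (E t 1)) (Icc a b) t = d1 at *
  generalize derivWithin (fun t ↦ g.inner (γ t) (accel g a b γ t) (E t 0)) (Icc a b) t = d0 at *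
  generalize g.inner (γ t) (accel g a b γ t) (E t 0) = x0 at *
  generalize g.inner (γ t) (accel g a b γ t) (E t 1) = x1 at *
  generalize g.inner (γ t) (accel g a b γ t) (E t 2) = x2 at *
  generalize frameConn g γ (Icc a b) 1 E 0 1 t = o at *
  generalize frameConn g γ (Icc a b) 1 E 0 2 t = p at *
  generalize frameConn g γ (Icc a b) 1 E 1 2 t = q at *
  generalize len g (velocity a b γ t) = l at *
  have hden : (0 * 0 + 0 * 0 + l * l) * (x0 * x0 + x1 * x1 + x2 * x2)
      - (0 * x0 + 0 * x1 + l * x2) ^ 2 = l ^ 2 * (x0 ^ 2 + x1 ^ 2) := by ring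
  -- The normal acceleration is proportional to (ω₀₂, ω₁₂), so the tangential acceleration x2 drops
  -- out of the numerator.
  have hnum : x0 * q - x1 * p = 0 := by rw [a0, a1]; ring
  rw [hden]
  field_simp
  linear_combination (-x2 * l) * hnum

end CurveTorsion

/-! ### Angles of the end normals -/

section AngleComponents

variable (g : Metric3 M)

/-- Components of a unit vector in the plane of `A 0`, `A 1` with respect to a rotated frame. -/
lemma components_of_rotation {p q : M} {E : Fin 3 → TangentSpace (𝓡 3) p}
    {E' A : Fin 3 → TangentSpace (𝓡 3) q} {α u w : ℝ} (hA : IsRotation α E' A)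
    (hE' : IsOrthonormal g E') (hEE' : ∀ i, (⟨p, E i⟩ : TangentBundle (𝓡 3) M) = ⟨q, E' i⟩)
    {θ : Real.Angle} (h : (⟨p, u • E 0 + w • E 1⟩ : TangentBundle (𝓡 3) M)
      = ⟨q, θ.cos • A 0 + θ.sin • A 1⟩) :
    u = (θ + α).cos ∧ w = (θ + α).sin := by
  have hE := isOrthonormal_congr g hE' hEE'
  have h0 := inner_congr g h (hEE' 0)
  have h1 := inner_congr g h (hEE' 1)
  rw [hA.1, hA.2] at h0 h1
  simp only [map_add, map_smul, add_apply, smul_apply, smul_eq_mul, hE _ _, hE' _ _] at h0 h1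
  simp only [Fin.reduceEq, if_true, if_false, mul_one, mul_zero, add_zero, zero_add] at h0 h1
  constructor
  · rw [h0, Real.Angle.cos_add, Real.Angle.cos_coe, Real.Angle.sin_coe]; ring
  · rw [h1, Real.Angle.sin_add, Real.Angle.cos_coe, Real.Angle.sin_coe]; ring

lemma exists_angle {p : M} {A : Fin 3 → TangentSpace (𝓡 3) p} (hA : IsOrthonormal g A)
    {ν : TangentSpace (𝓡 3) p} (h1 : g.inner p ν ν = 1) (h2 : g.inner p ν (A 2) = 0) :
    ∃ θ : Real.Angle, ν = θ.cos • A 0 + θ.sin • A 1 := by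
  have e := hA.inner_eq g ν ν
  rw [h1, Fin.sum_univ_three, h2] at e
  obtain ⟨α, hc, hs⟩ := exists_cos_sin (p := g.inner p ν (A 0)) (q := g.inner p ν (A 1))
    (by linarith)
  refine ⟨α, ?_⟩
  have hν := hA.eq_sum g ν
  rw [Fin.sum_univ_three, h2, zero_smul, add_zero] at hν
  rw [Real.Angle.cos_coe, Real.Angle.sin_coe, hc, hs]
  exact hν

lemma inner_normalPart {a b t : ℝ} {γ : ℝ → M} (hv : velocity a b γ t ≠ 0)
    (w : TangentSpace (𝓡 3) (γ t)) :
    g.inner (γ t) (normalPart g a b γ t w) (unitTangent g a b γ t) = 0 := by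
  have h := inner_normalize g hv
  have h' : g.inner (γ t) (unitTangent g a b γ t) (unitTangent g a b γ t) = 1 := h
  rw [normalPart, map_sub, sub_apply, map_smul, smul_apply, h']
  simp

lemma exists_angle_principalNormal {a b t : ℝ} {γ : ℝ → M} (hv : velocity a b γ t ≠ 0)
    {f : Fin 3 → TangentSpace (𝓡 3) (γ t)}
    (h : cross g f (velocity a b γ t) (accel g a b γ t) ≠ 0)
    {A : Fin 3 → TangentSpace (𝓡 3) (γ t)} (hA : IsOrthonormal g A)
    (hA2 : A 2 = unitTangent g a b γ t) :
    ∃ θ : Real.Angle, principalNormal g a b γ t = θ.cos • A 0 + θ.sin • A 1 := by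
  refine exists_angle g hA (inner_normalize g (normalPart_accel_ne_zero h)) ?_
  rw [hA2, principalNormal, map_smul, smul_apply, inner_normalPart g hv, smul_zero]

/-- Fixing the principal normals at the endpoints fixes the angle between them. -/
lemma FixesPrincipalNormals.fixesNormalAngle {a b δ : ℝ} {γ : ℝ → M} (hab : a < b)
    (hv : ∀ t ∈ Icc a b, velocity a b γ t ≠ 0) {F : ∀ t, Fin 3 → TangentSpace (𝓡 3) (γ t)}
    (h : ∀ t ∈ Icc a b, cross g (F t) (velocity a b γ t) (accel g a b γ t) ≠ 0)
    {A : Fin 3 → TangentSpace (𝓡 3) (γ a)} (hA : IsOrthonormal g A)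
    (hA2 : A 2 = unitTangent g a b γ a)
    {B : Fin 3 → TangentSpace (𝓡 3) (γ b)} (hB : IsOrthonormal g B)
    (hB2 : B 2 = unitTangent g a b γ b) {X : ℝ → ℝ → M}
    (hX : FixesPrincipalNormals g a b γ δ X) : FixesNormalAngle g a b A B δ X := by
  have haI : a ∈ Icc a b := left_mem_Icc.2 hab.le
  have hbI : b ∈ Icc a b := right_mem_Icc.2 hab.le
  obtain ⟨α, hα⟩ := exists_angle_principalNormal g (hv a haI) (h a haI) hA hA2
  obtain ⟨β, hβ⟩ := exists_angle_principalNormal g (hv b hbI) (h b hbI) hB hB2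
  -- The angle is read off from the initial curve, whose principal normals are shared by the whole
  -- family.
  refine ⟨β - α, fun ε hε ↦ ⟨α, ?_, ?_⟩⟩
  · rw [(hX ε hε).1, hα]
  · rw [(hX ε hε).2, hβ, add_sub_cancel]

end AngleComponents

/-! ### Variation of the integral of torsion -/

section TorsionVariation

variable {g : Metric3 M} {δ a b : ℝ} {X : ℝ → ℝ → M}
  {E : ∀ z : ℝ × ℝ, Fin 3 → TangentSpace (𝓡 3) (X z.1 z.2)}

lemma contDiffOn_accel_comp (hδ : 0 < δ) (hab : a < b)
    (hE : IsAdaptedFrame g (fun z : ℝ × ℝ ↦ X z.1 z.2) (strip δ a b) (0, 1) E) (i : Fin 3) :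
    ContDiffOn ℝ ∞ (fun z : ℝ × ℝ ↦ g.inner (X z.1 z.2) (accel g a b (X z.1) z.2) (E z i))
      (strip δ a b) := by
  have hS := uniqueDiffOn_strip hδ hab
  refine ((smoothField_pcov g hS (smoothField_pvel hS hE.base (0, 1)) (0, 1)).inner g
    (hE.smooth i)).congr fun z hz ↦ ?_
  rw [accel_eq_strip g hδ hab hE.base hz.1 hz.2]

lemma smoothField_accel (hδ : 0 < δ) (hab : a < b)
    (hX : ContMDiffOn 𝓘(ℝ, ℝ × ℝ) (𝓡 3) ∞ (fun z : ℝ × ℝ ↦ X z.1 z.2) (strip δ a b)) {ε : ℝ}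
    (hε : ε ∈ Icc (-δ) δ) : SmoothField (X ε) (accel g a b (X ε)) (Icc a b) := by
  have hS := uniqueDiffOn_strip hδ hab
  have h1 := (smoothField_pcov g hS (smoothField_pvel hS hX (0, 1)) (0, 1)).comp
    (by fun_prop : ContDiffOn ℝ ∞ (fun s : ℝ ↦ (ε, s)) (Icc a b)) (mapsTo_inr hε)
  refine ContMDiffOn.congr h1 fun t ht ↦ ?_
  rw [accel_eq_strip g hδ hab hX hε ht]

/-- At a, both F and the adapted frame are positive relative to A. The determinant between them is
thus positive there, hence along the curve, and being ±1 it equals 1. The formula for the torsion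
needs this normalization on every curve of the variation. -/
lemma det3_eq_one_of_sameOrientation (hab : a < b)
    (hE : IsAdaptedFrame g (fun z : ℝ × ℝ ↦ X z.1 z.2) (strip δ a b) (0, 1) E)
    {p : M} {A EA : Fin 3 → TangentSpace (𝓡 3) p} (hA : IsOrthonormal g A) {α : ℝ}
    (hα : IsRotation α EA A) (hA2 : A 2 = EA 2) {ε : ℝ} (hε : ε ∈ Icc (-δ) δ)
    (ha : ∀ i, (⟨X ε a, E (ε, a) i⟩ : TangentBundle (𝓡 3) M) = ⟨p, EA i⟩)
    {F : ∀ t, Fin 3 → TangentSpace (𝓡 3) (X ε t)}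
    (hF : IsFrameAlong g a b (X ε) F) (hFA : SameOrientation (F a) A) {t : ℝ} (ht : t ∈ Icc a b) :
    det3 g (F t) (E (ε, t) 0) (E (ε, t) 1) (E (ε, t) 2) = 1 := by
  have haI : a ∈ Icc a b := left_mem_Icc.2 hab.le
  have hEs := hE.slice hab hε
  have hEf : IsFrameAlong g a b (X ε) (fun t ↦ E (ε, t)) :=
    ⟨fun i ↦ (hEs.smooth i).continuousOn, hEs.orthonormal⟩
  have ho := hEs.orthonormal a haI
  have h1 := det3_pos_of_sameOrientation g hFA hA
    (v' := ![Real.cos α • E (ε, a) 0 + Real.sin α • E (ε, a) 1,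
      (-Real.sin α) • E (ε, a) 0 + Real.cos α • E (ε, a) 1, E (ε, a) 2]) (by
      intro i
      fin_cases i
      · exact (mk_smul_add_smul (ha 0) (ha 1) _ _).trans (congrArg _ hα.1.symm)
      · exact (mk_smul_add_smul (ha 0) (ha 1) _ _).trans (congrArg _ hα.2.symm)
      · exact (ha 2).trans (congrArg _ hA2.symm))
  have h2 : det3 g (E (ε, a)) (Real.cos α • E (ε, a) 0 + Real.sin α • E (ε, a) 1)
      ((-Real.sin α) • E (ε, a) 0 + Real.cos α • E (ε, a) 1) (E (ε, a) 2) = 1 := by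
    rw [det3_eq]
    simp only [map_add, map_smul, smul_eq_mul, ho _ _]
    simp
    linarith [Real.sin_sq_add_cos_sq α]
  rw [det3_eq_det_mul g ho] at h1
  have h3 : 0 < det3 g (F a) (E (ε, a) 0) (E (ε, a) 1) (E (ε, a) 2) :=
    h1.trans_eq ((congrArg _ h2).trans (mul_one _))
  have h4 := det3_pos_of_continuousOn g hF hEf haI h3 ht
  have h5 := det3_mul_self g (hF.orthonormal t ht) (hEf.orthonormal t ht)
  nlinarith

/-- Under variations which fix the angle between the principal normals at the endpoints, the
integral of torsion varies like the integral of the connection form of an adapted frame. -/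
lemma hasDerivAt_torsionIntegral (hδ : 0 < δ) (hab : a < b)
    (hE : IsAdaptedFrame g (fun z : ℝ × ℝ ↦ X z.1 z.2) (strip δ a b) (0, 1) E)
    (ha : ∀ ε ∈ Icc (-δ) δ, ∀ i,
      (⟨X ε a, E (ε, a) i⟩ : TangentBundle (𝓡 3) M) = ⟨X 0 a, E (0, a) i⟩)
    (hb : ∀ ε ∈ Icc (-δ) δ, ∀ i,
      (⟨X ε b, E (ε, b) i⟩ : TangentBundle (𝓡 3) M) = ⟨X 0 b, E (0, b) i⟩)
    {A : Fin 3 → TangentSpace (𝓡 3) (X 0 a)} (hA : IsOrthonormal g A) (hA2 : A 2 = E (0, a) 2)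
    {B : Fin 3 → TangentSpace (𝓡 3) (X 0 b)}
    {α β : ℝ} (hα : IsRotation α (E (0, a)) A) (hβ : IsRotation β (E (0, b)) B)
    (hne : ∀ z ∈ strip δ a b, g.inner (X z.1 z.2) (accel g a b (X z.1) z.2) (E z 0) ^ 2
      + g.inner (X z.1 z.2) (accel g a b (X z.1) z.2) (E z 1) ^ 2 ≠ 0)
    {F : ∀ ε t, Fin 3 → TangentSpace (𝓡 3) (X ε t)}
    (hF : ∀ ε ∈ Icc (-δ) δ, IsFrameAlong g a b (X ε) (F ε) ∧ SameOrientation (F ε a) A)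
    {c : Real.Angle} (hc : ∀ ε ∈ Icc (-δ) δ, ∃ θ : Real.Angle,
      (⟨X ε a, principalNormal g a b (X ε) a⟩ : TangentBundle (𝓡 3) M)
        = ⟨X 0 a, θ.cos • A 0 + θ.sin • A 1⟩ ∧
      (⟨X ε b, principalNormal g a b (X ε) b⟩ : TangentBundle (𝓡 3) M)
        = ⟨X 0 b, (θ + c).cos • B 0 + (θ + c).sin • B 1⟩) {D : ℝ}
    (hD : HasDerivAt (fun ε ↦ ∫ t in a..b,
      frameConn g (fun z : ℝ × ℝ ↦ X z.1 z.2) (strip δ a b) (0, 1) E 0 1 (ε, t)) D 0) :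
    HasDerivAt (fun ε ↦ torsionIntegral g a b (X ε) (F ε)) D 0 := by
  have hS := uniqueDiffOn_strip hδ hab
  have hU : UniqueDiffOn ℝ (Icc a b) := uniqueDiffOn_Icc hab
  have haI : a ∈ Icc a b := left_mem_Icc.2 hab.le
  have hbI : b ∈ Icc a b := right_mem_Icc.2 hab.le
  have hz := zero_mem_Icc hδ
  have hcomp := contDiffOn_accel_comp hδ hab hE
  set k : Fin 3 → ℝ × ℝ → ℝ := fun i z ↦ g.inner (X z.1 z.2) (accel g a b (X z.1) z.2) (E z i)
    with hk
  set ρ : ℝ × ℝ → ℝ := fun z ↦ √(k 0 z ^ 2 + k 1 z ^ 2) with hρ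
  have hρs : ContDiffOn ℝ ∞ ρ (strip δ a b) := (((hcomp 0).pow 2).add ((hcomp 1).pow 2)).sqrt hne
  have hpos : ∀ z ∈ strip δ a b, 0 < k 0 z ^ 2 + k 1 z ^ 2 := fun z hz ↦
    lt_of_le_of_ne (by positivity) (hne z hz).symm
  have hρ0 : ∀ z ∈ strip δ a b, ρ z ≠ 0 := fun z hz ↦ (Real.sqrt_pos.2 (hpos z hz)).ne'
  have hρ2 : ∀ z ∈ strip δ a b, ρ z ^ 2 = k 0 z ^ 2 + k 1 z ^ 2 := fun z hz ↦
    Real.sq_sqrt (hpos z hz).le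
  set u : ℝ × ℝ → ℝ := fun z ↦ k 0 z / ρ z with hu
  set w : ℝ × ℝ → ℝ := fun z ↦ k 1 z / ρ z with hw
  have hus : ContDiffOn ℝ ∞ u (strip δ a b) := (hcomp 0).div hρs hρ0
  have hws : ContDiffOn ℝ ∞ w (strip δ a b) := (hcomp 1).div hρs hρ0
  -- The angular velocity of the principal normal u E₀ + w E₁ in the adapted frame.
  set h : ℝ × ℝ → ℝ := fun z ↦ u z * fderivWithin ℝ w (strip δ a b) z (0, 1)
    - w z * fderivWithin ℝ u (strip δ a b) z (0, 1) with hh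
  have hhs : ContDiffOn ℝ ∞ h (strip δ a b) :=
    (hus.mul (contDiffOn_fderivWithin_apply hws hδ hab _)).sub
      (hws.mul (contDiffOn_fderivWithin_apply hus hδ hab _))
  have hslice : ∀ f : ℝ × ℝ → ℝ, ContDiffOn ℝ ∞ f (strip δ a b) → ∀ ε ∈ Icc (-δ) δ,
      ContDiffOn ℝ ∞ (fun t ↦ f (ε, t)) (Icc a b) := fun f hf ε hε ↦
    hf.comp (by fun_prop : ContDiffOn ℝ ∞ (fun s : ℝ ↦ (ε, s)) (Icc a b)) (mapsTo_inr hε)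
  have hderiv : ∀ f : ℝ × ℝ → ℝ, ContDiffOn ℝ ∞ f (strip δ a b) → ∀ ε ∈ Icc (-δ) δ,
      ∀ t ∈ Icc a b, derivWithin (fun t ↦ f (ε, t)) (Icc a b) t =
        fderivWithin ℝ f (strip δ a b) (ε, t) (0, 1) := fun f hf ε hε t ht ↦
    (hasDerivWithinAt_snd hf hε ht).derivWithin (hU t ht)
  have hunit : ∀ z ∈ strip δ a b, u z ^ 2 + w z ^ 2 = 1 := by
    intro z hz
    have h0 := hρ0 z hz
    simp only [hu, hw]
    rw [div_pow, div_pow, ← add_div, ← hρ2 z hz, div_self (pow_ne_zero 2 h0)]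
  have hν : ∀ ε ∈ Icc (-δ) δ, ∀ t ∈ Icc a b, principalNormal g a b (X ε) t =
      u (ε, t) • E (ε, t) 0 + w (ε, t) • E (ε, t) 1 := fun ε hε t ht ↦
    (hE.slice hab hε).principalNormal_eq ht
  set Θ : ℝ → ℝ := fun ε ↦ ∫ t in a..b, h (ε, t) with hΘ
  have hangle : ∀ ε ∈ Icc (-δ) δ, (Θ ε : Real.Angle) = c + β - α := by
    intro ε hε
    obtain ⟨θ, h1, h2⟩ := hc ε hε
    rw [hν ε hε a haI] at h1
    rw [hν ε hε b hbI] at h2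
    obtain ⟨ua, wa⟩ := components_of_rotation g hα (hE.orthonormal (0, a) ⟨hz, haI⟩) (ha ε hε) h1
    obtain ⟨ub, wb⟩ := components_of_rotation g hβ (hE.orthonormal (0, b) ⟨hz, hbI⟩) (hb ε hε) h2
    obtain ⟨r1, r2⟩ := rotation_by_integral hab (hslice u hus ε hε) (hslice w hws ε hε)
      (fun t ht ↦ hunit (ε, t) ⟨hε, ht⟩) (Θ := Θ ε) (by
        refine intervalIntegral.integral_congr fun t ht ↦ ?_
        rw [uIcc_of_le hab.le] at ht
        rw [hderiv u hus ε hε t ht, hderiv w hws ε hε t ht])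
    -- The principal normal makes the angle θ + α with E₀ at a, and θ + c + β at b. The unknown θ,
    -- which may vary with ε, cancels in the difference.
    have h3 : θ + c + β = θ + α + Θ ε := by
      refine angle_ext ?_ ?_
      · rw [← ub, r1, ua, wa, Real.Angle.cos_add (θ + α), Real.Angle.cos_coe, Real.Angle.sin_coe]
      · rw [← wb, r2, ua, wa, Real.Angle.sin_add (θ + α), Real.Angle.cos_coe, Real.Angle.sin_coe]
        ring
    have h4 : (Θ ε : Real.Angle) = θ + c + β - (θ + α) := by rw [h3]; abel
    rw [h4]; abel
  -- The total turning is differentiable in ε and constant modulo 2π.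
  have hΘ' : HasDerivAt Θ 0 0 := by
    have h1 := hasDerivAt_integral_strip hhs hδ hab
    have h2 := deriv_eq_of_angle_eventuallyEq (f := Θ) h1 (hasDerivAt_const 0 (Θ 0)) (by
      filter_upwards [Icc_mem_nhds (neg_lt_zero.2 hδ) hδ] with ε hε
      rw [hangle ε hε, hangle 0 hz])
    rw [h2] at h1
    exact h1
  have hfin := hΘ'.add hD
  rw [zero_add] at hfin
  refine hfin.congr_of_eventuallyEq ?_
  filter_upwards [Icc_mem_nhds (neg_lt_zero.2 hδ) hδ] with ε hε
  have hint : ∀ f : ℝ × ℝ → ℝ, ContDiffOn ℝ ∞ f (strip δ a b) →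
      IntervalIntegrable (fun t ↦ f (ε, t)) volume a b := by
    intro f hf
    refine ContinuousOn.intervalIntegrable ?_
    rw [uIcc_of_le hab.le]
    exact continuousOn_slice hf.continuousOn hε
  rw [Pi.add_apply, hΘ, torsionIntegral]
  beta_reduce
  rw [← intervalIntegral.integral_add (hint h hhs)
    (hint _ (contDiffOn_frameConn g hS hE.smooth (0, 1) 0 1))]
  refine intervalIntegral.integral_congr fun t ht ↦ ?_
  rw [uIcc_of_le hab.le] at ht
  have hzt : (ε, t) ∈ strip δ a b := ⟨hε, ht⟩
  rw [torsion_mul_len hab (hE.slice hab hε) (hF ε hε).1 ht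
    (det3_eq_one_of_sameOrientation hab hE hA hα hA2 hε (ha ε hε) (hF ε hε).1 (hF ε hε).2 ht)
    (smoothField_accel hδ hab hE.base hε) (hne _ hzt), frameConn_slice hδ hab hE hε ht]
  congr 1
  -- The angular velocity is unchanged by normalization: in u w' - w u' the derivative of ρ cancels,
  -- leaving (k₀ k₁' - k₁ k₀')/ρ².
  have d0 := ((hslice _ (hcomp 0) ε hε).differentiableOn (by simp) t ht).hasDerivWithinAt
  have d1 := ((hslice _ (hcomp 1) ε hε).differentiableOn (by simp) t ht).hasDerivWithinAt
  have dρ := ((hslice _ hρs ε hε).differentiableOn (by simp) t ht).hasDerivWithinAt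
  have hr := hρ0 _ hzt
  have hr2 := hρ2 _ hzt
  have du : derivWithin (fun t ↦ u (ε, t)) (Icc a b) t = _ :=
    (d0.div dρ hr).derivWithin (hU t ht)
  have dw : derivWithin (fun t ↦ w (ε, t)) (Icc a b) t = _ :=
    (d1.div dρ hr).derivWithin (hU t ht)
  simp only [hh]
  rw [← hderiv u hus ε hε t ht, ← hderiv w hws ε hε t ht, du, dw]
  simp only [hu, hw]
  change (k 0 (ε, t) * derivWithin (fun t ↦ k 1 (ε, t)) (Icc a b) t
    - k 1 (ε, t) * derivWithin (fun t ↦ k 0 (ε, t)) (Icc a b) t)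
      / (k 0 (ε, t) ^ 2 + k 1 (ε, t) ^ 2) = _
  rw [← hr2]
  generalize derivWithin (fun t ↦ k 0 (ε, t)) (Icc a b) t = x0
  generalize derivWithin (fun t ↦ k 1 (ε, t)) (Icc a b) t = x1
  generalize derivWithin (fun t ↦ ρ (ε, t)) (Icc a b) t = x2
  field_simp
  ring

end TorsionVariation

/-! ### Continuity of the conformal geodesic equation -/

section DefectContinuity

variable {g : Metric3 M}

lemma contDiffWithinAt_curv4 {P : Type*} [NormedAddCommGroup P] [NormedSpace ℝ P] {X : P → M}
    {S : Set P} {z : P} (hz : z ∈ S) {U V W Z : ∀ z, TangentSpace (𝓡 3) (X z)}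
    (hU : SmoothFieldAt X U S z) (hV : SmoothFieldAt X V S z) (hW : SmoothFieldAt X W S z)
    (hZ : SmoothFieldAt X Z S z) :
    ContDiffWithinAt ℝ ∞ (fun w ↦ curv4 g (X w) (U w) (V w) (W w) (Z w)) S z := by
  have hs := mem_source_self (X z)
  have ht := (isOpen_extChartAt_target (I := 𝓡 3) (X z)).mem_nhds (mem_extChartAt_target (X z))
  have hX := hU.base
  have hy := contDiffWithinAt_extChartAt hX hs
  have hu := hU.contDiffWithinAt hz hs
  have hv := hV.contDiffWithinAt hz hs
  have hw := hW.contDiffWithinAt hz hs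
  have hz' := hZ.contDiffWithinAt hz hs
  have hΓ0 := (contDiffOn_chartChristoffel g (X z)).contDiffAt ht
  have hΓ : ContDiffWithinAt ℝ ∞ (fun w ↦ chartChristoffel g (X z) (extChartAt (𝓡 3) (X z) (X w))) S z :=
    ContDiffAt.comp_contDiffWithinAt (g := chartChristoffel g (X z)) z hΓ0 hy
  have hΓ' : ContDiffWithinAt ℝ ∞
      (fun w ↦ fderiv ℝ (chartChristoffel g (X z)) (extChartAt (𝓡 3) (X z) (X w))) S z :=
    ContDiffAt.comp_contDiffWithinAt (g := fderiv ℝ (chartChristoffel g (X z))) z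
      (contDiffAt_fderiv hΓ0) hy
  have hG : ContDiffWithinAt ℝ ∞ (fun w ↦ chartMetric g (X z) (extChartAt (𝓡 3) (X z) (X w))) S z :=
    ContDiffAt.comp_contDiffWithinAt (g := chartMetric g (X z)) z
      ((contDiffOn_chartMetric g (X z)).contDiffAt ht) hy
  have hR : ContDiffWithinAt ℝ ∞ (fun w ↦ chartCurvature g (X z) (extChartAt (𝓡 3) (X z) (X w))
      (toCoord (X z) (X w) (U w)) (toCoord (X z) (X w) (V w)) (toCoord (X z) (X w) (W w))) S z :=
    (((((hΓ'.clm_apply hu).clm_apply hv).clm_apply hw).sub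
      (((hΓ'.clm_apply hv).clm_apply hu).clm_apply hw)).add
      ((hΓ.clm_apply hu).clm_apply ((hΓ.clm_apply hv).clm_apply hw))).sub
      ((hΓ.clm_apply hv).clm_apply ((hΓ.clm_apply hu).clm_apply hw))
  refine ((hG.clm_apply hR).clm_apply hz').congr_of_eventuallyEq_of_mem ?_ hz
  filter_upwards [eventually_mem_source hX.continuousWithinAt hs] with w hw
  exact curv4_eq_chart g hw _ _ _ _

variable {a b : ℝ} {γ : ℝ → M} {E : ∀ t, Fin 3 → TangentSpace (𝓡 3) (γ t)}

lemma geodesicDefect_eq_pcov (hab : a < b) (hγ : ContMDiffOn 𝓘(ℝ, ℝ) (𝓡 3) ∞ γ (Icc a b)) {t : ℝ}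
    (ht : t ∈ Icc a b) : geodesicDefect g a b γ t =
      pcov g γ (Icc a b) 1 (pcov g γ (Icc a b) 1 (pvel γ (Icc a b) 1)) t
      - (3 * g.inner (γ t) (pvel γ (Icc a b) 1 t) (pcov g γ (Icc a b) 1 (pvel γ (Icc a b) 1) t)
        / (len g (pvel γ (Icc a b) 1 t)) ^ 2) • pcov g γ (Icc a b) 1 (pvel γ (Icc a b) 1) t
      - (len g (pvel γ (Icc a b) 1 t)) ^ 2 • schoutenOp g (γ t) (pvel γ (Icc a b) 1 t) := by
  have hu : UniqueDiffOn ℝ (Icc a b) := uniqueDiffOn_Icc hab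
  have hv := smoothField_pvel hu hγ 1
  have ha : ∀ s ∈ Icc a b, accel g a b γ s = pcov g γ (Icc a b) 1 (pvel γ (Icc a b) 1) s :=
    fun s hs ↦ covDeriv_eq_pcov g hab hs (hv s hs)
  have hs : SmoothField γ (accel g a b γ) (Icc a b) :=
    ContMDiffOn.congr (smoothField_pcov g hu hv 1) fun s hs ↦ by rw [ha s hs]
  have hj : jerk g a b γ t = pcov g γ (Icc a b) 1 (accel g a b γ) t :=
    covDeriv_eq_pcov g hab ht (hs t ht)
  rw [geodesicDefect, hj, pcov_congr g ha ht, ha t ht]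
  rfl

/-- The Schouten endomorphism is defined through the chart around the moving point, so its
continuity is not visible. Its off-diagonal component in the frame is a curvature component, which
is chart-independent and smooth. -/
lemma continuousOn_geodesicDefect (hab : a < b) (hE : IsAdaptedFrame g γ (Icc a b) 1 E) {i : Fin 3}
    (hi : i ≠ 2) :
    ContinuousOn (fun t ↦ g.inner (γ t) (geodesicDefect g a b γ t) (E t i)) (Icc a b) := by
  have hu : UniqueDiffOn ℝ (Icc a b) := uniqueDiffOn_Icc hab
  obtain ⟨j, hj, hij⟩ : ∃ j : Fin 3, j ≠ 2 ∧ i ≠ j := by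
    fin_cases i
    · exact ⟨1, by decide, by decide⟩
    · exact ⟨0, by decide, by decide⟩
    · exact absurd rfl hi
  have hP : ∀ t ∈ Icc a b, g.inner (γ t) (schoutenOp g (γ t) (E t 2)) (E t i) =
      curv4 g (γ t) (E t j) (E t 2) (E t i) (E t j) := by
    intro t ht
    have ho : IsOrthonormal g ![E t i, E t j, E t 2] := by
      have h2 := hE.orthonormal t ht
      intro k l
      fin_cases k <;> fin_cases l <;> simp [h2 _ _, hi, hj, hij, hi.symm, hj.symm, hij.symm]
    exact inner_schoutenOp_of_ne g ho
  have hc := contDiffOn_frameConn g hu hE.smooth (1 : ℝ)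
  have hl := hE.contDiffOn_speed hu
  have hd : ∀ f : ℝ → ℝ, ContDiffOn ℝ ∞ f (Icc a b) →
      ContinuousOn (fun t ↦ fderivWithin ℝ f (Icc a b) t 1) (Icc a b) := fun f hf ↦
    hf.continuousOn_derivWithin hu (by simp)
  have hR : ContinuousOn (fun t ↦ curv4 g (γ t) (E t j) (E t 2) (E t i) (E t j)) (Icc a b) :=
    fun t ht ↦ (contDiffWithinAt_curv4 ht (hE.smooth j t ht) (hE.smooth 2 t ht) (hE.smooth i t ht)
      (hE.smooth j t ht)).continuousWithinAt
  have key : ContinuousOn (fun t ↦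
      -(len g (pvel γ (Icc a b) 1 t) * fderivWithin ℝ (frameConn g γ (Icc a b) 1 E i 2) (Icc a b) t 1)
      + fderivWithin ℝ (fun z ↦ len g (pvel γ (Icc a b) 1 z)) (Icc a b) t 1
        * frameConn g γ (Icc a b) 1 E i 2 t
      + len g (pvel γ (Icc a b) 1 t) * frameConn g γ (Icc a b) 1 E j 2 t
        * frameConn g γ (Icc a b) 1 E i j t
      - len g (pvel γ (Icc a b) 1 t) ^ 3 * curv4 g (γ t) (E t j) (E t 2) (E t i) (E t j))
      (Icc a b) :=
    ((((hl.continuousOn.mul (hd _ (hc i 2))).neg).add ((hd _ hl).mul (hc i 2).continuousOn)).add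
      ((hl.continuousOn.mul (hc j 2).continuousOn).mul (hc i j).continuousOn)).sub
      ((hl.continuousOn.pow 3).mul hR)
  refine key.congr fun t ht ↦ ?_
  beta_reduce
  rw [geodesicDefect_eq_pcov hab hE.base ht, hE.geodesic_comp hu ht hi hj hij, hP t ht]

end DefectContinuity

/-! ### Locality of the differential invariants of curves -/

section Locality

variable {g : Metric3 M} {a b : ℝ} {γ γ' : ℝ → M} {t : ℝ}

-- All tangent spaces are the same type `E3` by definition, so vectors at propositionally equal
-- points can be compared there.
omit [IsManifold (𝓡 3) ∞ M] in
lemma mk_eq_of_eq {p q : M} {u : TangentSpace (𝓡 3) p} {v : TangentSpace (𝓡 3) q} (h : p = q)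
    (h' : @Eq E3 u v) : (⟨p, u⟩ : TangentBundle (𝓡 3) M) = ⟨q, v⟩ := by
  subst h
  exact congrArg _ h'

omit [IsManifold (𝓡 3) ∞ M] in
lemma velocity_congr (ht : t ∈ Icc a b) (h : γ =ᶠ[𝓝[Icc a b] t] γ') :
    (⟨γ t, velocity a b γ t⟩ : TangentBundle (𝓡 3) M) = ⟨γ' t, velocity a b γ' t⟩ := by
  have h0 := h.self_of_nhdsWithin ht
  refine mk_eq_of_eq h0 ?_
  have h1 := h.mfderivWithin_eq (I := 𝓘(ℝ, ℝ)) (I' := 𝓡 3) h0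
  exact DFunLike.congr_fun (F := ℝ →L[ℝ] E3) h1 1

/-- The covariant derivative in terms of coordinate data at a point. -/
def covDerivFormula (g : Metric3 M) (p : M) (d v w : E3) : TangentBundle (𝓡 3) M :=
  ⟨p, ∑ k, (d k + ∑ i, ∑ j, christoffel g p k i j (extChartAt (𝓡 3) p p) * v i * w j)
    • coordVec p p k⟩

lemma covDeriv_congr (ht : t ∈ Icc a b) (h : γ =ᶠ[𝓝[Icc a b] t] γ')
    {V : ∀ t, TangentSpace (𝓡 3) (γ t)} {V' : ∀ t, TangentSpace (𝓡 3) (γ' t)}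
    (hV : ∀ᶠ s in 𝓝[Icc a b] t, (⟨γ s, V s⟩ : TangentBundle (𝓡 3) M) = ⟨γ' s, V' s⟩) :
    (⟨γ t, covDeriv g a b γ V t⟩ : TangentBundle (𝓡 3) M) = ⟨γ' t, covDeriv g a b γ' V' t⟩ := by
  have h0 : γ t = γ' t := h.self_of_nhdsWithin ht
  have hVt := hV.self_of_nhdsWithin ht
  have hvt := velocity_congr ht h
  have e1 : ∀ k, derivWithin (fun s ↦ toCoord (γ t) (γ s) (V s) k) (Icc a b) t =
      derivWithin (fun s ↦ toCoord (γ' t) (γ' s) (V' s) k) (Icc a b) t := by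
    intro k
    have he : (fun s ↦ toCoord (γ t) (γ s) (V s) k) =ᶠ[𝓝[Icc a b] t]
        fun s ↦ toCoord (γ' t) (γ' s) (V' s) k := by
      filter_upwards [hV] with s hs
      rw [h0, toCoord_congr hs]
    exact he.derivWithin_eq (he.self_of_nhdsWithin ht)
  have e2 : toCoord (γ t) (γ t) (velocity a b γ t) = toCoord (γ' t) (γ' t) (velocity a b γ' t) :=
    (congrArg (fun c ↦ toCoord c (γ t) (velocity a b γ t)) h0).trans (toCoord_congr hvt _)
  have e3 : toCoord (γ t) (γ t) (V t) = toCoord (γ' t) (γ' t) (V' t) :=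
    (congrArg (fun c ↦ toCoord c (γ t) (V t)) h0).trans (toCoord_congr hVt _)
  -- Written as a function of the base point and of coordinate data in a fixed space, the derivative
  -- can be rewritten along γ t = γ' t without dependent-type obstructions.
  change covDerivFormula g (γ t) (WithLp.toLp 2 fun k ↦
      derivWithin (fun s ↦ toCoord (γ t) (γ s) (V s) k) (Icc a b) t)
      (toCoord (γ t) (γ t) (velocity a b γ t)) (toCoord (γ t) (γ t) (V t)) =
    covDerivFormula g (γ' t) (WithLp.toLp 2 fun k ↦
      derivWithin (fun s ↦ toCoord (γ' t) (γ' s) (V' s) k) (Icc a b) t)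
      (toCoord (γ' t) (γ' t) (velocity a b γ' t)) (toCoord (γ' t) (γ' t) (V' t))
  simp only [e1, e2, e3]
  rw [h0]

lemma accel_congr (ht : t ∈ Icc a b) (h : γ =ᶠ[𝓝[Icc a b] t] γ') :
    (⟨γ t, accel g a b γ t⟩ : TangentBundle (𝓡 3) M) = ⟨γ' t, accel g a b γ' t⟩ := by
  refine covDeriv_congr ht h ?_
  filter_upwards [eventually_eventually_nhdsWithin.2 h, self_mem_nhdsWithin] with s hs hs'
  exact velocity_congr hs' hs

lemma unitTangent_congr (ht : t ∈ Icc a b) (h : γ =ᶠ[𝓝[Icc a b] t] γ') :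
    (⟨γ t, unitTangent g a b γ t⟩ : TangentBundle (𝓡 3) M) = ⟨γ' t, unitTangent g a b γ' t⟩ :=
  congrArg (fun w : TangentBundle (𝓡 3) M ↦
    (⟨w.1, (len g w.2)⁻¹ • w.2⟩ : TangentBundle (𝓡 3) M)) (velocity_congr ht h)

lemma principalNormal_congr (ht : t ∈ Icc a b) (h : γ =ᶠ[𝓝[Icc a b] t] γ') :
    (⟨γ t, principalNormal g a b γ t⟩ : TangentBundle (𝓡 3) M)
      = ⟨γ' t, principalNormal g a b γ' t⟩ := by
  have key : ∀ {p q : M} {u v : TangentSpace (𝓡 3) p} {u' v' : TangentSpace (𝓡 3) q},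
      (⟨p, u⟩ : TangentBundle (𝓡 3) M) = ⟨q, u'⟩ → (⟨p, v⟩ : TangentBundle (𝓡 3) M) = ⟨q, v'⟩ →
      (⟨p, (len g (v - g.inner p v u • u))⁻¹ • (v - g.inner p v u • u)⟩ : TangentBundle (𝓡 3) M) =
        ⟨q, (len g (v' - g.inner q v' u' • u'))⁻¹ • (v' - g.inner q v' u' • u')⟩ := by
    intro p q u v u' v' h1 h2
    obtain rfl := base_congr h1
    have h3 : u = u' := by simpa using h1
    have h4 : v = v' := by simpa using h2
    rw [h3, h4]
  exact key (unitTangent_congr ht h) (accel_congr ht h)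

end Locality

/-! ### Localized variations -/

section BumpVariation

open Classical in
/-- The variation of `x` which moves `x t` by `ε φ(t) w` in the chart around `c`. -/
def bumpVariation (x : ℝ → M) (c : M) (φ : ℝ → ℝ) (w : E3) (ε t : ℝ) : M :=
  if t ∈ tsupport φ then (extChartAt (𝓡 3) c).symm (extChartAt (𝓡 3) c (x t) + (ε * φ t) • w)
  else x t

variable {a b : ℝ} {x : ℝ → M} {c : M} {φ : ℝ → ℝ} {w : E3}

omit [IsManifold (𝓡 3) ∞ M] in
lemma bumpVariation_of_notMem {t : ℝ} (ht : t ∉ tsupport φ) (ε : ℝ) :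
    bumpVariation x c φ w ε t = x t := if_neg ht

omit [IsManifold (𝓡 3) ∞ M] in
lemma bumpVariation_of_mem_source {t : ℝ} (ht : x t ∈ (extChartAt (𝓡 3) c).source) (ε : ℝ) :
    bumpVariation x c φ w ε t =
      (extChartAt (𝓡 3) c).symm (extChartAt (𝓡 3) c (x t) + (ε * φ t) • w) := by
  by_cases h : t ∈ tsupport φ
  · exact if_pos h
  · rw [bumpVariation_of_notMem h, image_eq_zero_of_notMem_tsupport h, mul_zero, zero_smul, add_zero,
      (extChartAt (𝓡 3) c).left_inv ht]

variable (hsrc : ∀ t ∈ tsupport φ, x t ∈ (extChartAt (𝓡 3) c).source)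
include hsrc

omit [IsManifold (𝓡 3) ∞ M] in
lemma bumpVariation_zero : bumpVariation x c φ w 0 = x := by
  ext1 t
  by_cases h : t ∈ tsupport φ
  · rw [bumpVariation_of_mem_source (hsrc t h), zero_mul, zero_smul, add_zero,
      (extChartAt (𝓡 3) c).left_inv (hsrc t h)]
  · exact bumpVariation_of_notMem h 0

variable (hφ : ContDiff ℝ ∞ φ) (hx : ContMDiffOn 𝓘(ℝ, ℝ) (𝓡 3) ∞ x (Icc a b))
include hφ hx

omit [IsManifold (𝓡 3) ∞ M] in
lemma eventually_bump_mem_target (w : E3) : ∃ δ, 0 < δ ∧ ∀ z ∈ strip δ a b, z.2 ∈ tsupport φ →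
    extChartAt (𝓡 3) c (x z.2) + (z.1 * φ z.2) • w ∈ (extChartAt (𝓡 3) c).target := by
  have h : ∀ t ∈ Icc a b, ∀ᶠ z in 𝓝[strip 1 a b] ((0 : ℝ), t), z.2 ∈ tsupport φ →
      extChartAt (𝓡 3) c (x z.2) + (z.1 * φ z.2) • w ∈ (extChartAt (𝓡 3) c).target := by
    intro t ht
    by_cases htφ : t ∈ tsupport φ
    · have hs := hsrc t htφ
      have h1 : ContinuousWithinAt (fun z : ℝ × ℝ ↦ x z.2) (strip 1 a b) (0, t) :=
        (hx.continuousOn t ht).comp (t := Icc a b) continuousWithinAt_snd (fun z hz ↦ hz.2)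
      have h2 : ContinuousWithinAt (fun z : ℝ × ℝ ↦ extChartAt (𝓡 3) c (x z.2)
          + (z.1 * φ z.2) • w) (strip 1 a b) (0, t) := by
        refine ((continuousAt_extChartAt' hs).comp_continuousWithinAt (x := ((0 : ℝ), t)) h1).add ?_
        have := hφ.continuous
        fun_prop
      have h3 := h2.eventually_mem (s := (extChartAt (𝓡 3) c).target)
        ((isOpen_extChartAt_target (I := 𝓡 3) c).mem_nhds (by
          simpa using (extChartAt (𝓡 3) c).map_source hs))
      filter_upwards [h3] with z hz _ using hz
    · have h1 : ∀ᶠ z : ℝ × ℝ in 𝓝 (0, t), z.2 ∉ tsupport φ :=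
        (continuous_snd.continuousAt (x := ((0 : ℝ), t))).eventually_mem
          ((isClosed_tsupport φ).isOpen_compl.mem_nhds htφ)
      filter_upwards [nhdsWithin_le_nhds h1] with z hz hz' using absurd hz' hz
  obtain ⟨δ, h1, -, h2⟩ := exists_strip_of_eventually one_pos h
  exact ⟨δ, h1, h2⟩

lemma contMDiffOn_bumpVariation {δ : ℝ} (hδ : ∀ z ∈ strip δ a b, z.2 ∈ tsupport φ →
    extChartAt (𝓡 3) c (x z.2) + (z.1 * φ z.2) • w ∈ (extChartAt (𝓡 3) c).target) :
    ContMDiffOn 𝓘(ℝ, ℝ × ℝ) (𝓡 3) ∞ (fun z : ℝ × ℝ ↦ bumpVariation x c φ w z.1 z.2)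
      (strip δ a b) := by
  have hx' : ContMDiffOn 𝓘(ℝ, ℝ × ℝ) (𝓡 3) ∞ (fun z : ℝ × ℝ ↦ x z.2) (strip δ a b) := by
    have h1 : ContMDiffOn 𝓘(ℝ, ℝ × ℝ) 𝓘(ℝ, ℝ) ∞ (fun z : ℝ × ℝ ↦ z.2) (strip δ a b) :=
      contDiff_snd.contDiffOn.contMDiffOn
    exact hx.comp h1 fun z hz ↦ hz.2
  intro z hz
  by_cases hzφ : z.2 ∈ tsupport φ
  · have hs := hsrc z.2 hzφ
    have h1 : ContDiffWithinAt ℝ ∞ (fun z : ℝ × ℝ ↦ extChartAt (𝓡 3) c (x z.2)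
        + (z.1 * φ z.2) • w) (strip δ a b) z := by
      refine (contDiffWithinAt_extChartAt (hx' z hz) hs).add ?_
      have h2 : ContDiff ℝ ∞ fun z : ℝ × ℝ ↦ (z.1 * φ z.2) • w :=
        (contDiff_fst.mul (hφ.comp contDiff_snd)).smul contDiff_const
      exact h2.contDiffAt.contDiffWithinAt
    have h3 : ContMDiffAt 𝓘(ℝ, E3) (𝓡 3) ∞ (extChartAt (𝓡 3) c).symm
        (extChartAt (𝓡 3) c (x z.2) + (z.1 * φ z.2) • w) :=
      (contMDiffOn_extChartAt_symm c).contMDiffAt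
        ((isOpen_extChartAt_target c).mem_nhds (hδ z hz hzφ))
    refine (h3.comp_contMDiffWithinAt z h1.contMDiffWithinAt).congr_of_eventuallyEq ?_
      (bumpVariation_of_mem_source hs _)
    filter_upwards [eventually_mem_source (hx' z hz).continuousWithinAt hs] with z' hz'
    exact bumpVariation_of_mem_source hz' _
  · refine (hx' z hz).congr_of_eventuallyEq ?_ (bumpVariation_of_notMem hzφ _)
    have h1 : ∀ᶠ z' : ℝ × ℝ in 𝓝 z, z'.2 ∉ tsupport φ :=
      (continuous_snd.continuousAt (x := z)).eventually_mem
        ((isClosed_tsupport φ).isOpen_compl.mem_nhds hzφ)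
    filter_upwards [nhdsWithin_le_nhds h1] with z' hz' using bumpVariation_of_notMem hz' _

lemma pvel_bumpVariation {δ : ℝ} (hδ0 : 0 < δ) (hδ : ∀ z ∈ strip δ a b, z.2 ∈ tsupport φ →
    extChartAt (𝓡 3) c (x z.2) + (z.1 * φ z.2) • w ∈ (extChartAt (𝓡 3) c).target) {t : ℝ}
    (ht : t ∈ Icc a b) :
    pvel (fun z : ℝ × ℝ ↦ bumpVariation x c φ w z.1 z.2) (strip δ a b) (1, 0) (0, t) =
      φ t • fromCoord c (bumpVariation x c φ w 0 t) w := by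
  have hX := contMDiffOn_bumpVariation hsrc hφ hx hδ
  set X := bumpVariation x c φ w with hXdef
  by_cases htφ : t ∈ tsupport φ
  · have hs := hsrc t htφ
    have hs0 : X 0 t ∈ (extChartAt (𝓡 3) c).source := by
      rw [hXdef, bumpVariation_zero hsrc]; exact hs
    have hu : UniqueDiffOn ℝ (Icc (-δ) δ) := uniqueDiffOn_Icc (by linarith)
    have h1 := pvel_comp (X := fun z : ℝ × ℝ ↦ X z.1 z.2) (S := strip δ a b)
      (hasFDerivWithinAt_inl 0 t (Icc (-δ) δ)) (hu 0 (zero_mem_Icc hδ0)) (mapsTo_inl ht)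
      (hX (0, t) ⟨zero_mem_Icc hδ0, ht⟩) 1
    rw [ContinuousLinearMap.inl_apply] at h1
    have hX' : ContMDiffWithinAt 𝓘(ℝ, ℝ) (𝓡 3) ∞ (fun s ↦ X s t) (Icc (-δ) δ) 0 := by
      have h2 : ContMDiffOn 𝓘(ℝ, ℝ) 𝓘(ℝ, ℝ × ℝ) ∞ (fun s : ℝ ↦ (s, t)) (Icc (-δ) δ) :=
        ContDiffOn.contMDiffOn (by fun_prop)
      exact hX.comp h2 (mapsTo_inl ht) 0 (zero_mem_Icc hδ0)
    apply toCoord_injective hs0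
    have h2 := toCoord_pvel (X := fun s ↦ X s t) hX' (hu 0 (zero_mem_Icc hδ0)) hs0 1
    have h3 : ∀ s ∈ Icc (-δ) δ, extChartAt (𝓡 3) c (X s t) =
        extChartAt (𝓡 3) c (x t) + (s * φ t) • w := by
      intro s hs'
      rw [hXdef, bumpVariation_of_mem_source hs, (extChartAt (𝓡 3) c).right_inv
        (hδ (s, t) ⟨hs', ht⟩ htφ)]
    have h4 : HasDerivWithinAt (fun s : ℝ ↦ extChartAt (𝓡 3) c (x t) + (s * φ t) • w)
        ((1 * φ t) • w) (Icc (-δ) δ) 0 :=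
      (((hasDerivWithinAt_id 0 _).mul_const (φ t)).smul_const w).const_add _
    rw [fderivWithin_congr (fun s hs ↦ h3 s hs) (h3 0 (zero_mem_Icc hδ0))] at h2
    have h5 : fderivWithin ℝ (fun s : ℝ ↦ extChartAt (𝓡 3) c (x t) + (s * φ t) • w)
        (Icc (-δ) δ) 0 1 = (1 * φ t) • w := h4.derivWithin (hu 0 (zero_mem_Icc hδ0))
    rw [h5, one_mul] at h2
    rw [map_smul, toCoord_fromCoord hs0, ← h2]
    exact congrArg _ h1.symm
  · rw [pvel_fst_eq_zero hδ0 hX ht fun ε _ ↦ by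
      rw [hXdef, bumpVariation_of_notMem htφ, bumpVariation_of_notMem htφ],
      image_eq_zero_of_notMem_tsupport htφ, zero_smul]

end BumpVariation

/-- Near an interior point of a regular curve there are variations in every direction, supported
near this point. -/
lemma exists_local_variation (g : Metric3 M) {a b : ℝ} (hab : a < b) {x : ℝ → M}
    (hx : IsRegularCurve a b x) {t₀ : ℝ} (ht₀ : t₀ ∈ Ioo a b) {U : Set ℝ} (hU : U ∈ 𝓝 t₀) (w : E3) :
    ∃ (φ : ℝ → ℝ) (δ : ℝ) (X : ℝ → ℝ → M), ContDiff ℝ ∞ φ ∧ (∀ t, 0 ≤ φ t) ∧ φ t₀ = 1 ∧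
      tsupport φ ⊆ U ∧ (∀ t ∈ tsupport φ, x t ∈ (extChartAt (𝓡 3) (x t₀)).source) ∧
      IsVariation g a b x δ X ∧ FixesPrincipalNormals g a b x δ X ∧
      ∀ δ', 0 < δ' → δ' < δ → ∀ t ∈ Icc a b,
        pvel (fun z : ℝ × ℝ ↦ X z.1 z.2) (strip δ' a b) (1, 0) (0, t) =
          φ t • fromCoord (x t₀) (X 0 t) w := by
  have hI : Icc a b ∈ 𝓝 t₀ := Icc_mem_nhds ht₀.1 ht₀.2
  have hs : ∀ᶠ t in 𝓝 t₀, x t ∈ (extChartAt (𝓡 3) (x t₀)).source := by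
    have hc : ContinuousAt x t₀ := hx.smooth.continuousOn.continuousAt hI
    exact hc.eventually_mem ((isOpen_extChartAt_source (x t₀)).mem_nhds (mem_source_self _))
  obtain ⟨r, hr, hball⟩ := Metric.eventually_nhds_iff_ball.1
    ((hs.and hU).and (Ioo_mem_nhds ht₀.1 ht₀.2))
  -- The outer radius r / 2 keeps the closed support inside the ball of radius r, where all
  -- conditions hold.
  set B : ContDiffBump t₀ := ⟨r / 4, r / 2, by positivity, by linarith⟩ with hB
  have hsupp : tsupport B ⊆ Metric.ball t₀ r := by
    rw [B.tsupport_eq]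
    exact Metric.closedBall_subset_ball (by simp only [hB]; linarith)
  have hsrc : ∀ t ∈ tsupport B, x t ∈ (extChartAt (𝓡 3) (x t₀)).source := fun t ht ↦
    (hball t (hsupp ht)).1.1
  have hφ : ContDiff ℝ ∞ (B : ℝ → ℝ) := B.contDiff
  obtain ⟨δ₁, hδ₁, htar⟩ := eventually_bump_mem_target hsrc hφ hx.smooth w
  have hX := contMDiffOn_bumpVariation hsrc hφ hx.smooth htar
  have hX0 := bumpVariation_zero (w := w) hsrc
  set X := bumpVariation x (x t₀) B w with hXdef
  have hvel0 : ∀ t ∈ Icc a b, velocity a b (X 0) t ≠ 0 := by rw [hX0]; exact hx.velocity_ne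
  have hpv := smoothField_pvel (uniqueDiffOn_strip hδ₁ hab) hX (0, 1)
  obtain ⟨δ, hδ, hδδ₁, hne⟩ := exists_strip_ne_zero hδ₁ (hpv.inner g hpv).continuousOn fun t ht ↦ by
    rw [← velocity_eq_strip hab hX (zero_mem_Icc hδ₁) ht]
    exact (inner_self_pos g (hvel0 t ht)).ne'
  -- The support lies inside (a, b), so the curves agree with x near the ends and have the same unit
  -- tangents and principal normals there.
  have hgerm : ∀ ε, ∀ t, t ∉ Ioo a b → X ε =ᶠ[𝓝[Icc a b] t] x := by
    intro ε t ht
    have h1 : t ∉ tsupport B := fun h ↦ ht (hball t (hsupp h)).2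
    filter_upwards [nhdsWithin_le_nhds ((isClosed_tsupport B).isOpen_compl.mem_nhds h1)] with s hs
    exact bumpVariation_of_notMem hs ε
  have haI : a ∈ Icc a b := left_mem_Icc.2 hab.le
  have hbI : b ∈ Icc a b := right_mem_Icc.2 hab.le
  have ha' : a ∉ Ioo a b := fun h ↦ lt_irrefl _ h.1
  have hb' : b ∉ Ioo a b := fun h ↦ lt_irrefl _ h.2
  have hsub : ∀ {ε}, ε ∈ Ioo (-δ) δ → ε ∈ Icc (-δ) δ := fun h ↦ Ioo_subset_Icc_self h
  have hsub₁ : ∀ {ε}, ε ∈ Ioo (-δ) δ → ε ∈ Icc (-δ₁) δ₁ := fun h ↦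
    ⟨by linarith [h.1], by linarith [h.2]⟩
  refine ⟨B, δ, X, hφ, fun t ↦ B.nonneg, B.one_of_mem_closedBall (by simp [hB]; positivity),
    fun t ht ↦ (hball t (hsupp ht)).1.2, hsrc, ⟨hδ, hX0, ?_, fun ε hε ↦ ⟨?_, fun t ht h0 ↦ ?_⟩,
      fun ε hε ↦ ?_, fun ε hε ↦ ?_⟩, fun ε hε ↦ ⟨?_, ?_⟩, fun δ' hδ' hδ'δ t ht ↦ ?_⟩
  · exact hX.mono fun z hz ↦ ⟨hsub₁ hz.1, hz.2⟩
  · exact smooth_slice hab hX (hsub₁ hε)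
  · rw [velocity_eq_strip hab hX (hsub₁ hε) ht] at h0
    refine hne (ε, t) ⟨hsub hε, ht⟩ ?_
    rw [h0]
    simp
  · exact unitTangent_congr haI (hgerm ε a ha')
  · exact unitTangent_congr hbI (hgerm ε b hb')
  · exact principalNormal_congr haI (hgerm ε a ha')
  · exact principalNormal_congr hbI (hgerm ε b hb')
  · exact pvel_bumpVariation hsrc hφ hx.smooth hδ'
      (fun z hz ↦ htar z (strip_mono (by linarith) hz)) ht

/-! ### Critical curves -/

section Critical

variable {g : Metric3 M} {δ a b : ℝ}

lemma IsVariation.mono {x : ℝ → M} {X : ℝ → ℝ → M} (hX : IsVariation g a b x δ X) {δ' : ℝ}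
    (hδ' : 0 < δ') (h : δ' ≤ δ) : IsVariation g a b x δ' X :=
  have hsub : Ioo (-δ') δ' ⊆ Ioo (-δ) δ := Ioo_subset_Ioo (by linarith) h
  ⟨hδ', hX.zero, hX.smooth.mono (prod_mono hsub Subset.rfl), fun ε hε ↦ hX.regular ε (hsub hε),
    fun ε hε ↦ hX.left ε (hsub hε), fun ε hε ↦ hX.right ε (hsub hε)⟩

/-- The derivative in t within either strip is the velocity of the slice, so shrinking the range of
ε does not affect it. -/
lemma IsAdaptedFrame.mono_strip {X : ℝ → ℝ → M}
    {E : ∀ z : ℝ × ℝ, Fin 3 → TangentSpace (𝓡 3) (X z.1 z.2)} (hab : a < b)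
    (hE : IsAdaptedFrame g (fun z : ℝ × ℝ ↦ X z.1 z.2) (strip δ a b) (0, 1) E) {δ' : ℝ}
    (h : δ' ≤ δ) : IsAdaptedFrame g (fun z : ℝ × ℝ ↦ X z.1 z.2) (strip δ' a b) (0, 1) E := by
  have hsub := strip_mono (a := a) (b := b) h
  have hv : ∀ z ∈ strip δ' a b, pvel (fun z : ℝ × ℝ ↦ X z.1 z.2) (strip δ' a b) (0, 1) z =
      pvel (fun z : ℝ × ℝ ↦ X z.1 z.2) (strip δ a b) (0, 1) z := fun z hz ↦
    (velocity_eq_strip hab (hE.base.mono hsub) hz.1 hz.2).symm.trans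
      (velocity_eq_strip hab hE.base (hsub hz).1 hz.2)
  refine ⟨fun i ↦ (hE.smooth i).mono hsub, fun z hz ↦ hE.orthonormal z (hsub hz),
    fun z hz ↦ ?_, fun z hz ↦ ?_⟩
  · rw [hv z hz]; exact hE.pvel_ne z (hsub hz)
  · rw [hv z hz]; exact hE.tangent z (hsub hz)

/-- An adapted frame over the rectangle of a variation, constant at the ends and positively
oriented. -/
structure IsVariationFrame (g : Metric3 M) (a b δ : ℝ) (X : ℝ → ℝ → M)
    (F : ∀ t, Fin 3 → TangentSpace (𝓡 3) (X 0 t))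
    (E : ∀ z : ℝ × ℝ, Fin 3 → TangentSpace (𝓡 3) (X z.1 z.2)) : Prop where
  pos : 0 < δ
  adapted : IsAdaptedFrame g (fun z : ℝ × ℝ ↦ X z.1 z.2) (strip δ a b) (0, 1) E
  left : ∀ ε ∈ Icc (-δ) δ, ∀ i,
    (⟨X ε a, E (ε, a) i⟩ : TangentBundle (𝓡 3) M) = ⟨X 0 a, E (0, a) i⟩
  right : ∀ ε ∈ Icc (-δ) δ, ∀ i,
    (⟨X ε b, E (ε, b) i⟩ : TangentBundle (𝓡 3) M) = ⟨X 0 b, E (0, b) i⟩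
  oriented : ∀ t ∈ Icc a b, 0 < det3 g (F t) (E (0, t) 0) (E (0, t) 1) (E (0, t) 2)

/-- The range of ε is first halved, to replace the open interval of the variation by a closed one.
If the initial curve has no points of zero curvature, this persists on a thinner strip, which is
what the torsion formula requires. -/
lemma IsVariation.exists_frame {X : ℝ → ℝ → M} (hab : a < b) (hX : IsVariation g a b (X 0) δ X)
    {F : ∀ t, Fin 3 → TangentSpace (𝓡 3) (X 0 t)} (hF : IsFrameAlong g a b (X 0) F) :
    ∃ δ' E, δ' < δ ∧ IsVariationFrame g a b δ' X F E ∧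
      ((∀ t ∈ Icc a b, cross g (F t) (velocity a b (X 0) t) (accel g a b (X 0) t) ≠ 0) →
        ∀ z ∈ strip δ' a b, g.inner (X z.1 z.2) (accel g a b (X z.1) z.2) (E z 0) ^ 2
          + g.inner (X z.1 z.2) (accel g a b (X z.1) z.2) (E z 1) ^ 2 ≠ 0) := by
  have hpos := hX.pos
  have hI : ∀ {δ' ε}, δ' ≤ δ / 2 → ε ∈ Icc (-δ') δ' → ε ∈ Ioo (-δ) δ := fun h hε ↦
    ⟨by linarith [hε.1], by linarith [hε.2]⟩
  obtain ⟨δ₁, E, hδ₁, hδ₁δ, hE, hends, hor⟩ := exists_adaptedFrame g (half_pos hpos) hab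
    (hX.smooth.mono fun z hz ↦ ⟨hI le_rfl hz.1, hz.2⟩)
    (fun ε hε ↦ (hX.regular ε (hI le_rfl hε)).velocity_ne) hF
  have hframe : ∀ δ', 0 < δ' → δ' ≤ δ₁ → IsVariationFrame g a b δ' X F E := fun δ' h0 h ↦
    ⟨h0, hE.mono_strip hab h, fun ε hε ↦ hends ε a (hX.left ε (hI (h.trans hδ₁δ) hε)),
      fun ε hε ↦ hends ε b (hX.right ε (hI (h.trans hδ₁δ) hε)), hor⟩
  by_cases hc : ∀ t ∈ Icc a b, cross g (F t) (velocity a b (X 0) t) (accel g a b (X 0) t) ≠ 0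
  · obtain ⟨δ₂, hδ₂, hδ₂₁, hne⟩ := exists_strip_ne_zero hδ₁
      (((contDiffOn_accel_comp hδ₁ hab hE 0).continuousOn.pow 2).add
        ((contDiffOn_accel_comp hδ₁ hab hE 1).continuousOn.pow 2)) fun t ht h0 ↦ by
        have h1 := normalPart_accel_ne_zero (hc t ht)
        rw [(hE.slice hab (zero_mem_Icc hδ₁)).normalPart_eq ht] at h1
        have h2 : g.inner (X 0 t) (accel g a b (X 0) t) (E (0, t) 0) ^ 2
          + g.inner (X 0 t) (accel g a b (X 0) t) (E (0, t) 1) ^ 2 = 0 := h0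
        have h3 : g.inner (X 0 t) (accel g a b (X 0) t) (E (0, t) 0) = 0 := by
          have := sq_nonneg (g.inner (X 0 t) (accel g a b (X 0) t) (E (0, t) 1))
          nlinarith
        have h4 : g.inner (X 0 t) (accel g a b (X 0) t) (E (0, t) 1) = 0 := by
          rw [h3] at h2; simpa using h2
        exact h1 (by rw [h3, h4]; simp)
    exact ⟨δ₂, E, by linarith, hframe δ₂ hδ₂ hδ₂₁, fun _ ↦ hne⟩
  · exact ⟨δ₁, E, by linarith, hframe δ₁ hδ₁ le_rfl, fun h ↦ absurd h hc⟩

variable {X : ℝ → ℝ → M} {F : ∀ t, Fin 3 → TangentSpace (𝓡 3) (X 0 t)}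
  {E : ∀ z : ℝ × ℝ, Fin 3 → TangentSpace (𝓡 3) (X z.1 z.2)}

namespace IsVariationFrame

variable (hE : IsVariationFrame g a b δ X F E) (hab : a < b)
include hE hab

lemma slice_zero : IsAdaptedFrame g (X 0) (Icc a b) 1 (fun t ↦ E (0, t)) :=
  hE.adapted.slice hab (zero_mem_Icc hE.pos)

lemma exists_isRotation {t : ℝ} (ht : t ∈ Icc a b) {A : Fin 3 → TangentSpace (𝓡 3) (X 0 t)}
    (hA : IsOrthonormal g A) (hA2 : A 2 = unitTangent g a b (X 0) t)
    (hFA : SameOrientation (F t) A) : ∃ α, IsRotation α (E (0, t)) A :=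
  exists_isRotation_of_sameOrientation g ((hE.slice_zero hab).orthonormal t ht) hA
    (hA2.trans ((hE.slice_zero hab).unitTangent_eq ht)) (hE.oriented t ht) hFA

/-- The integral of the connection form is stationary along variations of conformal geodesics. -/
lemma hasDerivAt_zero (hx : IsConformalGeodesic g a b (X 0)) :
    HasDerivAt (fun ε ↦ ∫ t in a..b, frameConn g (fun z : ℝ × ℝ ↦ X z.1 z.2) (strip δ a b) (0, 1)
      E 0 1 (ε, t)) 0 0 := by
  have h := hasDerivAt_integral_frameConn hE.pos hab hE.adapted hE.left hE.right
  refine h.congr_deriv ?_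
  rw [intervalIntegral.integral_congr (g := fun _ ↦ (0 : ℝ))]
  · simp
  · intro t ht
    rw [uIcc_of_le hab.le] at ht
    obtain ⟨h0, h1⟩ := (wedgeEqZero_iff (hE.slice_zero hab) ht (geodesicDefect g a b (X 0) t)).1
      (hx.2 t ht)
    beta_reduce
    rw [h0, h1]
    simp

/-- A real lift of the total torsion. -/
lemma isTotalTorsion {A : Fin 3 → TangentSpace (𝓡 3) (X 0 a)}
    {B : Fin 3 → TangentSpace (𝓡 3) (X 0 b)} {α β : ℝ} (hα : IsRotation α (E (0, a)) A)
    (hβ : IsRotation β (E (0, b)) B) :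
    ∀ᶠ ε in 𝓝 0, IsTotalTorsion g a b (X ε) A B ((α - β - ∫ t in a..b,
      frameConn g (fun z : ℝ × ℝ ↦ X z.1 z.2) (strip δ a b) (0, 1) E 0 1 (ε, t) : ℝ) :
        Real.Angle) := by
  filter_upwards [Icc_mem_nhds (neg_lt_zero.2 hE.pos) hE.pos] with ε hε
  have h := isTotalTorsion_of_frame hab (hE.adapted.slice hab hε) hα hβ (hE.left ε hε)
    (hE.right ε hε)
  rwa [intervalIntegral.integral_congr (g := fun t ↦
    frameConn g (fun z : ℝ × ℝ ↦ X z.1 z.2) (strip δ a b) (0, 1) E 0 1 (ε, t))] at h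
  intro t ht
  rw [uIcc_of_le hab.le] at ht
  exact frameConn_slice hE.pos hab hE.adapted hε ht 0 1

lemma isFrameAlong {ε : ℝ} (hε : ε ∈ Icc (-δ) δ) :
    IsFrameAlong g a b (X ε) (fun t ↦ E (ε, t)) :=
  ⟨fun i ↦ ((hE.adapted.slice hab hε).smooth i).continuousOn,
    (hE.adapted.slice hab hε).orthonormal⟩

omit hab in
lemma sameOrientation {A : Fin 3 → TangentSpace (𝓡 3) (X 0 a)} (hA2 : A 2 = E (0, a) 2) {α : ℝ}
    (hα : IsRotation α (E (0, a)) A) {ε : ℝ} (hε : ε ∈ Icc (-δ) δ) :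
    SameOrientation (E (ε, a)) A := by
  have hsq := Real.sin_sq_add_cos_sq α
  -- The inverse rotation, expressing E in terms of A.
  refine ⟨!![Real.cos α, -Real.sin α, 0; Real.sin α, Real.cos α, 0; 0, 0, 1], ?_, fun i ↦ ?_⟩
  · have : Matrix.det !![Real.cos α, -Real.sin α, 0; Real.sin α, Real.cos α, 0; 0, 0, 1] = 1 := by
      rw [Matrix.det_fin_three]
      simp
      linarith
    rw [this]; exact one_pos
  · rw [hE.left ε hε i]
    congr 1
    rw [Fin.sum_univ_three, hα.1, hα.2, hA2]
    fin_cases i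
    · simp
      match_scalars
      · linear_combination -hsq
      · ring
    · simp
      match_scalars
      · linear_combination -hsq
      · ring
    · simp

end IsVariationFrame

/-- Both sides are the determinant of u, v and the common last vector, which depends only on the
orientation. A sign computed in a frame chosen beforehand along x thus carries over to the frame of
any variation. -/
lemma oriented_minor_eq {p : M} {F E E' : Fin 3 → TangentSpace (𝓡 3) p} (hE : IsOrthonormal g E)
    (hE' : IsOrthonormal g E') (h : 0 < det3 g F (E 0) (E 1) (E 2))
    (h' : 0 < det3 g F (E' 0) (E' 1) (E' 2)) (h2 : E 2 = E' 2) (u v : TangentSpace (𝓡 3) p) :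
    g.inner p u (E 0) * g.inner p v (E 1) - g.inner p u (E 1) * g.inner p v (E 0) =
      g.inner p u (E' 0) * g.inner p v (E' 1) - g.inner p u (E' 1) * g.inner p v (E' 0) := by
  have key : ∀ {E : Fin 3 → TangentSpace (𝓡 3) p}, IsOrthonormal g E → det3 g E u v (E 2) =
      g.inner p u (E 0) * g.inner p v (E 1) - g.inner p u (E 1) * g.inner p v (E 0) := by
    intro E hE
    rw [det3_eq, hE 0 2, hE 1 2, hE 2 2]
    simp only [g.symm p (E _) u, g.symm p (E _) v]
    simp
    ring
  rw [det3_eq_det_mul g hE] at h'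
  have h1 : det3 g E (E' 0) (E' 1) (E' 2) = 1 := by
    have h3 := pos_of_mul_pos_right h' h.le
    have h4 := det3_mul_self g hE hE'
    nlinarith
  rw [← key hE, ← key hE', det3_eq_det_mul g hE', h1, one_mul, h2]

/-- A regular curve which is not a conformal geodesic has a variation, trivial near the ends, along
which the integral of the connection form is not stationary. -/
lemma exists_noncritical_variation (hab : a < b) {x : ℝ → M} (hx : IsRegularCurve a b x)
    {F : ∀ t, Fin 3 → TangentSpace (𝓡 3) (x t)} (hF : IsFrameAlong g a b x F)
    (hnot : ¬IsConformalGeodesic g a b x) :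
    ∃ δ X, IsVariation g a b x δ X ∧ FixesPrincipalNormals g a b x δ X ∧
      ∀ F' : ∀ t, Fin 3 → TangentSpace (𝓡 3) (X 0 t),
        (∀ t i, (⟨X 0 t, F' t i⟩ : TangentBundle (𝓡 3) M) = ⟨x t, F t i⟩) →
        ∀ δ' E, δ' < δ → IsVariationFrame g a b δ' X F' E →
          ¬HasDerivAt (fun ε ↦ ∫ t in a..b, frameConn g (fun z : ℝ × ℝ ↦ X z.1 z.2)
            (strip δ' a b) (0, 1) E 0 1 (ε, t)) 0 0 := by
  -- The constant family is used to obtain an adapted frame along x itself.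
  obtain ⟨δ₀, E, hδ₀, -, hE, -, hEF⟩ := exists_adaptedFrame g (X := fun _ ↦ x) one_pos hab
    (by
      have h1 : ContMDiffOn 𝓘(ℝ, ℝ × ℝ) 𝓘(ℝ, ℝ) ∞ (fun z : ℝ × ℝ ↦ z.2) (strip 1 a b) :=
        contDiff_snd.contDiffOn.contMDiffOn
      exact hx.smooth.comp h1 fun z hz ↦ hz.2)
    (fun _ _ ↦ hx.velocity_ne) hF
  have hE0 := IsAdaptedFrame.slice (X := fun _ ↦ x) hab hE (zero_mem_Icc hδ₀)
  set E₀ : ∀ t, Fin 3 → TangentSpace (𝓡 3) (x t) := fun t ↦ E (0, t) with hE₀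
  set J : Fin 3 → ℝ → ℝ := fun i t ↦ g.inner (x t) (geodesicDefect g a b x t) (E₀ t i) with hJ
  have hJc : ∀ i : Fin 3, i ≠ 2 → ContinuousOn (J i) (Icc a b) := fun i hi ↦
    continuousOn_geodesicDefect hab hE0 hi
  -- By continuity, a defect that is tangent on the open interval is tangent on the closed one, so a
  -- failure can be found at an interior time.
  obtain ⟨t₀, ht₀, hJt₀⟩ : ∃ t₀ ∈ Ioo a b, ¬(J 0 t₀ = 0 ∧ J 1 t₀ = 0) := by
    by_contra! hcon
    have hz : ∀ i : Fin 3, i ≠ 2 → EqOn (J i) 0 (Ioo a b) → EqOn (J i) 0 (Icc a b) := by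
      intro i hi h
      exact h.of_subset_closure (hJc i hi) continuousOn_const Ioo_subset_Icc_self
        (by rw [closure_Ioo hab.ne])
    refine hnot ⟨hx, fun t ht ↦ (wedgeEqZero_iff hE0 ht (geodesicDefect g a b x t)).2 ⟨?_, ?_⟩⟩
    · exact hz 0 (by decide) (fun s hs ↦ (hcon s hs).1) ht
    · exact hz 1 (by decide) (fun s hs ↦ (hcon s hs).2) ht
  have ht₀' := Ioo_subset_Icc_self ht₀
  -- With W = J₁ E₀ - J₀ E₁ at t₀, the quantity W₀ J₁ - W₁ J₀ equals J₀² + J₁² > 0 there.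
  set w : E3 := toCoord (x t₀) (x t₀) (J 1 t₀ • E₀ t₀ 0 - J 0 t₀ • E₀ t₀ 1) with hw
  set Z : ∀ t, TangentSpace (𝓡 3) (x t) := fun t ↦ fromCoord (x t₀) (x t) w with hZ
  have hs₀ := mem_source_self (x t₀)
  have hZs : SmoothFieldAt x Z (Icc a b) t₀ := by
    refine (smoothFieldAt_iff (hx.smooth t₀ ht₀') ht₀' hs₀).2 ?_
    refine (contDiffWithinAt_const (c := w)).congr_of_eventuallyEq_of_mem ?_ ht₀'
    filter_upwards [eventually_mem_source (hx.smooth t₀ ht₀').continuousWithinAt hs₀] with t ht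
    exact toCoord_fromCoord ht w
  set Q : ℝ → ℝ := fun t ↦ g.inner (x t) (Z t) (E₀ t 0) * J 1 t - g.inner (x t) (Z t) (E₀ t 1) * J 0 t
    with hQ
  have hQc : ContinuousWithinAt Q (Icc a b) t₀ :=
    ((smoothFieldAt_inner g hZs (hE0.smooth 0 t₀ ht₀')).continuousWithinAt.mul
      (hJc 1 (by decide) t₀ ht₀')).sub
    ((smoothFieldAt_inner g hZs (hE0.smooth 1 t₀ ht₀')).continuousWithinAt.mul
      (hJc 0 (by decide) t₀ ht₀'))
  have hQpos : 0 < Q t₀ := by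
    have hZ₀ : Z t₀ = J 1 t₀ • E₀ t₀ 0 - J 0 t₀ • E₀ t₀ 1 := fromCoord_toCoord hs₀ _
    have ho := hE0.orthonormal t₀ ht₀'
    have e0 : g.inner (x t₀) (Z t₀) (E₀ t₀ 0) = J 1 t₀ := by
      rw [hZ₀]
      simp only [map_sub, map_smul, sub_apply, smul_apply]
      rw [ho 0 0, ho 1 0]
      simp
    have e1 : g.inner (x t₀) (Z t₀) (E₀ t₀ 1) = -J 0 t₀ := by
      rw [hZ₀]
      simp only [map_sub, map_smul, sub_apply, smul_apply]
      rw [ho 0 1, ho 1 1]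
      simp
    simp only [hQ]
    rw [e0, e1]
    rcases not_and_or.1 hJt₀ with h | h
    · have := mul_self_pos.2 h
      nlinarith [mul_self_nonneg (J 1 t₀)]
    · have := mul_self_pos.2 h
      nlinarith [mul_self_nonneg (J 0 t₀)]
  have hU : {t | t ∈ Icc a b → 0 < Q t} ∈ 𝓝 t₀ :=
    eventually_nhdsWithin_iff.1 (hQc.eventually (lt_mem_nhds hQpos))
  obtain ⟨φ, δ, X, -, hφ0, hφ1, hφU, -, hX, hfix, hW⟩ := exists_local_variation g hab hx ht₀ hU w
  refine ⟨δ, X, hX, hfix, ?_⟩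
  obtain rfl := hX.zero
  intro F' hF' δ' E' hδ' hE' hder
  have hFF' : F' = F := by
    ext1 t; ext1 i
    simpa using hF' t i
  subst hFF'
  have hEs := hE'.slice_zero hab
  have h1 := hasDerivAt_integral_frameConn hE'.pos hab hE'.adapted hE'.left hE'.right
  have h2 := h1.unique hder
  have hcomp : ∀ t ∈ Icc a b, ∀ i, frameComp g (fun z : ℝ × ℝ ↦ X z.1 z.2)
      (pvel (fun z : ℝ × ℝ ↦ X z.1 z.2) (strip δ' a b) (1, 0)) E' i (0, t) =
        φ t * g.inner (X 0 t) (Z t) (E' (0, t) i) := by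
    intro t ht i
    rw [frameComp, hW δ' hE'.pos hδ' t ht, map_smul, smul_apply, smul_eq_mul]
  have hval : ∀ t ∈ Icc a b, ((len g (velocity a b (X 0) t)) ^ 2)⁻¹ *
        (frameComp g _ (pvel (fun z : ℝ × ℝ ↦ X z.1 z.2) (strip δ' a b) (1, 0)) E' 0 (0, t) *
          g.inner (X 0 t) (geodesicDefect g a b (X 0) t) (E' (0, t) 1)
        - frameComp g _ (pvel (fun z : ℝ × ℝ ↦ X z.1 z.2) (strip δ' a b) (1, 0)) E' 1 (0, t) *
          g.inner (X 0 t) (geodesicDefect g a b (X 0) t) (E' (0, t) 0)) =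
      ((len g (velocity a b (X 0) t)) ^ 2)⁻¹ * (φ t * Q t) := by
    intro t ht
    have h3 := oriented_minor_eq (hEs.orthonormal t ht) (hE0.orthonormal t ht) (hE'.oriented t ht)
      (hEF t ht) ((hEs.unitTangent_eq ht).symm.trans (hE0.unitTangent_eq ht)) (Z t)
      (geodesicDefect g a b (X 0) t)
    rw [hcomp t ht, hcomp t ht]
    simp only [hQ, hJ]
    rw [← h3]
    ring
  -- The integrand is v⁻² φ Q, which is nonnegative because Q > 0 on the support of φ, and it is
  -- positive at t₀.
  refine absurd h2 (ne_of_gt (intervalIntegral.integral_pos hab ?_ ?_ ?_))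
  · have hWs := smoothField_pvel (uniqueDiffOn_strip hE'.pos hab) hE'.adapted.base (1, 0)
    have hc := fun i ↦ continuousOn_slice
      (contDiffOn_frameComp g hE'.adapted.smooth hWs i).continuousOn (zero_mem_Icc hE'.pos)
    have hl := (hEs.contDiffOn_speed (uniqueDiffOn_Icc hab)).continuousOn
    refine ContinuousOn.mul ((hl.pow 2).inv₀ fun t ht ↦
      pow_ne_zero 2 (len_pos g (hEs.pvel_ne t ht)).ne') ?_
    exact ((hc 0).mul (continuousOn_geodesicDefect hab hEs (by decide))).sub
      ((hc 1).mul (continuousOn_geodesicDefect hab hEs (by decide)))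
  · intro t ht
    have ht' := Ioc_subset_Icc_self ht
    rw [hval t ht']
    by_cases htφ : t ∈ tsupport φ
    · have := hφU htφ ht'
      have := hφ0 t
      positivity
    · simp [image_eq_zero_of_notMem_tsupport htφ]
  · refine ⟨t₀, ht₀', ?_⟩
    rw [hval t₀ ht₀', hφ1]
    have := len_pos g (hx.velocity_ne t₀ ht₀')
    positivity

end Critical

/-! ### The equivalences -/

section Main

variable {g : Metric3 M} {a b : ℝ} (hab : a < b) {x : ℝ → M} (hx : IsRegularCurve a b x)
  {F : ∀ t, Fin 3 → TangentSpace (𝓡 3) (x t)} (hF : IsFrameAlong g a b x F)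
  {A : Fin 3 → TangentSpace (𝓡 3) (x a)} (hA : IsOrthonormal g A)
  (hA_or : SameOrientation (F a) A) (hA_tan : A 2 = unitTangent g a b x a)
  {B : Fin 3 → TangentSpace (𝓡 3) (x b)} (hB : IsOrthonormal g B)
  (hB_or : SameOrientation (F b) B) (hB_tan : B 2 = unitTangent g a b x b)
include hab hx hF hA hA_or hA_tan hB hB_or hB_tan

theorem isConformalGeodesic_iff_isCriticalForTotalTorsion :
    IsConformalGeodesic g a b x ↔ IsCriticalForTotalTorsion g a b x A B := by
  have haI : a ∈ Icc a b := left_mem_Icc.2 hab.le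
  have hbI : b ∈ Icc a b := right_mem_Icc.2 hab.le
  constructor
  · intro hcg δ X hX
    obtain rfl := hX.zero
    obtain ⟨δ', E, -, hE, -⟩ := hX.exists_frame hab hF
    obtain ⟨α, hα⟩ := hE.exists_isRotation hab haI hA hA_tan hA_or
    obtain ⟨β, hβ⟩ := hE.exists_isRotation hab hbI hB hB_tan hB_or
    refine ⟨_, hE.isTotalTorsion hab hα hβ, ?_⟩
    simpa using (hE.hasDerivAt_zero hab hcg).const_sub (α - β)
  · intro hcrit
    by_contra hnot
    obtain ⟨δ, X, hX, -, hnc⟩ := exists_noncritical_variation hab hx hF hnot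
    obtain ⟨f, hf, hf0⟩ := hcrit δ X hX
    obtain rfl := hX.zero
    obtain ⟨δ', E, hδ', hE, -⟩ := hX.exists_frame hab hF
    obtain ⟨α, hα⟩ := hE.exists_isRotation hab haI hA hA_tan hA_or
    obtain ⟨β, hβ⟩ := hE.exists_isRotation hab hbI hB hB_tan hB_or
    have hD := hasDerivAt_integral_frameConn hE.pos hab hE.adapted hE.left hE.right
    -- Total torsion is unique, so the lift f agrees modulo 2π with the explicit lift α - β - ∫ ω₀₁,
    -- and both have the same derivative.
    have h1 := deriv_eq_of_angle_eventuallyEq (hD.const_sub (α - β)) hf0 (by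
      filter_upwards [hf, hE.isTotalTorsion hab hα hβ] with ε h1 h2
      exact h2.unique hab hA hB h1)
    rw [neg_eq_zero.1 h1] at hD
    exact hnc F (fun _ _ ↦ rfl) δ' E hδ' hE hD

variable (hcross : ∀ t ∈ Icc a b, cross g (F t) (velocity a b x t) (accel g a b x t) ≠ 0)
include hcross

theorem IsConformalGeodesic.isCriticalForTorsionIntegral (hcg : IsConformalGeodesic g a b x) :
    IsCriticalForTorsionIntegral g a b x A (FixesNormalAngle g a b A B) := by
  have haI : a ∈ Icc a b := left_mem_Icc.2 hab.le
  have hbI : b ∈ Icc a b := right_mem_Icc.2 hab.le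
  rintro δ X hX ⟨c, hc⟩ F' hF'
  obtain rfl := hX.zero
  obtain ⟨δ', E, hδ', hE, hne⟩ := hX.exists_frame hab hF
  have hI : ∀ {ε}, ε ∈ Icc (-δ') δ' → ε ∈ Ioo (-δ) δ := fun hε ↦
    ⟨by linarith [hε.1], by linarith [hε.2]⟩
  obtain ⟨α, hα⟩ := hE.exists_isRotation hab haI hA hA_tan hA_or
  obtain ⟨β, hβ⟩ := hE.exists_isRotation hab hbI hB hB_tan hB_or
  exact hasDerivAt_torsionIntegral hE.pos hab hE.adapted hE.left hE.right hA
    (hA_tan.trans ((hE.slice_zero hab).unitTangent_eq haI)) hα hβ (hne hcross)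
    (fun ε hε ↦ hF' ε (hI hε)) (fun ε hε ↦ hc ε (hI hε)) (hE.hasDerivAt_zero hab hcg)

theorem isConformalGeodesic_of_isCriticalForTorsionIntegral
    (hcrit : IsCriticalForTorsionIntegral g a b x A (FixesPrincipalNormals g a b x)) :
    IsConformalGeodesic g a b x := by
  have haI : a ∈ Icc a b := left_mem_Icc.2 hab.le
  have hbI : b ∈ Icc a b := right_mem_Icc.2 hab.le
  by_contra hnot
  obtain ⟨δ, X, hX, hfix, hnc⟩ := exists_noncritical_variation hab hx hF hnot
  obtain rfl := hX.zero
  obtain ⟨δ', E, hδ', hE, hne⟩ := hX.exists_frame hab hF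
  have hI : ∀ {ε}, ε ∈ Icc (-δ') δ' → ε ∈ Ioo (-δ) δ := fun hε ↦
    ⟨by linarith [hε.1], by linarith [hε.2]⟩
  obtain ⟨α, hα⟩ := hE.exists_isRotation hab haI hA hA_tan hA_or
  obtain ⟨β, hβ⟩ := hE.exists_isRotation hab hbI hB hB_tan hB_or
  have hA2 := hA_tan.trans ((hE.slice_zero hab).unitTangent_eq haI)
  obtain ⟨c, hc⟩ := FixesPrincipalNormals.fixesNormalAngle g hab hx.velocity_ne hcross hA hA_tan hB
    hB_tan hfix
  have hD := hasDerivAt_integral_frameConn hE.pos hab hE.adapted hE.left hE.right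
  -- The adapted frame itself serves to represent the orientation along each curve.
  have hEF : ∀ ε ∈ Icc (-δ') δ', IsFrameAlong g a b (X ε) (fun t ↦ E (ε, t)) ∧
      SameOrientation (E (ε, a)) A := fun ε hε ↦
    ⟨hE.isFrameAlong hab hε, hE.sameOrientation hA2 hα hε⟩
  have h1 := hasDerivAt_torsionIntegral hE.pos hab hE.adapted hE.left hE.right hA hA2 hα hβ
    (hne hcross) (F := fun ε t ↦ E (ε, t)) hEF (fun ε hε ↦ hc ε (hI hε)) hD
  have h2 := hcrit δ' X (hX.mono hE.pos hδ'.le)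
    (fun ε hε ↦ hfix ε (hI (Ioo_subset_Icc_self hε))) (fun ε t ↦ E (ε, t))
    (fun ε hε ↦ hEF ε (Ioo_subset_Icc_self hε))
  rw [h1.unique h2] at hD
  exact hnc F (fun _ _ ↦ rfl) δ' E hδ' hE hD

end Main

end ConfGeod

end

open ConfGeod in
theorem theorem1p2 {M : Type*} [TopologicalSpace M] [T2Space M] [SecondCountableTopology M]
    [ChartedSpace E3 M] [IsManifold (𝓡 3) ∞ M] (g : Metric3 M)
    (a b : ℝ) (hab : a < b) (x : ℝ → M) (hx : IsRegularCurve a b x)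
    -- an orientation along the curve
    (F : ∀ t, Fin 3 → TangentSpace (𝓡 3) (x t)) (hF : IsFrameAlong g a b x F)
    -- oriented orthonormal bases at the endpoints, adapted to the curve
    (A : Fin 3 → TangentSpace (𝓡 3) (x a)) (hA : IsOrthonormal g A)
    (hA_or : SameOrientation (F a) A) (hA_tan : A 2 = unitTangent g a b x a)
    (B : Fin 3 → TangentSpace (𝓡 3) (x b)) (hB : IsOrthonormal g B)
    (hB_or : SameOrientation (F b) B) (hB_tan : B 2 = unitTangent g a b x b) :
    (IsConformalGeodesic g a b x ↔ IsCriticalForTotalTorsion g a b x A B) ∧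
    ((∀ t ∈ Icc a b, cross g (F t) (velocity a b x t) (accel g a b x t) ≠ 0) →
      (IsConformalGeodesic g a b x ↔
        IsCriticalForTorsionIntegral g a b x A (FixesNormalAngle g a b A B)) ∧
      (IsConformalGeodesic g a b x ↔
        IsCriticalForTorsionIntegral g a b x A (FixesPrincipalNormals g a b x))) := by
  refine ⟨isConformalGeodesic_iff_isCriticalForTotalTorsion hab hx hF hA hA_or hA_tan hB hB_or
    hB_tan, fun hcross ↦ ?_⟩
  have h1 : IsConformalGeodesic g a b x →
      IsCriticalForTorsionIntegral g a b x A (FixesNormalAngle g a b A B) :=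
    IsConformalGeodesic.isCriticalForTorsionIntegral hab hx hF hA hA_or hA_tan hB hB_or hB_tan hcross
  -- Fixed end normals enclose a fixed angle, so criticality in the larger class implies criticality
  -- in the smaller one. With `h1` and `h3` this closes the cycle of implications.
  have h2 : IsCriticalForTorsionIntegral g a b x A (FixesNormalAngle g a b A B) →
      IsCriticalForTorsionIntegral g a b x A (FixesPrincipalNormals g a b x) :=
    fun h δ X hX hfix ↦ h δ X hX (FixesPrincipalNormals.fixesNormalAngle g hab hx.velocity_ne hcross
      hA hA_tan hB hB_tan hfix)
  have h3 := isConformalGeodesic_of_isCriticalForTorsionIntegral hab hx hF hA hA_or hA_tan hB hB_or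
    hB_tan hcross
  exact ⟨⟨h1, fun h ↦ h3 (h2 h)⟩, ⟨fun h ↦ h2 (h1 h), h3⟩⟩
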